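/- Let $\Gamma\subset\mathbb R^n$ be a bounded connected network made of finitely many straight segments (edges) $\Gamma_\alpha$, $\alpha\in\mathcal A$, of lengths $\ell_\alpha>0$, joining finitely many vertices $\nu_i$, $i\in I$; two distinct edges are either disjoint or meet in a single vertex, and an edge contains no vertex besides its two end points. Each edge is oriented and parametrized by arc length through $\pi_\alpha:[0,\ell_\alpha]\to\Gamma_\alpha$; $\mathcal A_i$ is the set of edges containing $\nu_i$; for a function $v$ on $\Gamma$ put $v_\alpha=v\circ\pi_\alpha$, let $v|_{\Gamma_\alpha}$ be the continuous extension of $v$ to the closed edge (when it exists), let $\partial$ denote the (weak) derivative along the edges, and let $\int_\Gamma v\,dx=\sum_\alpha\int_0^{\ell_\alpha}v_\alpha\,dy$. Let $T>0$, $\mu_\alpha>0$ for $\alpha\in\mathcal A$, and $\gamma_{i\alpha}>0$ for $i\in I,\ \alpha\in\mathcal A_i$, with $\sum_{\alpha\in\mathcal A_i}\gamma_{i\alpha}\mu_\alpha=1$ for all $i\in I$. Let $H^s_b(\Gamma)$ be the space of $v$ with $v_\alpha\in H^s(0,\ell_\alpha)$ for all $\alpha$, with norm $\big(\sum_{k=0}^s\|\partial^k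 v\|_{L^2(\Gamma)}^2\big)^{1/2}$; let $H^s(\Gamma)=C(\Gamma)\cap H^s_b(\Gamma)$, let $V=H^1(\Gamma)$, and let $W$ be the space of $w\in H^1_b(\Gamma)$ such that $w|_{\Gamma_\alpha}(\nu_i)/\gamma_{i\alpha}=w|_{\Gamma_\beta}(\nu_i)/\gamma_{i\beta}$ for all $i\in I$, $\alpha,\beta\in\mathcal A_i$. Functions $u\in L^2(\Gamma)$ are identified with elements of the dual $W'$ through $\langle u,w\rangle=\int_\Gamma uw\,dx$. For $v_T\in L^2(\Gamma)$ and $h\in L^2(0,T;W')$ consider the problem $$-\partial_t v-\mu_\alpha\partial^2 v=h\ \text{ in }(\Gamma_\alpha\setminus\{\nu_i\}_{i\in I})\times(0,T),\ \alpha\in\mathcal A,\qquad v|_{\Gamma_\alpha}(\nu_i,t)=v|_{\Gamma_\beta}(\nu_i,t),\qquad \sum_{\alpha\in\mathcal A_i}\gamma_{i\alpha}\mu_\alpha\partial_\alpha v(\nu_i,t)=0,\qquad v(\cdot,T)=v_T ,$$ for $i\in I$, $\alpha,\beta\in\mathcal A_i$, $t\in(0,T)$, where $\partial_\alpha v(\nu_i,t)$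 is the outward derivative along $\Gamma_\alpha$ at $\nu_i$. A weak solution is a function $v\in L^2(0,T;V)\cap C([0,T];L^2(\Gamma))$ with $\partial_t v\in L^2(0,T;W')$ such that $v(\cdot,T)=v_T$ and, for a.e. $t\in(0,T)$ and all $w\in W$, $$-\langle\partial_t v(t),w\rangle_{W',W}+\sum_{\alpha\in\mathcal A}\int_{\Gamma_\alpha}\mu_\alpha\,\partial v(t)\,\partial w\,dx=\langle h(t),w\rangle_{W',W}.$$ **Theorem.** There is a constant $C>0$, depending only on $\Gamma$, $(\mu_\alpha)$, $(\gamma_{i\alpha})$ and $T$, such that for all $v_T\in V$ and all $h\in L^2(\Gamma\times(0,T))=L^2(0,T;L^2(\Gamma))$ the following holds. The problem has a unique weak solution $v$; it satisfies $v\in L^2(0,T;H^2(\Gamma))\cap C([0,T];V)$ and $\partial_t v\in L^2(0,T;L^2(\Gamma))$, and $$\|v\|_{L^\infty(0,T;V)}+\|v\|_{L^2(0,T;H^2(\Gamma))}+\|\partial_t v\|_{L^2(0,T;L^2(\Gamma))}\le C\big(\|h\|_{L^2(0,T;L^2(\Gamma))}+\|v_T\|_V\big).$$ -/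

import Mathlib

open MeasureTheory Set
open scoped ENNReal NNReal ContDiff

/-- `u'` is the weak (distributional) derivative of `u` on the interval `(a, b)`; the functions may
take values in a Banach space. -/
def HasWeakDerivOn {X : Type*} [NormedAddCommGroup X] [NormedSpace ℝ X]
    (a b : ℝ) (u u' : ℝ → X) : Prop :=
  ∀ ψ : ℝ → ℝ, ContDiff ℝ ∞ ψ → HasCompactSupport ψ → tsupport ψ ⊆ Ioo a b →
    ∫ t in Ioo a b, deriv ψ t • u t = -∫ t in Ioo a b, ψ t • u' t

/-- A bounded network in `ℝⁿ`: finitely many vertices `pos i`, and finitely many edges, the edge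
`α` being the straight segment from `pos (src α)` to `pos (tgt α)` with this orientation. -/
structure Network (n : ℕ) (I A : Type*) [Fintype I] [Fintype A] where
  pos : I → EuclideanSpace ℝ (Fin n)
  src : A → I
  tgt : A → I
  pos_injective : Function.Injective pos
  src_ne_tgt : ∀ α, src α ≠ tgt α
  /-- Two distinct edges are disjoint or meet in a single vertex. -/
  inter_edges : ∀ α β, α ≠ β →
    segment ℝ (pos (src α)) (pos (tgt α)) ∩ segment ℝ (pos (src β)) (pos (tgt β)) = ∅ ∨
    ∃ i, segment ℝ (pos (src α)) (pos (tgt α)) ∩ segment ℝ (pos (src β)) (pos (tgt β)) = {pos i}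
  /-- An edge contains no vertex other than its two end points. -/
  vertex_mem_edge : ∀ i α, pos i ∈ segment ℝ (pos (src α)) (pos (tgt α)) → i = src α ∨ i = tgt α
  /-- Every vertex belongs to some edge. -/
  exists_edge : ∀ i, ∃ α, pos i ∈ segment ℝ (pos (src α)) (pos (tgt α))
  connected : IsConnected (⋃ α, segment ℝ (pos (src α)) (pos (tgt α)))

namespace Network

noncomputable section

variable {n : ℕ} {I A : Type*} [Fintype I] [Fintype A] (N : Network n I A)

/-- The closed edge `Γ_α`. -/
def edge (α : A) : Set (EuclideanSpace ℝ (Fin n)) :=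
  segment ℝ (N.pos (N.src α)) (N.pos (N.tgt α))

/-- The set `Γ`. -/
def carrier : Set (EuclideanSpace ℝ (Fin n)) := ⋃ α, N.edge α

/-- The length `ℓ_α`. -/
def length (α : A) : ℝ := dist (N.pos (N.src α)) (N.pos (N.tgt α))

/-- The arc length parametrization `π_α : [0, ℓ_α] → Γ_α`. -/
def param (α : A) (y : ℝ) : EuclideanSpace ℝ (Fin n) :=
  AffineMap.lineMap (N.pos (N.src α)) (N.pos (N.tgt α)) (y / N.length α)

open Classical in
/-- The set `𝒜_i` of the edges adjacent to the vertex `i`. -/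
def adj (i : I) : Finset A := Finset.univ.filter fun α => N.pos i ∈ N.edge α

open Classical in
/-- The parameter `π_α⁻¹(ν_i)` of the end point `ν_i` of the edge `α`. -/
def endParam (i : I) (α : A) : ℝ := if i = N.src α then 0 else N.length α

/-- The length measure on `Γ`: the integral over `Γ` is the sum over the edges of
`∫_0^{ℓ_α} v(π_α(y)) dy`. -/
def measure : Measure (EuclideanSpace ℝ (Fin n)) :=
  Measure.sum fun α => (volume.restrict (Ioo 0 (N.length α))).map (N.param α)

/-- `L²(Γ)`. -/
abbrev L2 : Type := Lp ℝ 2 N.measure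

/-- Tuples `(v₀, …, v_s)` in `L²(Γ)`, with the norm `(∑ ‖v_k‖²)^{1/2}`. -/
abbrev L2Tuple (s : ℕ) : Type := PiLp 2 fun _ : Fin (s + 1) => N.L2

theorem continuous_param (α : A) : Continuous (N.param α) := by
  unfold param
  exact AffineMap.lineMap_continuous.comp (continuous_id.div_const _)

theorem ae_param {p : EuclideanSpace ℝ (Fin n) → Prop} (h : ∀ᵐ x ∂N.measure, p x) (α : A) :
    ∀ᵐ y ∂volume.restrict (Ioo 0 (N.length α)), p (N.param α y) := by
  have h1 : ∀ᵐ x ∂(volume.restrict (Ioo 0 (N.length α))).map (N.param α), p x :=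
    (Measure.ae_sum_iff.1 h) α
  exact ae_of_ae_map (N.continuous_param α).aemeasurable h1

theorem memLp_param (u : N.L2) (α : A) :
    MemLp (fun y => u (N.param α y)) 2 (volume.restrict (Ioo 0 (N.length α))) := by
  have h1 : MemLp u 2 ((volume.restrict (Ioo 0 (N.length α))).map (N.param α)) :=
    (Lp.memLp u).mono_measure (Measure.le_sum _ α)
  exact h1.comp_of_map (N.continuous_param α).aemeasurable

theorem add_param (u v : N.L2) (α : A) :
    (fun y => (u + v : N.L2) (N.param α y)) =ᵐ[volume.restrict (Ioo 0 (N.length α))]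
      fun y => u (N.param α y) + v (N.param α y) :=
  N.ae_param (Lp.coeFn_add u v) α

theorem smul_param (c : ℝ) (u : N.L2) (α : A) :
    (fun y => (c • u : N.L2) (N.param α y)) =ᵐ[volume.restrict (Ioo 0 (N.length α))]
      fun y => c * u (N.param α y) :=
  N.ae_param (Lp.coeFn_smul c u) α

theorem zero_param (α : A) :
    (fun y => (0 : N.L2) (N.param α y)) =ᵐ[volume.restrict (Ioo 0 (N.length α))] fun _ => 0 :=
  N.ae_param (Lp.coeFn_zero ℝ 2 N.measure) α

theorem integrable_smul_param {g : ℝ → ℝ} (hg : Continuous g) (hc : HasCompactSupport g)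
    (u : N.L2) (α : A) :
    Integrable (fun y => g y • u (N.param α y)) (volume.restrict (Ioo 0 (N.length α))) := by
  have h1 := (N.memLp_param u α).integrable (by norm_num)
  obtain ⟨C, hC⟩ := hc.exists_bound_of_continuous hg
  exact h1.bdd_mul hg.aestronglyMeasurable (Filter.Eventually.of_forall hC)

/-- `u'` is the weak derivative of `u` on every edge. -/
def IsEdgeDeriv (u u' : N.L2) : Prop :=
  ∀ α, HasWeakDerivOn 0 (N.length α) (fun y => u (N.param α y)) (fun y => u' (N.param α y))

theorem IsEdgeDeriv.zero : N.IsEdgeDeriv 0 0 := by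
  intro α ψ _ _ _
  have key : ∀ g : ℝ → ℝ,
      ∫ y in Ioo 0 (N.length α), g y • (0 : N.L2) (N.param α y) = 0 := by
    intro g
    refine integral_eq_zero_of_ae ?_
    filter_upwards [N.zero_param α] with y hy
    rw [hy, smul_zero, Pi.zero_apply]
  rw [key, key, neg_zero]

theorem IsEdgeDeriv.add {u u' v v' : N.L2} (hu : N.IsEdgeDeriv u u') (hv : N.IsEdgeDeriv v v') :
    N.IsEdgeDeriv (u + v) (u' + v') := by
  intro α ψ h1 h2 h3
  have e1 := hu α ψ h1 h2 h3
  have e2 := hv α ψ h1 h2 h3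
  have key : ∀ (g : ℝ → ℝ), Continuous g → HasCompactSupport g → ∀ a b : N.L2,
      ∫ y in Ioo 0 (N.length α), g y • (a + b : N.L2) (N.param α y) =
        (∫ y in Ioo 0 (N.length α), g y • a (N.param α y)) +
          ∫ y in Ioo 0 (N.length α), g y • b (N.param α y) := by
    intro g hg hc a b
    rw [← integral_add (N.integrable_smul_param hg hc a α) (N.integrable_smul_param hg hc b α)]
    refine integral_congr_ae ?_
    filter_upwards [N.add_param a b α] with y hy
    rw [hy, smul_add]
  rw [key _ (h1.continuous_deriv (by simp)) h2.deriv, key _ h1.continuous h2, e1, e2]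
  ring

theorem IsEdgeDeriv.smul (c : ℝ) {u u' : N.L2} (hu : N.IsEdgeDeriv u u') :
    N.IsEdgeDeriv (c • u) (c • u') := by
  intro α ψ h1 h2 h3
  have e1 := hu α ψ h1 h2 h3
  have key : ∀ (g : ℝ → ℝ) (a : N.L2),
      ∫ y in Ioo 0 (N.length α), g y • (c • a : N.L2) (N.param α y) =
        c * ∫ y in Ioo 0 (N.length α), g y • a (N.param α y) := by
    intro g a
    rw [← integral_const_mul]
    refine integral_congr_ae ?_
    filter_upwards [N.smul_param c a α] with y hy
    rw [hy]
    simp only [smul_eq_mul]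
    ring
  rw [key, key, e1]
  ring

/-- `H^s_b(Γ)`: functions that are in `H^s` of every edge. An element is stored together with its
edgewise weak derivatives, as `(v, ∂v, …, ∂ˢv)`, so the norm is the usual one. -/
def Hb (s : ℕ) : Submodule ℝ (N.L2Tuple s) where
  carrier := {p | ∀ k : Fin s, N.IsEdgeDeriv (p k.castSucc) (p k.succ)}
  zero_mem' := fun _ => IsEdgeDeriv.zero N
  add_mem' := fun ha hb k => IsEdgeDeriv.add N (ha k) (hb k)
  smul_mem' := fun c _ ha k => IsEdgeDeriv.smul N c (ha k)

/-- The elements of `L²(Γ)^{s+1}` whose `0`-th component is a continuous function on `Γ`. -/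
def contTuples (s : ℕ) : Submodule ℝ (N.L2Tuple s) where
  carrier := {p | ∃ g : EuclideanSpace ℝ (Fin n) → ℝ,
    ContinuousOn g N.carrier ∧ ∀ᵐ x ∂N.measure, p 0 x = g x}
  zero_mem' := ⟨fun _ => 0, continuousOn_const, Lp.coeFn_zero ℝ 2 N.measure⟩
  add_mem' := by
    rintro a b ⟨f, hf, hf'⟩ ⟨g, hg, hg'⟩
    refine ⟨fun x => f x + g x, hf.add hg, ?_⟩
    filter_upwards [hf', hg', Lp.coeFn_add (a 0) (b 0)] with x h1 h2 h3
    rw [PiLp.add_apply, h3, Pi.add_apply, h1, h2]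
  smul_mem' := by
    rintro c a ⟨f, hf, hf'⟩
    refine ⟨fun x => c * f x, continuousOn_const.mul hf, ?_⟩
    filter_upwards [hf', Lp.coeFn_smul c (a 0)] with x h1 h3
    rw [PiLp.smul_apply, h3, Pi.smul_apply, h1, smul_eq_mul]

/-- `H^s(Γ) = C(Γ) ∩ H^s_b(Γ)`. -/
def H (s : ℕ) : Submodule ℝ (N.L2Tuple s) := N.contTuples s ⊓ N.Hb s

/-- `V = H¹(Γ)`. -/
abbrev V : Submodule ℝ (N.L2Tuple 1) := N.H 1

/-- The space `W` of all `w ∈ H¹_b(Γ)` for which `w|_{Γ_α}(ν_i) / γ_{iα}` does not depend on the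
edge `α ∈ 𝒜_i`; here `w|_{Γ_α}` is the continuous extension of `w` to the closed edge. -/
def W (γ : I → A → ℝ) : Submodule ℝ (N.L2Tuple 1) where
  carrier := {p | p ∈ N.Hb 1 ∧ ∃ g : A → ℝ → ℝ,
    (∀ α, ContinuousOn (g α) (Icc 0 (N.length α)) ∧
      ∀ᵐ y ∂volume.restrict (Ioo 0 (N.length α)), p 0 (N.param α y) = g α y) ∧
    ∀ i, ∀ α ∈ N.adj i, ∀ β ∈ N.adj i,
      g α (N.endParam i α) / γ i α = g β (N.endParam i β) / γ i β}
  zero_mem' := ⟨zero_mem _, fun _ _ => 0, fun α => ⟨continuousOn_const, N.zero_param α⟩,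
    fun _ _ _ _ _ => by simp⟩
  add_mem' := by
    rintro a b ⟨ha, f, hf, hf'⟩ ⟨hb, g, hg, hg'⟩
    refine ⟨add_mem ha hb, fun α y => f α y + g α y, fun α => ⟨(hf α).1.add (hg α).1, ?_⟩, ?_⟩
    · filter_upwards [(hf α).2, (hg α).2, N.add_param (a 0) (b 0) α] with y h1 h2 h3
      rw [PiLp.add_apply, h3, h1, h2]
    · intro i α hα β hβ
      simp only [add_div]
      rw [hf' i α hα β hβ, hg' i α hα β hβ]
  smul_mem' := by
    rintro c a ⟨ha, f, hf, hf'⟩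
    refine ⟨Submodule.smul_mem _ c ha, fun α y => c * f α y,
      fun α => ⟨continuousOn_const.mul (hf α).1, ?_⟩, ?_⟩
    · filter_upwards [(hf α).2, N.smul_param c (a 0) α] with y h1 h3
      rw [PiLp.smul_apply, h3, h1]
    · intro i α hα β hβ
      simp only [mul_div_assoc]
      rw [hf' i α hα β hβ]

/-- The topological dual `W'`. -/
abbrev WDual (γ : I → A → ℝ) : Type := StrongDual ℝ (N.W γ)

/-- The embedding `L²(Γ) → W'`, `⟨u, w⟩ = ∫_Γ u w dx`. -/
def toWDual (γ : I → A → ℝ) (u : N.L2) : N.WDual γ :=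
  (innerSL ℝ u).comp ((PiLp.proj 2 (fun _ : Fin (1 + 1) => N.L2) 0).comp (N.W γ).subtypeL)

theorem toWDual_apply (γ : I → A → ℝ) (u : N.L2) (w : N.W γ) :
    N.toWDual γ u w = ∫ x, u x * (w : N.L2Tuple 1) 0 x ∂N.measure := by
  change inner ℝ u ((w : N.L2Tuple 1) 0) = _
  rw [L2.inner_def]
  refine integral_congr_ae (Filter.Eventually.of_forall fun x => ?_)
  simp [mul_comm]

/-- The bilinear form `ℬ(v, w) = ∑_α ∫_{Γ_α} μ_α ∂v ∂w dx` on `V × W`. -/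
def form (μ : A → ℝ) (γ : I → A → ℝ) (v : N.V) (w : N.W γ) : ℝ :=
  ∑ α, ∫ y in Ioo 0 (N.length α),
    μ α * (v : N.L2Tuple 1) 1 (N.param α y) * (w : N.L2Tuple 1) 1 (N.param α y)

/-- `v` is a weak solution of the backward heat problem on `Γ × (0, T)` with terminal datum
`vT ∈ L²(Γ)` and right-hand side `F ∈ L²(0, T; W')`:
`v ∈ C([0, T]; L²(Γ)) ∩ L²(0, T; V)`, `∂ₜv ∈ L²(0, T; W')`, and
`-⟨∂ₜv(t), w⟩ + ℬ(v(t), w) = ⟨F(t), w⟩` for almost every `t` and all `w ∈ W`, and `v(T) = vT`.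
Here `vV` is `v` as a function with values in `V`, and `v'` is `∂ₜv`. -/
def IsWeakSolution (μ : A → ℝ) (γ : I → A → ℝ) (T : ℝ) (F : ℝ → N.WDual γ) (vT : N.L2)
    (v : ℝ → N.L2) : Prop :=
  ContinuousOn v (Icc 0 T) ∧
  (∃ (vV : ℝ → N.V) (v' : ℝ → N.WDual γ),
    MemLp vV 2 (volume.restrict (Ioo 0 T)) ∧
    (∀ᵐ t ∂volume.restrict (Ioo 0 T), (vV t : N.L2Tuple 1) 0 = v t) ∧
    MemLp v' 2 (volume.restrict (Ioo 0 T)) ∧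
    HasWeakDerivOn 0 T (fun t => N.toWDual γ (v t)) v' ∧
    ∀ᵐ t ∂volume.restrict (Ioo 0 T), ∀ w : N.W γ,
      -(v' t w) + N.form μ γ (vV t) w = F t w) ∧
  v T = vT

end

end Network

/-! ### Backward primitives in time and the energy identity. -/

section TailIntegral

variable {X Y Z : Type*} [NormedAddCommGroup X] [NormedSpace ℝ X]
  [NormedAddCommGroup Y] [NormedSpace ℝ Y]
  [NormedAddCommGroup Z] [NormedSpace ℝ Z]
  {ν : Measure ℝ}

/-! Solutions take values in `V` but are tested against `W`, so the form has no direct coercivity.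
Interpolating `γ` log-linearly along each edge gives a positive weight `ρ`, smooth on every edge,
whose value at the end `ν_i` of `Γ_α` is `γ_{iα}`. Multiplication by `ρ` maps `V` onto `W`
(`weightTuple_mem_W`, `exists_weightTuple_eq`). Testing with `ρ y`, `y ∈ V`, turns the form into `∫
μ ρ ∂v ∂y + ∫ μ ∂ρ ∂v y` (`form_weightTuple`), a symmetric form plus a first-order drift, and the
pairing with `L²(Γ)` into the inner product weighted by `ρ`; multiplication by `√ρ` realises the
latter in plain `L²(Γ)`. Passing from `v` to `exp(lt) v` adds `l` times the weighted inner product.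
The symmetric part becomes coercive, and for large `l` the drift is at most a quarter of the
symmetric elliptic operator (`exists_shift`).

The symmetric problem is solved abstractly, for a coercive form `a` on `V` and an injective dense
embedding `ι : V → H`. Let `N` be the Lax–Milgram operator, `a (N x) y = ⟨x, ι y⟩`. For any `g` and
`x` the function `z(t) = N (x + ∫_t^T g)` is an explicit solution with `f = -∂ₜz = ι N g`, terminal
value `N x` and right-hand side `h = f + x + ∫_t^T g`. The identity `a(z(t), z(t)) = a(z(T), z(T)) +
2 ∫_t^T ⟨h - f, f⟩` (`smoothSolution_energy`) bounds `f` in `L²(H)` and `z` uniformly in `V` by the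
data. Such data are dense (`denseRange_dataMap`), so the solution operator extends by continuity
(`exists_symmetric_solution`). The extension satisfies `‖f‖² ≤ ‖h‖² + a(z(T), z(T))`, which makes
the drift a perturbation of norm at most `1/2`, absorbed by a Neumann series
(`exists_perturbed_solution`).

For uniqueness the equation for the difference of two weak solutions is integrated over `(t, T)`.
The derivative in `W'` disappears, and what remains is an equation in `L²(0,T;V)` with only the zero
solution (`eq_zero_of_perturbed_equation`). Hence every weak solution is the constructed one and
inherits its regularity. The `H²` bound comes from test functions supported inside one edge, which
give `μ_α ∂²v = -(h + ∂ₜv)` (`secondTuple_mem_H`). -/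

theorem integral_bilin_Ioi_swap [CompleteSpace X] [CompleteSpace Y] [CompleteSpace Z] [SFinite ν]
    (B : X →L[ℝ] Y →L[ℝ] Z) {f : ℝ → X} {g : ℝ → Y}
    (hf : Integrable f ν) (hg : Integrable g ν) :
    ∫ s, B (f s) (∫ r in Ioi s, g r ∂ν) ∂ν = ∫ r, B (∫ s in Iio r, f s ∂ν) (g r) ∂ν := by
  have hk : Integrable (fun p : ℝ × ℝ => B (f p.1) (g p.2)) (ν.prod ν) :=
    Integrable.op_fst_snd (op := fun x y => B x y) (by fun_prop) ⟨‖B‖, B.le_opNorm₂⟩ hf hg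
  have hm : MeasurableSet {p : ℝ × ℝ | p.1 < p.2} := measurableSet_lt measurable_fst measurable_snd
  have hi := hk.indicator hm
  have h1 : ∀ s, B (f s) (∫ r in Ioi s, g r ∂ν) =
      ∫ r, ({p : ℝ × ℝ | p.1 < p.2}.indicator (fun p => B (f p.1) (g p.2))) (s, r) ∂ν := by
    intro s
    rw [← ContinuousLinearMap.integral_comp_comm _ hg.restrict, ← integral_indicator measurableSet_Ioi]
    rfl
  have h2 : ∀ r, B (∫ s in Iio r, f s ∂ν) (g r) =
      ∫ s, ({p : ℝ × ℝ | p.1 < p.2}.indicator (fun p => B (f p.1) (g p.2))) (s, r) ∂ν := by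
    intro r
    change B.flip (g r) _ = _
    rw [← ContinuousLinearMap.integral_comp_comm _ hf.restrict, ← integral_indicator measurableSet_Iio]
    rfl
  simp only [h1, h2]
  exact integral_integral_swap (f := fun s r =>
    ({p : ℝ × ℝ | p.1 < p.2}.indicator (fun p => B (f p.1) (g p.2))) (s, r)) hi

theorem continuous_integral_Ioi [CompleteSpace X] [NullSingletonClass ν] {f : ℝ → X} (hf : Integrable f ν) :
    Continuous fun t => ∫ s in Ioi t, f s ∂ν := by
  have h := intervalIntegral.continuous_primitive (μ := ν) (f := f)
    (fun a b => hf.intervalIntegrable) 0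
  have e : (fun t => ∫ s in Ioi t, f s ∂ν) =
      fun t => (∫ s in Ioi 0, f s ∂ν) - ∫ s in (0 : ℝ)..t, f s ∂ν := by
    funext t
    have a1 := intervalIntegral.integral_Iic_sub_Iic (μ := ν) (f := f) (a := 0) (b := t)
      hf.integrableOn hf.integrableOn
    have a2 := intervalIntegral.integral_Iic_add_Ioi (μ := ν) (f := f) (b := t)
      hf.integrableOn hf.integrableOn
    have a3 := intervalIntegral.integral_Iic_add_Ioi (μ := ν) (f := f) (b := 0)
      hf.integrableOn hf.integrableOn
    rw [← a1, eq_sub_iff_add_eq, eq_comm, ← sub_eq_iff_eq_add', ← sub_eq_zero]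
    rw [← a3] at a2
    have : (∫ s in Ioi t, f s ∂ν) = (∫ s in Iic 0, f s ∂ν) + (∫ s in Ioi 0, f s ∂ν) -
      ∫ s in Iic t, f s ∂ν := eq_sub_of_add_eq' a2
    rw [this]; abel
  rw [e]
  exact continuous_const.sub h

theorem norm_integral_Lp_le [IsFiniteMeasure ν] (f : Lp X 2 ν) (S : Set ℝ) :
    ‖∫ s in S, f s ∂ν‖ ≤ (measureUnivNNReal ν : ℝ) ^ (1 / 2 : ℝ) * ‖f‖ := by
  have hm := Lp.memLp f
  have hi : Integrable f ν := hm.integrable (by norm_num)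
  have h1 : ‖∫ s in S, f s ∂ν‖ ≤ ∫ s, ‖f s‖ ∂ν :=
    (norm_integral_le_integral_norm _).trans
      (setIntegral_le_integral hi.norm (Filter.Eventually.of_forall fun _ => norm_nonneg _))
  refine h1.trans ?_
  rw [integral_norm_eq_lintegral_enorm hi.1, ← eLpNorm_one_eq_lintegral_enorm, Lp.norm_def]
  have h2 := eLpNorm_le_eLpNorm_mul_rpow_measure_univ (μ := ν) (f := f) (p := 1) (q := 2)
    (by norm_num) hm.1
  have h3 : eLpNorm f 2 ν * ν univ ^ (1 / (1 : ℝ≥0∞).toReal - 1 / (2 : ℝ≥0∞).toReal) ≠ ⊤ := by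
    refine ENNReal.mul_ne_top hm.2.ne (ENNReal.rpow_ne_top_of_nonneg ?_ (measure_ne_top _ _))
    norm_num
  refine (ENNReal.toReal_mono h3 h2).trans (le_of_eq ?_)
  rw [ENNReal.toReal_mul, mul_comm, ← ENNReal.toReal_rpow]
  congr 2
  norm_num

theorem Lp.integrable_of_finite {E : Type*} [NormedAddCommGroup E] [IsFiniteMeasure ν]
    (f : Lp E 2 ν) : Integrable f ν :=
  (Lp.memLp f).integrable (by norm_num)

/-- The map `f ↦ (t ↦ ∫_{s > t} f s dν)`. -/
noncomputable def tailIntegral (ν : Measure ℝ) [IsFiniteMeasure ν] [NullSingletonClass ν] (X : Type*)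
    [NormedAddCommGroup X] [NormedSpace ℝ X] [CompleteSpace X] :
    Lp X 2 ν →L[ℝ] BoundedContinuousFunction ℝ X :=
  LinearMap.mkContinuous
    { toFun := fun f => BoundedContinuousFunction.ofNormedAddCommGroup
        (fun t => ∫ s in Ioi t, f s ∂ν) (continuous_integral_Ioi (Lp.integrable_of_finite f)) _
        (fun t => norm_integral_Lp_le f (Ioi t))
      map_add' := fun f g => by
        ext t
        change (∫ s in Ioi t, (f + g : Lp X 2 ν) s ∂ν) =
          (∫ s in Ioi t, f s ∂ν) + ∫ s in Ioi t, g s ∂ν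
        rw [← integral_add (Lp.integrable_of_finite f).restrict
          (Lp.integrable_of_finite g).restrict]
        exact integral_congr_ae (ae_restrict_of_ae (Lp.coeFn_add f g))
      map_smul' := fun c f => by
        ext t
        change (∫ s in Ioi t, (c • f : Lp X 2 ν) s ∂ν) = c • ∫ s in Ioi t, f s ∂ν
        rw [← integral_smul]
        exact integral_congr_ae (ae_restrict_of_ae (Lp.coeFn_smul c f)) }
    ((measureUnivNNReal ν : ℝ) ^ (1 / 2 : ℝ))
    (fun f => BoundedContinuousFunction.norm_ofNormedAddCommGroup_le _ (by positivity)
      (fun t => norm_integral_Lp_le f (Ioi t)))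

variable [IsFiniteMeasure ν] [NullSingletonClass ν]

theorem tailIntegral_apply [CompleteSpace X] (f : Lp X 2 ν) (t : ℝ) :
    tailIntegral ν X f t = ∫ s in Ioi t, f s ∂ν := rfl

theorem tailIntegral_compLpL [CompleteSpace X] [CompleteSpace Y] (L : X →L[ℝ] Y) (f : Lp X 2 ν)
    (t : ℝ) : tailIntegral ν Y (L.compLpL 2 ν f) t = L (tailIntegral ν X f t) := by
  rw [tailIntegral_apply, tailIntegral_apply,
    ← L.integral_comp_comm (Lp.integrable_of_finite f).restrict]
  exact integral_congr_ae (ae_restrict_of_ae (ContinuousLinearMap.coeFn_compLpL L f))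

/-- The double integral of `a (g s) (g r)` splits along the diagonal into two triangles; by Fubini
and symmetry these contribute equally. -/
theorem bilin_integral_self [CompleteSpace X] (a : X →L[ℝ] X →L[ℝ] ℝ) (ha : ∀ x y, a x y = a y x)
    {g : ℝ → X} (hg : Integrable g ν) :
    a (∫ s, g s ∂ν) (∫ s, g s ∂ν) = 2 * ∫ s, a (∫ r in Ioi s, g r ∂ν) (g s) ∂ν := by
  set G := ∫ s, g s ∂ν
  have h1 : a G G = ∫ s, a (g s) G ∂ν := by
    change a.flip G G = _
    rw [← ContinuousLinearMap.integral_comp_comm _ hg]; rfl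
  have hI : ∀ s, G = (∫ r in Iio s, g r ∂ν) + ∫ r in Ioi s, g r ∂ν := by
    intro s
    rw [← integral_Iic_eq_integral_Iio, intervalIntegral.integral_Iic_add_Ioi hg.integrableOn hg.integrableOn]

  have hc : Continuous fun t => ∫ s in Ioi t, g s ∂ν := continuous_integral_Ioi hg
  have hc2 : Continuous fun t => ∫ s in Iio t, g s ∂ν := by
    have : (fun t => ∫ s in Iio t, g s ∂ν) = fun t => G - ∫ s in Ioi t, g s ∂ν := by
      funext t
      exact eq_sub_of_add_eq (hI t).symm
    rw [this]
    exact continuous_const.sub hc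
  have hb : ∀ S, ‖∫ s in S, g s ∂ν‖ ≤ ∫ s, ‖g s‖ ∂ν := fun S =>
    (norm_integral_le_integral_norm _).trans
      (setIntegral_le_integral hg.norm (Filter.Eventually.of_forall fun _ => norm_nonneg _))
  have hint : ∀ u : ℝ → X, Continuous u → (∀ t, ‖u t‖ ≤ ∫ s, ‖g s‖ ∂ν) →
      Integrable (fun s => a (g s) (u s)) ν := by
    intro u hu hub
    refine Integrable.mono' (hg.norm.const_mul (‖a‖ * ∫ s, ‖g s‖ ∂ν)) ?_ ?_
    · exact ContinuousLinearMap.aestronglyMeasurable_comp₂ a hg.1 hu.aestronglyMeasurable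
    · refine Filter.Eventually.of_forall fun s => (a.le_opNorm₂ _ _).trans ?_
      have := hub s
      calc ‖a‖ * ‖g s‖ * ‖u s‖ ≤ ‖a‖ * ‖g s‖ * ∫ s, ‖g s‖ ∂ν := by gcongr
        _ = _ := by ring
  have h2 : a G G = (∫ s, a (g s) (∫ r in Iio s, g r ∂ν) ∂ν) +
      ∫ s, a (g s) (∫ r in Ioi s, g r ∂ν) ∂ν := by
    rw [h1, ← integral_add (hint _ hc2 fun t => hb _) (hint _ hc fun t => hb _)]
    refine integral_congr_ae (Filter.Eventually.of_forall fun s => ?_)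
    dsimp only
    rw [← map_add, ← hI s]
  have h3 := integral_bilin_Ioi_swap a hg hg
  have h4 : (∫ s, a (g s) (∫ r in Iio s, g r ∂ν) ∂ν) =
      ∫ s, a (g s) (∫ r in Ioi s, g r ∂ν) ∂ν := by
    rw [h3]; exact integral_congr_ae (Filter.Eventually.of_forall fun s => ha _ _)
  rw [h2, h4, two_mul]
  congr 1 <;> exact integral_congr_ae (Filter.Eventually.of_forall fun s => ha _ _)

/-- With `z(t) = x + ∫_{s>t} g`, this is the integrated form of `d/dt a(z, z) = -2 a(z, g)`. It
rests on Fubini alone, so `g` only has to be square integrable. -/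
theorem bilin_add_integral_Ioi [CompleteSpace X] (a : X →L[ℝ] X →L[ℝ] ℝ)
    (ha : ∀ x y, a x y = a y x) (x : X) (g : Lp X 2 ν) (t : ℝ) :
    a (x + tailIntegral ν X g t) (x + tailIntegral ν X g t) =
      a x x + 2 * ∫ s in Ioi t, a (x + tailIntegral ν X g s) (g s) ∂ν := by
  have hg := Lp.integrable_of_finite g
  have h1 := bilin_integral_self (ν := ν.restrict (Ioi t)) a ha hg.restrict
  have h2 : ∫ s in Ioi t, a (∫ r in Ioi s, g r ∂(ν.restrict (Ioi t))) (g s) ∂ν =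
      ∫ s in Ioi t, a (tailIntegral ν X g s) (g s) ∂ν := by
    refine setIntegral_congr_fun measurableSet_Ioi fun s hs => ?_
    rw [Measure.restrict_restrict measurableSet_Ioi, tailIntegral_apply,
      inter_eq_left.2 (Ioi_subset_Ioi (le_of_lt hs))]
  have h3 : a x (tailIntegral ν X g t) = ∫ s in Ioi t, a x (g s) ∂ν := by
    rw [tailIntegral_apply, ContinuousLinearMap.integral_comp_comm _ hg.restrict]
  have h4 : ∫ s in Ioi t, a (x + tailIntegral ν X g s) (g s) ∂ν =
      (∫ s in Ioi t, a x (g s) ∂ν) + ∫ s in Ioi t, a (tailIntegral ν X g s) (g s) ∂ν := by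
    rw [← integral_add]
    · refine integral_congr_ae (Filter.Eventually.of_forall fun s => ?_)
      simp
    · exact (ContinuousLinearMap.integrable_comp _ hg).restrict
    · refine Integrable.restrict (Integrable.mono' (hg.norm.const_mul
        (‖a‖ * ‖tailIntegral ν X g‖)) ?_ ?_)
      · exact ContinuousLinearMap.aestronglyMeasurable_comp₂ a
          (tailIntegral ν X g).continuous.aestronglyMeasurable hg.1
      · refine Filter.Eventually.of_forall fun s => (a.le_opNorm₂ _ _).trans ?_
        have := (tailIntegral ν X g).norm_coe_le_norm s
        gcongr
  rw [h4, ← h3, ← h2, mul_add, ← h1, ← tailIntegral_apply]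
  simp only [map_add, add_apply]
  rw [ha (tailIntegral ν X g t) x]
  ring

end TailIntegral

set_option linter.unusedSectionVars false

/-! ### Lax–Milgram operator and positivity of the backward primitive. -/

section AbstractParabolic

open BoundedContinuousFunction in
/-- `tailIntegral` as an operator in `L²`. -/
noncomputable def tailOp (ν : Measure ℝ) [IsFiniteMeasure ν] [NullSingletonClass ν] (X : Type*)
    [NormedAddCommGroup X] [NormedSpace ℝ X] [CompleteSpace X] : Lp X 2 ν →L[ℝ] Lp X 2 ν :=
  (BoundedContinuousFunction.toLp 2 ν ℝ).comp (tailIntegral ν X)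

variable {ν : Measure ℝ} [IsFiniteMeasure ν] [NullSingletonClass ν]

theorem coeFn_tailOp {X : Type*} [NormedAddCommGroup X] [NormedSpace ℝ X] [CompleteSpace X]
    (f : Lp X 2 ν) : tailOp ν X f =ᵐ[ν] tailIntegral ν X f :=
  BoundedContinuousFunction.coeFn_toLp 2 ν ℝ _

variable {H V : Type*} [NormedAddCommGroup H] [InnerProductSpace ℝ H] [CompleteSpace H]
  [NormedAddCommGroup V] [InnerProductSpace ℝ V] [CompleteSpace V]

/-- If `B` is the isomorphism of `V` representing `a`, the operator is `B⁻¹ ι*`. -/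
theorem IsCoercive.exists_solution {a : V →L[ℝ] V →L[ℝ] ℝ} (ha : IsCoercive a) (ι : V →L[ℝ] H) :
    ∃ N : H →L[ℝ] V, ∀ x y, a (N x) y = inner ℝ x (ι y) := by
  refine ⟨(ha.continuousLinearEquivOfBilin.symm : V →L[ℝ] V).comp (ContinuousLinearMap.adjoint ι),
    fun x y => ?_⟩
  rw [← ha.continuousLinearEquivOfBilin_apply]
  simp [ContinuousLinearMap.adjoint_inner_left]

theorem L2.inner_self_eq_integral_inner {X : Type*} [NormedAddCommGroup X]
    [InnerProductSpace ℝ X] (f : Lp X 2 ν) : ∫ s, inner ℝ (f s) (f s) ∂ν = ‖f‖ ^ 2 := by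
  rw [← L2.inner_def, real_inner_self_eq_norm_sq]

theorem L2.setIntegral_inner_le {X : Type*} [NormedAddCommGroup X]
    [InnerProductSpace ℝ X] (f g : Lp X 2 ν) (S : Set ℝ) :
    2 * ∫ s in S, inner ℝ (f s) (g s) ∂ν ≤ ‖f‖ ^ 2 + ‖g‖ ^ 2 := by
  have hf := L2.integrable_inner (𝕜 := ℝ) f f
  have hg := L2.integrable_inner (𝕜 := ℝ) g g
  rw [← L2.inner_self_eq_integral_inner f, ← L2.inner_self_eq_integral_inner g,
    ← integral_add hf hg, ← integral_const_mul]
  refine (integral_mono ((L2.integrable_inner f g).restrict.const_mul 2)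
    (hf.add hg).restrict fun s => ?_).trans
    (setIntegral_le_integral (hf.add hg) (Filter.Eventually.of_forall fun s =>
      add_nonneg real_inner_self_nonneg real_inner_self_nonneg))
  have := real_inner_self_nonneg (x := f s - g s)
  rw [real_inner_sub_sub_self] at this
  simp only [Pi.add_apply]
  linarith

variable {a : V →L[ℝ] V →L[ℝ] ℝ} {ι : V →L[ℝ] H} {N : H →L[ℝ] V} {t₀ : ℝ}

/-- The condition on `Iic t₀` says that all mass lies after `t₀`, so evaluating a backward primitive
at `t₀` gives the full integral. -/
theorem setIntegral_Ioi_eq {X : Type*} [NormedAddCommGroup X] [NormedSpace ℝ X]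
    (h₀ : ν (Iic t₀) = 0) (f : ℝ → X) : ∫ s in Ioi t₀, f s ∂ν = ∫ s, f s ∂ν := by
  refine setIntegral_eq_integral_of_ae_compl_eq_zero ?_
  have : ∀ᵐ s ∂ν, s ∉ Iic t₀ := measure_eq_zero_iff_ae_notMem.1 h₀
  filter_upwards [this] with s hs h
  exact absurd (mem_Ioi.2 (not_le.1 (show ¬ s ≤ t₀ from hs))) h

theorem inner_tailOp_nonneg (h₀ : ν (Iic t₀) = 0) (b : V →L[ℝ] V →L[ℝ] ℝ)
    (hb : ∀ x y, b x y = b y x) (hpos : ∀ x, 0 ≤ b x x) (g : Lp V 2 ν) :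
    0 ≤ ∫ s, b (tailIntegral ν V g s) (g s) ∂ν := by
  have h := bilin_add_integral_Ioi (ν := ν) b hb 0 g t₀
  rw [setIntegral_Ioi_eq h₀] at h
  simp only [zero_add, map_zero] at h
  have := hpos (tailIntegral ν V g t₀)
  linarith

/-- Writing `J` for the backward primitive, `⟨ι N g, g⟩ = ∫ a(N g, N g)` and `⟨J g, g⟩ = ‖∫ g‖² / 2`
are both nonnegative. If their sum vanishes then `N g = 0`, so `g(s)` is orthogonal to the dense
range of `ι`. -/
theorem eq_zero_of_inner_add_tailOp (ha : IsCoercive a)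
    (hN : ∀ x y, a (N x) y = inner ℝ x (ι y)) (hι : DenseRange ι) (h₀ : ν (Iic t₀) = 0)
    {g : Lp H 2 ν} (h1 : inner ℝ (((ι.comp N).compLpL 2 ν + tailOp ν H) g) g = 0) : g = 0 := by
  have h2 : inner ℝ (((ι.comp N).compLpL 2 ν + tailOp ν H) g) g = inner ℝ ((ι.comp N).compLpL 2 ν g) g + inner ℝ (tailOp ν H g) g :=
    inner_add_left _ _ _
  have h3 : 0 ≤ inner ℝ (tailOp ν H g) g := by
    rw [L2.inner_def]
    have := inner_tailOp_nonneg h₀ (innerSL ℝ : H →L[ℝ] H →L[ℝ] ℝ)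
      (fun x y => real_inner_comm _ _) (fun x => real_inner_self_nonneg) g
    refine this.trans (le_of_eq (integral_congr_ae ?_))
    filter_upwards [coeFn_tailOp g] with s hs
    rw [hs]; rfl
  have hapos : ∀ x, 0 ≤ a x x := fun x => by
    obtain ⟨c, hc, hc'⟩ := ha
    exact le_trans (by positivity) (hc' x)
  have e : ∀ᵐ s ∂ν, inner ℝ ((ι.comp N).compLpL 2 ν g s) (g s) = a (N (g s)) (N (g s)) := by
    filter_upwards [ContinuousLinearMap.coeFn_compLpL (ι.comp N) g] with s hs
    rw [hs, hN]
    exact real_inner_comm _ _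
  have h4 : 0 ≤ ∫ s, inner ℝ ((ι.comp N).compLpL 2 ν g s) (g s) ∂ν := by
    refine integral_nonneg_of_ae ?_
    filter_upwards [e] with s hs
    rw [hs]; exact hapos _
  have h5 : ∫ s, inner ℝ ((ι.comp N).compLpL 2 ν g s) (g s) ∂ν = 0 := by
    rw [← L2.inner_def] at h4 ⊢
    linarith
  rw [integral_eq_zero_iff_of_nonneg_ae (by filter_upwards [e] with s hs; rw [hs]; exact hapos _)
    (L2.integrable_inner _ _)] at h5
  rw [Lp.eq_zero_iff_ae_eq_zero]
  filter_upwards [e, h5] with s hs hs'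
  obtain ⟨c, hc, hc'⟩ := ha
  have h6 := hc' (N (g s))
  rw [← hs, hs', Pi.zero_apply] at h6
  have h7 : N (g s) = 0 := by
    by_contra hne
    have : 0 < ‖N (g s)‖ := norm_pos_iff.2 hne
    have : 0 < c * ‖N (g s)‖ * ‖N (g s)‖ := by positivity
    linarith
  have h8 : ∀ y, inner ℝ (g s) y = 0 := fun y => by
    refine hι.induction_on (p := fun y => inner ℝ (g s) y = 0) y
      (isClosed_eq (by fun_prop) continuous_const) fun v => ?_
    rw [← hN, h7]; simp
  exact inner_self_eq_zero.1 (h8 (g s))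

/-- An element `g` orthogonal to the range is in particular orthogonal to its own image, so
positivity forces `g = 0`. -/
theorem denseRange_add_tailOp (ha : IsCoercive a)
    (hN : ∀ x y, a (N x) y = inner ℝ x (ι y)) (hι : DenseRange ι) (h₀ : ν (Iic t₀) = 0) :
    DenseRange (((ι.comp N).compLpL 2 ν + tailOp ν H : Lp H 2 ν →L[ℝ] Lp H 2 ν)) := by
  set A := ((ι.comp N).compLpL 2 ν + tailOp ν H : Lp H 2 ν →L[ℝ] Lp H 2 ν)
  have key : (LinearMap.range A.toLinearMap).topologicalClosure = ⊤ := by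
    rw [Submodule.topologicalClosure_eq_top_iff, Submodule.eq_bot_iff]
    intro g hg
    exact eq_zero_of_inner_add_tailOp ha hN hι h₀ ((Submodule.mem_orthogonal _ _).1 hg (A g) ⟨g, rfl⟩)
  intro y
  have : y ∈ (LinearMap.range A.toLinearMap).topologicalClosure := by rw [key]; trivial
  exact this

theorem denseRange_laxMilgram (hs : ∀ x y, a x y = a y x) (ha : IsCoercive a)
    (hN : ∀ x y, a (N x) y = inner ℝ x (ι y)) (hι : Function.Injective ι) : DenseRange N := by
  have key : (LinearMap.range N.toLinearMap).topologicalClosure = ⊤ := by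
    rw [Submodule.topologicalClosure_eq_top_iff, Submodule.eq_bot_iff]
    intro v hv
    set w := ha.continuousLinearEquivOfBilin.symm v
    have h1 : ∀ x, a (N x) w = 0 := fun x => by
      rw [hs, ← ha.continuousLinearEquivOfBilin_apply, ContinuousLinearEquiv.apply_symm_apply,
        real_inner_comm]
      exact (Submodule.mem_orthogonal _ _).1 hv (N x) ⟨x, rfl⟩
    -- The choice `x = ι w` turns `a (N x) w = 0` into `‖ι w‖² = 0`.
    have h2 : ι w = 0 := by
      have := h1 (ι w)
      rw [hN] at this
      exact inner_self_eq_zero.1 this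
    have h3 : w = 0 := hι (by rw [h2, map_zero])
    have : v = ha.continuousLinearEquivOfBilin w := by simp [w]
    rw [this, h3, map_zero]
  intro y
  have : y ∈ (LinearMap.range N.toLinearMap).topologicalClosure := by rw [key]; trivial
  exact this

end AbstractParabolic

/-! ### The symmetric problem: explicit solutions, energy bounds, extension by density. -/

section AbstractSolution

open BoundedContinuousFunction

variable {ν : Measure ℝ} [IsFiniteMeasure ν] [NullSingletonClass ν]
variable {H V : Type*} [NormedAddCommGroup H] [InnerProductSpace ℝ H] [CompleteSpace H]
  [NormedAddCommGroup V] [InnerProductSpace ℝ V] [CompleteSpace V]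
variable {a : V →L[ℝ] V →L[ℝ] ℝ} {ι : V →L[ℝ] H} {N : H →L[ℝ] V} {t₀ : ℝ}

/-- For smooth data, `(g, x) ↦ (h, z(T))`, where `h` is the right-hand side. -/
noncomputable def dataMap (ν : Measure ℝ) [IsFiniteMeasure ν] [NullSingletonClass ν]
    (ι : V →L[ℝ] H) (N : H →L[ℝ] V) : (Lp H 2 ν × H) →L[ℝ] (Lp H 2 ν × V) :=
  ((((ι.comp N).compLpL 2 ν + tailOp ν H).comp (ContinuousLinearMap.fst ℝ _ _)) +
    (Lp.constL 2 ν ℝ).comp (ContinuousLinearMap.snd ℝ _ _)).prod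
    (N.comp (ContinuousLinearMap.snd ℝ _ _))

theorem dataMap_apply (g : Lp H 2 ν) (x : H) : dataMap ν ι N (g, x) =
    ((ι.comp N).compLpL 2 ν g + tailOp ν H g + Lp.const 2 ν x, N x) := rfl

/-- For smooth data, `(g, x) ↦ (-∂ₜz, z)`. -/
noncomputable def smoothSolution (ν : Measure ℝ) [IsFiniteMeasure ν] [NullSingletonClass ν]
    (ι : V →L[ℝ] H) (N : H →L[ℝ] V) : (Lp H 2 ν × H) →ₗ[ℝ] (Lp H 2 ν × (ℝ →ᵇ V)) where
  toFun p := ((ι.comp N).compLpL 2 ν p.1,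
    BoundedContinuousFunction.const ℝ (N p.2) + tailIntegral ν V (N.compLpL 2 ν p.1))
  map_add' p q := by
    ext1
    · simp
    · ext t
      simp only [Prod.fst_add, Prod.snd_add, map_add, BoundedContinuousFunction.add_apply,
        BoundedContinuousFunction.const_apply]
      abel
  map_smul' c p := by
    ext1
    · simp
    · ext t
      simp

/-- The data are triangular in `(g, x)`: `x` alone fixes the terminal value up to a small error, and
then `g` adjusts the right-hand side. -/
theorem denseRange_dataMap (hs : ∀ x y, a x y = a y x) (ha : IsCoercive a)
    (hN : ∀ x y, a (N x) y = inner ℝ x (ι y)) (hι : DenseRange ι) (hι' : Function.Injective ι)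
    (h₀ : ν (Iic t₀) = 0) : DenseRange (dataMap ν ι N) := by
  rw [Metric.denseRange_iff]
  rintro ⟨y, v⟩ r hr
  obtain ⟨x, hx⟩ := Metric.denseRange_iff.1 (denseRange_laxMilgram hs ha hN hι') v r hr
  obtain ⟨g, hg⟩ := Metric.denseRange_iff.1 (denseRange_add_tailOp (ν := ν) ha hN hι h₀)
    (y - Lp.const 2 ν x) r hr
  refine ⟨(g, x), ?_⟩
  rw [dataMap_apply, Prod.dist_eq, max_lt_iff]
  refine ⟨?_, hx⟩
  have e : (ι.comp N).compLpL 2 ν g + tailOp ν H g + Lp.const 2 ν x =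
      ((ι.comp N).compLpL 2 ν + tailOp ν H) g + Lp.const 2 ν x := rfl
  rw [e, dist_eq_norm, ← sub_sub, sub_right_comm, ← dist_eq_norm]
  exact hg

theorem coeFn_dataMap_sub (g : Lp H 2 ν) (x : H) :
    ((dataMap ν ι N (g, x)).1 - (smoothSolution ν ι N (g, x)).1 : Lp H 2 ν) =ᵐ[ν]
      fun s => x + tailIntegral ν H g s := by
  have e : (dataMap ν ι N (g, x)).1 - (smoothSolution ν ι N (g, x)).1 =
      tailOp ν H g + Lp.const 2 ν x := by
    rw [dataMap_apply]
    change (ι.comp N).compLpL 2 ν g + tailOp ν H g + Lp.const 2 ν x -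
      (ι.comp N).compLpL 2 ν g = _
    abel
  rw [e]
  filter_upwards [Lp.coeFn_add (tailOp ν H g) (Lp.const 2 ν x), coeFn_tailOp g,
    Lp.coeFn_const 2 ν x] with s h1 h2 h3
  rw [h1, Pi.add_apply, h2, h3, Function.const_apply, add_comm]

theorem smoothSolution_snd_apply (g : Lp H 2 ν) (x : H) (t : ℝ) :
    (smoothSolution ν ι N (g, x)).2 t = N (x + tailIntegral ν H g t) := by
  change N x + tailIntegral ν V (N.compLpL 2 ν g) t = _
  rw [tailIntegral_compLpL, map_add]

/-- Since `z(s) = N (x + ∫_{r>s} g)`, the integrand `a (z s) (N (g s))` equals `⟨x + ∫_{r>s} g, ι N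
(g s)⟩`, which is `⟨h - f, f⟩`. -/
theorem smoothSolution_energy (hs : ∀ x y, a x y = a y x)
    (hN : ∀ x y, a (N x) y = inner ℝ x (ι y)) (g : Lp H 2 ν) (x : H) (t : ℝ) :
    a ((smoothSolution ν ι N (g, x)).2 t) ((smoothSolution ν ι N (g, x)).2 t) =
      a (N x) (N x) + 2 * ∫ s in Ioi t, inner ℝ
        (((dataMap ν ι N (g, x)).1 - (smoothSolution ν ι N (g, x)).1 : Lp H 2 ν) s)
        ((smoothSolution ν ι N (g, x)).1 s) ∂ν := by
  have h := bilin_add_integral_Ioi (ν := ν) a hs (N x) (N.compLpL 2 ν g) t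
  refine h.trans ?_
  congr 2
  refine integral_congr_ae (ae_restrict_of_ae ?_)
  filter_upwards [coeFn_dataMap_sub (ι := ι) (N := N) g x,
    ContinuousLinearMap.coeFn_compLpL (p := 2) (μ := ν) N g,
    ContinuousLinearMap.coeFn_compLpL (p := 2) (μ := ν) (ι.comp N) g] with s h1 h2 h3
  have h4 : (smoothSolution ν ι N (g, x)).1 s = ι (N (g s)) := h3
  rw [h1, h2, h4, tailIntegral_compLpL, ← map_add, hN]

theorem IsCoercive.nonneg {b : V →L[ℝ] V →L[ℝ] ℝ} (hb : IsCoercive b) (x : V) : 0 ≤ b x x := by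
  obtain ⟨c, hc, hc'⟩ := hb
  exact le_trans (by positivity) (hc' x)

/-- The energy identity at `t₀` has a nonnegative left side, so `2 ‖f‖² ≤ a(z(T), z(T)) + 2 ⟨h, f⟩`.
The leading constant `1` is what later makes the solution operator with zero terminal value a
contraction from `h` to `f`. -/
theorem norm_sq_smoothSolution_fst_le (hs : ∀ x y, a x y = a y x) (ha : IsCoercive a)
    (hN : ∀ x y, a (N x) y = inner ℝ x (ι y)) (h₀ : ν (Iic t₀) = 0) (p : Lp H 2 ν × H) :
    ‖(smoothSolution ν ι N p).1‖ ^ 2 ≤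
      ‖(dataMap ν ι N p).1‖ ^ 2 + a (dataMap ν ι N p).2 (dataMap ν ι N p).2 := by
  obtain ⟨g, x⟩ := p
  have h := smoothSolution_energy (ν := ν) hs hN g x t₀
  rw [setIntegral_Ioi_eq h₀, ← L2.inner_def, inner_sub_left, real_inner_self_eq_norm_sq] at h
  have h1 := ha.nonneg ((smoothSolution ν ι N (g, x)).2 t₀)
  have h2 := real_inner_le_norm (dataMap ν ι N (g, x)).1 (smoothSolution ν ι N (g, x)).1
  have h3 : (dataMap ν ι N (g, x)).2 = N x := rfl
  rw [h3]
  nlinarith [sq_nonneg (‖(dataMap ν ι N (g, x)).1‖ - ‖(smoothSolution ν ι N (g, x)).1‖)]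

theorem norm_sq_smoothSolution_snd_le (hs : ∀ x y, a x y = a y x) (ha : IsCoercive a)
    (hN : ∀ x y, a (N x) y = inner ℝ x (ι y)) (h₀ : ν (Iic t₀) = 0) (p : Lp H 2 ν × H) (t : ℝ) :
    a ((smoothSolution ν ι N p).2 t) ((smoothSolution ν ι N p).2 t) ≤
      5 * (‖(dataMap ν ι N p).1‖ ^ 2 + a (dataMap ν ι N p).2 (dataMap ν ι N p).2) := by
  have h1 := norm_sq_smoothSolution_fst_le (ν := ν) hs ha hN h₀ p
  obtain ⟨g, x⟩ := p
  have h := smoothSolution_energy (ν := ν) hs hN g x t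
  have h2 := L2.setIntegral_inner_le
    ((dataMap ν ι N (g, x)).1 - (smoothSolution ν ι N (g, x)).1)
    (smoothSolution ν ι N (g, x)).1 (Ioi t)
  have h3 : (dataMap ν ι N (g, x)).2 = N x := rfl
  have h4 := norm_sub_le (dataMap ν ι N (g, x)).1 (smoothSolution ν ι N (g, x)).1
  -- The factor 5 arises from `‖h - f‖² + ‖f‖² ≤ 2 ‖h‖² + 3 ‖f‖²` and the preceding bound on `‖f‖²`.
  have h5 : ‖(dataMap ν ι N (g, x)).1 - (smoothSolution ν ι N (g, x)).1‖ ^ 2 ≤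
      2 * ‖(dataMap ν ι N (g, x)).1‖ ^ 2 + 2 * ‖(smoothSolution ν ι N (g, x)).1‖ ^ 2 := by
    nlinarith [sq_nonneg (‖(dataMap ν ι N (g, x)).1‖ - ‖(smoothSolution ν ι N (g, x)).1‖),
      norm_nonneg ((dataMap ν ι N (g, x)).1 - (smoothSolution ν ι N (g, x)).1)]
  have h6 := ha.nonneg (N x)
  rw [h3] at h1 ⊢
  rw [h]
  nlinarith [sq_nonneg ‖(dataMap ν ι N (g, x)).1‖]

/-- The equation `-∂ₜz + a(z, ·) = h`, `z(T) = x` for a symmetric form `a`; here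
`(Φ (h, x)).1 = -∂ₜz` and `(Φ (h, x)).2 = z`. -/
theorem exists_symmetric_solution (hs : ∀ x y, a x y = a y x) (ha : IsCoercive a)
    (hN : ∀ x y, a (N x) y = inner ℝ x (ι y)) (hι : DenseRange ι) (hι' : Function.Injective ι)
    (h₀ : ν (Iic t₀) = 0) :
    ∃ Φ : (Lp H 2 ν × V) →L[ℝ] (Lp H 2 ν × (ℝ →ᵇ V)), ∀ p,
      (∀ t, ι ((Φ p).2 t) = ι p.2 + tailIntegral ν H (Φ p).1 t) ∧
      BoundedContinuousFunction.toLp 2 ν ℝ (Φ p).2 = N.compLpL 2 ν (p.1 - (Φ p).1) ∧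
      ‖(Φ p).1‖ ^ 2 ≤ ‖p.1‖ ^ 2 + a p.2 p.2 := by
  have hd := denseRange_dataMap (ν := ν) hs ha hN hι hι' h₀
  have hb : ∃ C, ∀ p, ‖smoothSolution ν ι N p‖ ≤ C * ‖dataMap ν ι N p‖ := by
    obtain ⟨c, hc, hc'⟩ := id ha
    -- One summand bounds `f`, the other bounds `z`; the norm of a product is a maximum, so their
    -- sum serves both.
    refine ⟨√(1 + ‖a‖) + √(5 / c * (1 + ‖a‖)), fun p => ?_⟩
    have h1 : ‖(dataMap ν ι N p).1‖ ^ 2 + a (dataMap ν ι N p).2 (dataMap ν ι N p).2 ≤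
        (1 + ‖a‖) * ‖dataMap ν ι N p‖ ^ 2 := by
      have e1 := norm_fst_le (dataMap ν ι N p)
      have e2 := norm_snd_le (dataMap ν ι N p)
      have e3 := (le_abs_self _).trans (a.le_opNorm₂ (dataMap ν ι N p).2 (dataMap ν ι N p).2)
      calc _ ≤ ‖(dataMap ν ι N p).1‖ ^ 2 +
            ‖a‖ * ‖(dataMap ν ι N p).2‖ * ‖(dataMap ν ι N p).2‖ := by gcongr
        _ ≤ ‖dataMap ν ι N p‖ ^ 2 + ‖a‖ * ‖dataMap ν ι N p‖ * ‖dataMap ν ι N p‖ := by gcongr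
        _ = _ := by ring
    have h2 : ‖(smoothSolution ν ι N p).1‖ ≤ √(1 + ‖a‖) * ‖dataMap ν ι N p‖ := by
      refine abs_le_of_sq_le_sq' ?_ (by positivity) |>.2
      rw [mul_pow, Real.sq_sqrt (by positivity)]
      exact (norm_sq_smoothSolution_fst_le hs ha hN h₀ p).trans h1
    have h3 : ‖(smoothSolution ν ι N p).2‖ ≤ √(5 / c * (1 + ‖a‖)) * ‖dataMap ν ι N p‖ := by
      refine (BoundedContinuousFunction.norm_le (by positivity)).2 fun t => ?_
      refine abs_le_of_sq_le_sq' ?_ (by positivity) |>.2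
      rw [mul_pow, Real.sq_sqrt (by positivity)]
      have e1 := norm_sq_smoothSolution_snd_le hs ha hN h₀ p t
      have e2 := hc' ((smoothSolution ν ι N p).2 t)
      have e3 : c * ‖(smoothSolution ν ι N p).2 t‖ ^ 2 ≤
          5 * ((1 + ‖a‖) * ‖dataMap ν ι N p‖ ^ 2) := by nlinarith
      calc _ = c * ‖(smoothSolution ν ι N p).2 t‖ ^ 2 / c := by field_simp
        _ ≤ 5 * ((1 + ‖a‖) * ‖dataMap ν ι N p‖ ^ 2) / c := by gcongr
        _ = _ := by ring
    rw [Prod.norm_def, max_le_iff]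
    constructor
    · refine h2.trans ?_
      gcongr
      exact le_add_of_nonneg_right (by positivity)
    · refine h3.trans ?_
      gcongr
      exact le_add_of_nonneg_left (by positivity)
  -- The bound `hb` makes the solution a bounded linear function of the data on a dense set. Each
  -- asserted relation is closed under limits, hence needs checking on explicit data only.
  set Φ := (smoothSolution ν ι N).extendOfNorm (dataMap ν ι N).toLinearMap
  have hΦ : ∀ p, Φ (dataMap ν ι N p) = smoothSolution ν ι N p :=
    LinearMap.extendOfNorm_eq (e := (dataMap ν ι N).toLinearMap) hd hb
  refine ⟨Φ, fun p => ⟨fun t => ?_, ?_, ?_⟩⟩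
  · refine hd.induction_on (p := fun p : Lp H 2 ν × V =>
      ι ((Φ p).2 t) = ι p.2 + tailIntegral ν H (Φ p).1 t) p (isClosed_eq ?_ ?_) fun q => ?_
    · exact ι.continuous.comp ((BoundedContinuousFunction.evalCLM ℝ t).continuous.comp
        (continuous_snd.comp Φ.continuous))
    · exact (ι.continuous.comp continuous_snd).add
        ((BoundedContinuousFunction.evalCLM ℝ t).continuous.comp
          ((tailIntegral ν H).continuous.comp (continuous_fst.comp Φ.continuous)))
    · rw [hΦ]
      obtain ⟨g, x⟩ := q
      rw [smoothSolution_snd_apply, map_add, map_add]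
      congr 1
      exact (tailIntegral_compLpL (ι.comp N) g t).symm
  · refine hd.induction_on (p := fun p : Lp H 2 ν × V =>
      BoundedContinuousFunction.toLp 2 ν ℝ (Φ p).2 = N.compLpL 2 ν (p.1 - (Φ p).1)) p
      (isClosed_eq ?_ ?_) fun q => ?_
    · exact (ContinuousLinearMap.continuous _).comp (continuous_snd.comp Φ.continuous)
    · exact (ContinuousLinearMap.continuous _).comp
        (continuous_fst.sub (continuous_fst.comp Φ.continuous))
    · rw [hΦ]
      obtain ⟨g, x⟩ := q
      apply Lp.ext
      filter_upwards [BoundedContinuousFunction.coeFn_toLp 2 ν ℝ (smoothSolution ν ι N (g, x)).2,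
        ContinuousLinearMap.coeFn_compLpL (p := 2) (μ := ν) N
          ((dataMap ν ι N (g, x)).1 - (smoothSolution ν ι N (g, x)).1),
        coeFn_dataMap_sub (ι := ι) (N := N) g x] with s h1 h2 h3
      rw [h1, h2, h3, smoothSolution_snd_apply]
  · refine hd.induction_on (p := fun p : Lp H 2 ν × V =>
      ‖(Φ p).1‖ ^ 2 ≤ ‖p.1‖ ^ 2 + a p.2 p.2) p (isClosed_le ?_ ?_) fun q => ?_
    · exact (continuous_fst.comp Φ.continuous).norm.pow 2
    · fun_prop
    · rw [hΦ]
      exact norm_sq_smoothSolution_fst_le hs ha hN h₀ q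

end AbstractSolution

/-! ### Adding the drift: Neumann series and uniqueness. -/

section AbstractPerturbation

open BoundedContinuousFunction

variable {ν : Measure ℝ} [IsFiniteMeasure ν] [NullSingletonClass ν]
variable {H V : Type*} [NormedAddCommGroup H] [InnerProductSpace ℝ H] [CompleteSpace H]
  [NormedAddCommGroup V] [InnerProductSpace ℝ V] [CompleteSpace V]
variable {a : V →L[ℝ] V →L[ℝ] ℝ} {ι D : V →L[ℝ] H} {N : H →L[ℝ] V} {t₀ : ℝ}

theorem norm_compLpL_le {X Y : Type*} [NormedAddCommGroup X] [NormedSpace ℝ X]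
    [NormedAddCommGroup Y] [NormedSpace ℝ Y] (K : X →L[ℝ] Y) {c : ℝ} (hc : 0 ≤ c)
    (hK : ∀ x, ‖K x‖ ≤ c * ‖x‖) (f : Lp X 2 ν) : ‖K.compLpL 2 ν f‖ ≤ c * ‖f‖ := by
  refine (ContinuousLinearMap.norm_compLp_le K f).trans ?_
  gcongr
  exact K.opNorm_le_bound hc hK

/-- Solve the symmetric problem with an unknown right-hand side `g`. As `z = N (g - f)`, the full
equation reads `g + D N (g - f) = h`, where `f` depends affinely on `g`. Its linear part is the
identity plus an operator of norm at most `1/4 · 2`. -/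
theorem exists_perturbed_solution (hs : ∀ x y, a x y = a y x) (ha : IsCoercive a)
    (hN : ∀ x y, a (N x) y = inner ℝ x (ι y)) (hι : DenseRange ι) (hι' : Function.Injective ι)
    (h₀ : ν (Iic t₀) = 0) (hD : ∀ x, ‖D (N x)‖ ≤ 1 / 4 * ‖x‖) :
    ∃ C, 0 ≤ C ∧ ∀ (h : Lp H 2 ν) (x : V), ∃ (f : Lp H 2 ν) (z : ℝ →ᵇ V),
      (∀ t, ι (z t) = ι x + tailIntegral ν H f t) ∧
      (∀ᵐ t ∂ν, ∀ y, inner ℝ (f t) (ι y) + a (z t) y + inner ℝ (D (z t)) (ι y) =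
        inner ℝ (h t) (ι y)) ∧
      ‖f‖ ≤ C * (‖h‖ + ‖x‖) ∧ ‖z‖ ≤ C * (‖h‖ + ‖x‖) := by
  obtain ⟨Φ, hΦ⟩ := exists_symmetric_solution (ν := ν) hs ha hN hι hι' h₀
  set K : Lp H 2 ν →L[ℝ] Lp H 2 ν := (D.comp N).compLpL 2 ν
  have hK : ∀ g, ‖K g‖ ≤ 1 / 4 * ‖g‖ := norm_compLpL_le _ (by norm_num) hD
  set M : Lp H 2 ν →L[ℝ] Lp H 2 ν := (ContinuousLinearMap.fst ℝ _ _).comp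
    (Φ.comp (ContinuousLinearMap.inl ℝ _ _))
  -- With zero terminal value, the sharp estimate for the symmetric problem makes `g ↦ f` a
  -- contraction.
  have hM : ∀ g, ‖M g‖ ≤ ‖g‖ := fun g => by
    have := (hΦ (g, 0)).2.2
    simp only [map_zero, add_zero] at this
    exact abs_le_of_sq_le_sq' this (norm_nonneg _) |>.2
  set S : Lp H 2 ν →L[ℝ] Lp H 2 ν := K.comp (1 - M)
  have hS : ∀ g, ‖S g‖ ≤ 1 / 2 * ‖g‖ := fun g => by
    have h1 := hK (g - M g)
    have h2 := norm_sub_le g (M g)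
    have h3 := hM g
    change ‖K (g - M g)‖ ≤ _
    linarith
  have hS1 : ‖-S‖ < 1 := by
    refine ((-S).opNorm_le_bound (by norm_num) (fun g => ?_)).trans_lt
      (by norm_num : (1 / 2 : ℝ) < 1)
    change ‖-(S g)‖ ≤ _
    rw [norm_neg]
    exact hS g
  refine ⟨‖Φ‖ * (3 + ‖Φ‖), by positivity, fun h x => ?_⟩
  -- The part of `f` produced by the terminal value `x` does not depend on `g` and is moved to the
  -- right-hand side.
  set h' := h + K (Φ (0, x)).1
  set g := ((Units.oneSub (-S) hS1)⁻¹ : (Lp H 2 ν →L[ℝ] Lp H 2 ν)ˣ).1 h'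
  have hg : g + S g = h' := by
    have := (Units.oneSub (-S) hS1).mul_inv
    have := congrArg (fun L : Lp H 2 ν →L[ℝ] Lp H 2 ν => L h') this
    simp only [Units.val_oneSub, sub_neg_eq_add] at this
    exact this
  have hgn : ‖g‖ ≤ 2 * ‖h‖ + ‖Φ‖ * ‖x‖ := by
    have e1 : ‖g‖ ≤ ‖h'‖ + ‖S g‖ := by
      rw [← hg]
      have := norm_sub_le (g + S g) (S g)
      rwa [add_sub_cancel_right] at this
    have e2 := hS g
    have e3 : ‖h'‖ ≤ ‖h‖ + ‖K (Φ (0, x)).1‖ := norm_add_le _ _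
    have e4 := hK (Φ (0, x)).1
    have e5 : ‖(Φ (0, x)).1‖ ≤ ‖Φ‖ * ‖x‖ := by
      refine (norm_fst_le _).trans ((Φ.le_opNorm _).trans (le_of_eq ?_))
      simp [Prod.norm_def]
    have : 0 ≤ ‖Φ‖ * ‖x‖ := by positivity
    linarith
  have hfs : (Φ (g, x)).1 = M g + (Φ (0, x)).1 := by
    have : ((g, x) : Lp H 2 ν × V) = (g, 0) + (0, x) := by simp
    rw [this, map_add]; rfl
  have hgh : g + K (g - (Φ (g, x)).1) = h := by
    have e1 : S g = K (g - M g) := rfl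
    have e2 : g - (Φ (g, x)).1 = (g - M g) - (Φ (0, x)).1 := by rw [hfs]; abel
    rw [e2, map_sub, ← e1, ← add_sub_assoc, hg]
    simp [h']
  have hb : ‖Φ (g, x)‖ ≤ ‖Φ‖ * (3 + ‖Φ‖) * (‖h‖ + ‖x‖) := by
    refine (Φ.le_opNorm _).trans ?_
    rw [mul_assoc]
    gcongr
    have e : ‖((g, x) : Lp H 2 ν × V)‖ ≤ ‖g‖ + ‖x‖ := by
      rw [Prod.norm_def]
      exact max_le (le_add_of_nonneg_right (norm_nonneg _))
        (le_add_of_nonneg_left (norm_nonneg _))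
    have : 0 ≤ ‖Φ‖ * ‖h‖ := by positivity
    nlinarith [norm_nonneg h, norm_nonneg x]
  refine ⟨(Φ (g, x)).1, (Φ (g, x)).2, (hΦ (g, x)).1, ?_, (norm_fst_le _).trans hb,
    (norm_snd_le _).trans hb⟩
  have hz := (hΦ (g, x)).2.1
  filter_upwards [BoundedContinuousFunction.coeFn_toLp 2 ν ℝ (Φ (g, x)).2,
    ContinuousLinearMap.coeFn_compLpL (p := 2) (μ := ν) N (g - (Φ (g, x)).1),
    ContinuousLinearMap.coeFn_compLpL (p := 2) (μ := ν) (D.comp N) (g - (Φ (g, x)).1),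
    Lp.coeFn_sub g (Φ (g, x)).1, Lp.coeFn_add g (K (g - (Φ (g, x)).1))] with t h1 h2 h3 h4 h5 y
  have e1 : (Φ (g, x)).2 t = N (g t - (Φ (g, x)).1 t) := by
    rw [← h1, hz, h2, h4, Pi.sub_apply]
  have e2 : h t = g t + D ((Φ (g, x)).2 t) := by
    have e3 : h t = (g + K (g - (Φ (g, x)).1) : Lp H 2 ν) t := by rw [hgh]
    rw [e3, h5, Pi.add_apply, h3, h4, e1]; rfl
  rw [e2, inner_add_left]
  have e4 : a ((Φ (g, x)).2 t) y = inner ℝ (g t) (ι y) - inner ℝ ((Φ (g, x)).1 t) (ι y) := by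
    rw [e1, hN, inner_sub_left]
  rw [e4]
  ring

/-- Put `J` for the backward primitive, `K = D N`, `z = ι u` and `q = z + D J u`. The equation says
`N q = -J u`, whence `z = q + K q` and `(ι N + J) z = ι N K q`. So `z` is the `f` of the symmetric
problem with data `(K q, 0)`, and `‖z‖ ≤ ‖K q‖ ≤ ‖q‖ / 4`. Combined with `‖q‖ ≤ ‖z‖ + ‖K q‖`, this
forces `q = 0`. -/
theorem eq_zero_of_perturbed_equation (hs : ∀ x y, a x y = a y x) (ha : IsCoercive a)
    (hN : ∀ x y, a (N x) y = inner ℝ x (ι y)) (hι : DenseRange ι) (hι' : Function.Injective ι)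
    (h₀ : ν (Iic t₀) = 0) (hD : ∀ x, ‖D (N x)‖ ≤ 1 / 4 * ‖x‖) (u : Lp V 2 ν)
    (hu : ∀ᵐ t ∂ν, ∀ y, inner ℝ (ι (u t)) (ι y) + a (tailIntegral ν V u t) y +
      inner ℝ (D (tailIntegral ν V u t)) (ι y) = 0) : u = 0 := by
  obtain ⟨Φ, hΦ⟩ := exists_symmetric_solution (ν := ν) hs ha hN hι hι' h₀
  set K : Lp H 2 ν →L[ℝ] Lp H 2 ν := (D.comp N).compLpL 2 ν
  have hK : ∀ g, ‖K g‖ ≤ 1 / 4 * ‖g‖ := norm_compLpL_le _ (by norm_num) hD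
  set z : Lp H 2 ν := ι.compLpL 2 ν u
  set q : Lp H 2 ν := z + D.compLpL 2 ν (tailOp ν V u)
  have hq : ∀ᵐ t ∂ν, q t = ι (u t) + D (tailIntegral ν V u t) := by
    filter_upwards [Lp.coeFn_add z (D.compLpL 2 ν (tailOp ν V u)),
      ContinuousLinearMap.coeFn_compLpL (p := 2) (μ := ν) ι u,
      ContinuousLinearMap.coeFn_compLpL (p := 2) (μ := ν) D (tailOp ν V u),
      coeFn_tailOp u] with t h1 h2 h3 h4
    rw [h1, Pi.add_apply, h2, h3, h4]
  have hNq : ∀ᵐ t ∂ν, N (q t) = -tailIntegral ν V u t := by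
    filter_upwards [hq, hu] with t h1 h2
    have e : ∀ y, a (N (q t) + tailIntegral ν V u t) y = 0 := fun y => by
      rw [map_add, _root_.add_apply, hN, h1, inner_add_left, ← h2 y]
      ring
    obtain ⟨c, hc, hc'⟩ := id ha
    have h6 := hc' (N (q t) + tailIntegral ν V u t)
    rw [e] at h6
    rw [← add_eq_zero_iff_eq_neg]
    by_contra hne
    have : 0 < ‖N (q t) + tailIntegral ν V u t‖ := norm_pos_iff.2 hne
    have : 0 < c * ‖N (q t) + tailIntegral ν V u t‖ * ‖N (q t) + tailIntegral ν V u t‖ := by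
      positivity
    linarith
  have hz : z = q + K q := by
    apply Lp.ext
    filter_upwards [Lp.coeFn_add q (K q), hq, hNq,
      ContinuousLinearMap.coeFn_compLpL (p := 2) (μ := ν) (D.comp N) q,
      ContinuousLinearMap.coeFn_compLpL (p := 2) (μ := ν) ι u] with t h1 h2 h3 h4 h5
    rw [h1, Pi.add_apply, h4, h5, ContinuousLinearMap.comp_apply, h3, h2, map_neg]
    abel
  set A : Lp H 2 ν →L[ℝ] Lp H 2 ν := (ι.comp N).compLpL 2 ν + tailOp ν H
  have hJz : tailOp ν H z = -(ι.comp N).compLpL 2 ν q := by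
    apply Lp.ext
    filter_upwards [Lp.coeFn_neg ((ι.comp N).compLpL 2 ν q), coeFn_tailOp z, hNq,
      ContinuousLinearMap.coeFn_compLpL (p := 2) (μ := ν) (ι.comp N) q] with t h1 h2 h3 h4
    rw [h1, Pi.neg_apply, h2, h4, ContinuousLinearMap.comp_apply, h3, tailIntegral_compLpL]
    simp
  have hA : A z = (ι.comp N).compLpL 2 ν (K q) := by
    change (ι.comp N).compLpL 2 ν z + tailOp ν H z = _
    rw [hJz, ← sub_eq_add_neg, ← map_sub, hz, add_sub_cancel_left]
  -- In the symmetric problem with zero terminal value, `J f = ι z` and `z = N (g - f)`, so `f`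
  -- satisfies an equation of the same type as `z` here; `A` is injective by positivity.
  have hAM : ∀ g, A (Φ (g, 0)).1 = (ι.comp N).compLpL 2 ν g := fun g => by
    obtain ⟨h1, h2, -⟩ := hΦ (g, 0)
    have e : tailOp ν H (Φ (g, 0)).1 = (ι.comp N).compLpL 2 ν (g - (Φ (g, 0)).1) := by
      apply Lp.ext
      filter_upwards [coeFn_tailOp (Φ (g, 0)).1,
        BoundedContinuousFunction.coeFn_toLp 2 ν ℝ (Φ (g, 0)).2,
        ContinuousLinearMap.coeFn_compLpL (p := 2) (μ := ν) N (g - (Φ (g, 0)).1),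
        ContinuousLinearMap.coeFn_compLpL (p := 2) (μ := ν) (ι.comp N) (g - (Φ (g, 0)).1)]
        with t h3 h4 h5 h6
      have h7 := h1 t
      rw [map_zero, zero_add] at h7
      rw [h3, h6, ← h7, ContinuousLinearMap.comp_apply, ← h5, ← h2, h4]
    change (ι.comp N).compLpL 2 ν (Φ (g, 0)).1 + tailOp ν H (Φ (g, 0)).1 = _
    rw [e, ← map_add, add_sub_cancel]
  have hzM : z = (Φ (K q, 0)).1 := by
    rw [← sub_eq_zero]
    refine eq_zero_of_inner_add_tailOp (ν := ν) ha hN hι h₀ ?_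
    change inner ℝ (A _) _ = _
    rw [map_sub, hA, hAM, sub_self, inner_zero_left]
  have hn1 : ‖z‖ ≤ ‖K q‖ := by
    have := (hΦ (K q, 0)).2.2
    simp only [map_zero, add_zero] at this
    rw [← hzM] at this
    exact abs_le_of_sq_le_sq' this (norm_nonneg _) |>.2
  have hn2 := hK q
  have hn3 : ‖q‖ ≤ ‖z‖ + ‖K q‖ := by
    have := norm_sub_le z (K q)
    rwa [hz, add_sub_cancel_right, ← hz] at this
  have hq0 : ‖q‖ = 0 := le_antisymm (by linarith) (norm_nonneg _)
  have hz0 : z = 0 := by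
    rw [← norm_eq_zero]
    refine le_antisymm ?_ (norm_nonneg _)
    linarith
  rw [Lp.eq_zero_iff_ae_eq_zero] at hz0 ⊢
  filter_upwards [hz0, ContinuousLinearMap.coeFn_compLpL (p := 2) (μ := ν) ι u] with t h1 h2
  refine hι' ?_
  rw [← h2, h1, Pi.zero_apply, Pi.zero_apply, map_zero]

end AbstractPerturbation

/-! ### Weak derivatives on an interval and their primitives. -/

section WeakDerivative

variable {X Y : Type*} [NormedAddCommGroup X] [NormedSpace ℝ X]
  [NormedAddCommGroup Y] [NormedSpace ℝ Y] {a b : ℝ}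

theorem Integrable.testFunction_smul {ν : Measure ℝ} {g : ℝ → ℝ} (hg : Continuous g)
    (hc : HasCompactSupport g) {u : ℝ → X} (hu : Integrable u ν) :
    Integrable (fun t => g t • u t) ν := by
  obtain ⟨C, hC⟩ := hc.exists_bound_of_continuous hg
  exact hu.bdd_smul C hg.aestronglyMeasurable (Filter.Eventually.of_forall hC)

theorem setIntegral_deriv_testFunction {ψ : ℝ → ℝ} (h1 : ContDiff ℝ ∞ ψ)
    (h3 : tsupport ψ ⊆ Ioo a b) {s : ℝ} (hs : s ∈ Icc a b) :
    ∫ t in Ioo a s, deriv ψ t = ψ s := by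
  rw [← integral_Ioc_eq_integral_Ioo, ← intervalIntegral.integral_of_le hs.1,
    intervalIntegral.integral_deriv_eq_sub (fun x _ => h1.differentiable (by simp) x)
      ((h1.continuous_deriv (by simp)).intervalIntegrable _ _)]
  have : ψ a = 0 := image_eq_zero_of_notMem_tsupport fun h => lt_irrefl _ (h3 h).1
  rw [this, sub_zero]

/-- Fubini moves the integration onto `deriv ψ`, whose integral from `a` to `s` is `ψ s`. The minus
sign reflects integration towards the right end. -/
theorem HasWeakDerivOn.integral_Ioi [CompleteSpace X] {f : ℝ → X}
    (hf : Integrable f (volume.restrict (Ioo a b))) :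
    HasWeakDerivOn a b (fun t => ∫ s in Ioi t, f s ∂(volume.restrict (Ioo a b)))
      (fun t => -f t) := by
  intro ψ h1 h2 h3
  have hψ : Integrable (deriv ψ) (volume.restrict (Ioo a b)) :=
    ((h1.continuous_deriv (by simp)).integrable_of_hasCompactSupport h2.deriv).restrict
  have h := integral_bilin_Ioi_swap (ContinuousLinearMap.lsmul ℝ ℝ : ℝ →L[ℝ] X →L[ℝ] X) hψ hf
  simp only [ContinuousLinearMap.lsmul_apply] at h
  rw [h, ← integral_neg]
  refine setIntegral_congr_fun measurableSet_Ioo fun s hs => ?_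
  have e : ∫ t in Iio s, deriv ψ t ∂(volume.restrict (Ioo a b)) = ψ s := by
    rw [Measure.restrict_restrict measurableSet_Iio]
    have : Iio s ∩ Ioo a b = Ioo a s := by
      ext t; simp only [mem_inter_iff, mem_Iio, mem_Ioo]
      exact ⟨fun h => ⟨h.2.1, h.1⟩, fun h => ⟨h.2, h.1, h.2.trans hs.2⟩⟩
    rw [this]
    exact setIntegral_deriv_testFunction h1 h3 ⟨hs.1.le, hs.2.le⟩
  simp only [e, smul_neg, neg_neg]

theorem HasWeakDerivOn.const [CompleteSpace X] (hab : a ≤ b) (x : X) :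
    HasWeakDerivOn a b (fun _ => x) 0 := by
  intro ψ h1 h2 h3
  rw [integral_smul_const, setIntegral_deriv_testFunction h1 h3 ⟨hab, le_rfl⟩]
  have : ψ b = 0 := image_eq_zero_of_notMem_tsupport fun h => lt_irrefl _ (h3 h).2
  simp [this]

theorem HasWeakDerivOn.add {u u' v v' : ℝ → X} (hu : HasWeakDerivOn a b u u')
    (hv : HasWeakDerivOn a b v v') (iu : Integrable u (volume.restrict (Ioo a b)))
    (iu' : Integrable u' (volume.restrict (Ioo a b)))
    (iv : Integrable v (volume.restrict (Ioo a b)))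
    (iv' : Integrable v' (volume.restrict (Ioo a b))) :
    HasWeakDerivOn a b (fun t => u t + v t) (fun t => u' t + v' t) := by
  intro ψ h1 h2 h3
  have c := h1.continuous_deriv (by simp)
  simp only [smul_add]
  rw [integral_add (Integrable.testFunction_smul c h2.deriv iu)
    (Integrable.testFunction_smul c h2.deriv iv),
    integral_add (Integrable.testFunction_smul h1.continuous h2 iu')
    (Integrable.testFunction_smul h1.continuous h2 iv'), hu ψ h1 h2 h3, hv ψ h1 h2 h3]
  abel

theorem HasWeakDerivOn.smul_contDiff {u u' : ℝ → X} (hu : HasWeakDerivOn a b u u')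
    (iu : Integrable u (volume.restrict (Ioo a b)))
    (iu' : Integrable u' (volume.restrict (Ioo a b))) {η : ℝ → ℝ} (hη : ContDiff ℝ ∞ η) :
    HasWeakDerivOn a b (fun t => η t • u t) (fun t => η t • u' t + deriv η t • u t) := by
  intro ψ h1 h2 h3
  have c := h1.continuous_deriv (by simp)
  have cη := hη.continuous_deriv (by simp)
  have h := hu (fun t => ψ t * η t) (h1.mul hη) h2.mul_right
    ((tsupport_mul_subset_left).trans h3)
  have e : ∀ t, deriv (fun t => ψ t * η t) t = deriv ψ t * η t + ψ t * deriv η t := fun t =>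
    deriv_fun_mul (h1.differentiable (by simp) t) (hη.differentiable (by simp) t)
  simp only [e, add_smul, smul_add, ← mul_smul] at h ⊢
  have i1 : Integrable (fun t => (deriv ψ t * η t) • u t) (volume.restrict (Ioo a b)) :=
    Integrable.testFunction_smul (c.mul hη.continuous) h2.deriv.mul_right iu
  have i2 : Integrable (fun t => (ψ t * deriv η t) • u t) (volume.restrict (Ioo a b)) :=
    Integrable.testFunction_smul (h1.continuous.mul cη) h2.mul_right iu
  have i3 : Integrable (fun t => (ψ t * η t) • u' t) (volume.restrict (Ioo a b)) :=
    Integrable.testFunction_smul (h1.continuous.mul hη.continuous) h2.mul_right iu'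
  rw [integral_add i1 i2] at h
  rw [integral_add i3 i2, neg_add, ← h]
  abel

theorem HasWeakDerivOn.comp_clm [CompleteSpace X] [CompleteSpace Y] {u u' : ℝ → X}
    (hu : HasWeakDerivOn a b u u')
    (iu : Integrable u (volume.restrict (Ioo a b)))
    (iu' : Integrable u' (volume.restrict (Ioo a b))) (L : X →L[ℝ] Y) :
    HasWeakDerivOn a b (fun t => L (u t)) (fun t => L (u' t)) := by
  intro ψ h1 h2 h3
  have c := h1.continuous_deriv (by simp)
  simp only [← map_smul]
  rw [L.integral_comp_comm (Integrable.testFunction_smul c h2.deriv iu),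
    L.integral_comp_comm (Integrable.testFunction_smul h1.continuous h2 iu'), hu ψ h1 h2 h3,
    map_neg]

theorem HasWeakDerivOn.congr {u u' v v' : ℝ → X} (hu : HasWeakDerivOn a b u u')
    (h : ∀ᵐ t ∂(volume.restrict (Ioo a b)), u t = v t)
    (h' : ∀ᵐ t ∂(volume.restrict (Ioo a b)), u' t = v' t) : HasWeakDerivOn a b v v' := by
  intro ψ h1 h2 h3
  have e := hu ψ h1 h2 h3
  rw [integral_congr_ae (g := fun t => deriv ψ t • u t) (by filter_upwards [h] with t ht; rw [ht]),
    e]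
  congr 1
  exact integral_congr_ae (by filter_upwards [h'] with t ht; rw [ht])

theorem exists_Icc_of_compact_subset_Ioo (hab : a < b) {K : Set ℝ} (hK : IsCompact K)
    (hs : K ⊆ Ioo a b) : ∃ a' b', a < a' ∧ a' ≤ b' ∧ b' < b ∧ K ⊆ Icc a' b' := by
  rcases K.eq_empty_or_nonempty with rfl | hne
  · exact ⟨(a + b) / 2, (a + b) / 2, by linarith, le_rfl, by linarith, empty_subset _⟩
  · obtain ⟨m, hm, hm'⟩ := hK.exists_isLeast hne
    obtain ⟨M, hM, hM'⟩ := hK.exists_isGreatest hne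
    exact ⟨m, M, (hs hm).1, hm' hM, (hs hM).2, fun x hx => ⟨hm' hx, hM' hx⟩⟩

/-- The primitive vanishes to the left of the support, and to the right of it because the total
integral is zero. -/
theorem exists_antiderivative_testFunction (hab : a < b) {η : ℝ → ℝ} (h1 : ContDiff ℝ ∞ η)
    (h2 : HasCompactSupport η) (h3 : tsupport η ⊆ Ioo a b) (h0 : ∫ t, η t = 0) :
    ∃ ψ : ℝ → ℝ, ContDiff ℝ ∞ ψ ∧ HasCompactSupport ψ ∧ tsupport ψ ⊆ Ioo a b ∧
      deriv ψ = η := by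
  obtain ⟨a', b', ha, hab', hb, hK⟩ := exists_Icc_of_compact_subset_Ioo hab h2 h3
  have hz : ∀ t, t ∉ Icc a' b' → η t = 0 := fun t ht =>
    image_eq_zero_of_notMem_tsupport fun h => ht (hK h)
  set ψ : ℝ → ℝ := fun t => ∫ s in a..t, η s
  have hd : ∀ t, HasDerivAt ψ (η t) t := fun t =>
    intervalIntegral.integral_hasDerivAt_right (h1.continuous.intervalIntegrable _ _)
      (h1.continuous.stronglyMeasurableAtFilter _ _) h1.continuous.continuousAt
  have hψd : deriv ψ = η := funext fun t => (hd t).deriv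
  have hψ1 : ContDiff ℝ ∞ ψ := by
    rw [contDiff_infty_iff_deriv, hψd]
    exact ⟨fun t => (hd t).differentiableAt, h1⟩
  have hψ0 : ∀ t, t ∉ Icc a' b' → ψ t = 0 := by
    intro t ht
    by_cases h : t < a'
    · refine intervalIntegral.integral_zero_ae (Filter.Eventually.of_forall fun s hs => hz s ?_)
      intro hs'
      rcases le_total a t with h' | h'
      · rw [uIoc_of_le h'] at hs
        linarith [hs.2, hs'.1]
      · rw [uIoc_of_ge h'] at hs
        linarith [hs.2, hs'.1]
    · have htb : b' < t := by
        by_contra h'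
        exact ht ⟨not_lt.1 h, not_lt.1 h'⟩
      have e : ∫ s in a..t, η s = ∫ s, η s := by
        rw [intervalIntegral.integral_of_le (by linarith)]
        refine setIntegral_eq_integral_of_forall_compl_eq_zero fun s hs => hz s fun hs' => hs ?_
        exact ⟨by linarith [hs'.1], by linarith [hs'.2]⟩
      change ∫ s in a..t, η s = 0
      rw [e, h0]
  have hsupp : tsupport ψ ⊆ Icc a' b' := by
    refine closure_minimal (fun t ht => ?_) isClosed_Icc
    by_contra h
    exact ht (hψ0 t h)
  exact ⟨ψ, hψ1, HasCompactSupport.of_support_subset_isCompact isCompact_Icc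
    ((subset_tsupport _).trans hsupp), hsupp.trans fun t ht => ⟨by linarith [ht.1],
      by linarith [ht.2]⟩, hψd⟩

theorem exists_testFunction_integral_one (hab : a < b) : ∃ χ : ℝ → ℝ, ContDiff ℝ ∞ χ ∧
    HasCompactSupport χ ∧ tsupport χ ⊆ Ioo a b ∧ ∫ t, χ t = 1 := by
  -- The outer radius is less than half the length of the interval, so the closed ball supporting
  -- the bump is inside it.
  let f : ContDiffBump ((a + b) / 2) := ⟨(b - a) / 8, (b - a) / 4, by linarith, by linarith⟩
  refine ⟨f.normed volume, f.contDiff_normed, f.hasCompactSupport_normed, ?_, f.integral_normed⟩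
  rw [f.tsupport_normed_eq, Real.closedBall_eq_Icc]
  intro t ht
  have h : f.rOut = (b - a) / 4 := rfl
  rw [h] at ht
  exact ⟨by linarith [ht.1], by linarith [ht.2]⟩

/-- Having zero as a primitive means vanishing against all test functions. This is how the
fundamental lemma of the calculus of variations is used below. -/
theorem HasWeakDerivOn.eq_zero [CompleteSpace X] {u' : ℝ → X}
    (hu : HasWeakDerivOn a b (0 : ℝ → X) u')
    (iu' : Integrable u' (volume.restrict (Ioo a b))) :
    ∀ᵐ t ∂(volume.restrict (Ioo a b)), u' t = 0 := by
  rw [ae_restrict_iff' measurableSet_Ioo]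
  refine isOpen_Ioo.ae_eq_zero_of_integral_contDiff_smul_eq_zero
    (IntegrableOn.locallyIntegrableOn iu') fun g h1 h2 h3 => ?_
  have := hu g h1 h2 h3
  simp only [Pi.zero_apply, smul_zero, integral_zero] at this
  rw [← setIntegral_eq_integral_of_forall_compl_eq_zero (s := Ioo a b), ← neg_eq_zero, ← this]
  intro t ht
  rw [image_eq_zero_of_notMem_tsupport fun h => ht (h3 h), zero_smul]

/-- The lemma of du Bois-Reymond. -/
theorem HasWeakDerivOn.exists_eq_const [CompleteSpace X] (hab : a < b) {u : ℝ → X}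
    (hu : HasWeakDerivOn a b u 0) (iu : Integrable u (volume.restrict (Ioo a b))) :
    ∃ c, ∀ᵐ t ∂(volume.restrict (Ioo a b)), u t = c := by
  obtain ⟨χ, hχ1, hχ2, hχ3, hχ⟩ := exists_testFunction_integral_one hab
  refine ⟨∫ t in Ioo a b, χ t • u t, ?_⟩
  set c := ∫ t in Ioo a b, χ t • u t
  have key : HasWeakDerivOn a b (0 : ℝ → X) (fun t => u t - c) := by
    intro φ h1 h2 h3
    have hφs : ∫ t in Ioo a b, φ t = ∫ t, φ t :=
      setIntegral_eq_integral_of_forall_compl_eq_zero fun t ht =>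
        image_eq_zero_of_notMem_tsupport fun h => ht (h3 h)
    have hφi := h1.continuous.integrable_of_hasCompactSupport (μ := volume) h2
    have hχi := hχ1.continuous.integrable_of_hasCompactSupport (μ := volume) hχ2
    -- Subtracting `(∫ φ) χ` makes the integral zero, so the difference is the derivative of a test
    -- function and is annihilated by `u`.
    obtain ⟨ψ, p1, p2, p3, p4⟩ := exists_antiderivative_testFunction hab
      (η := fun t => φ t - (∫ s, φ s) * χ t) (h1.sub (contDiff_const.mul hχ1))
      (h2.sub hχ2.mul_left)
      ((tsupport_sub _ _).trans (union_subset h3 (tsupport_mul_subset_right.trans hχ3)))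
      (by rw [integral_sub hφi (hχi.const_mul _), integral_const_mul, hχ]; ring)
    have e := hu ψ p1 p2 p3
    simp only [p4, Pi.zero_apply, smul_zero, integral_zero, neg_zero, sub_smul, mul_smul] at e ⊢
    have i1 := Integrable.testFunction_smul h1.continuous h2 iu
    have i2 := Integrable.testFunction_smul hχ1.continuous hχ2 iu
    have e2 := integral_sub i1 (i2.smul (∫ s, φ s))
    simp only [Pi.smul_apply] at e2
    rw [e2, integral_smul] at e
    simp only [smul_sub]
    rw [integral_sub i1 (hφi.restrict.smul_const c), integral_smul_const, hφs, e, neg_zero]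
  have := key.eq_zero (iu.sub (integrable_const c))
  filter_upwards [this] with t ht
  exact sub_eq_zero.1 ht

/-- The sum has zero weak derivative. This supplies the continuous representative used for traces
and the time-integrated equation used for uniqueness. -/
theorem HasWeakDerivOn.exists_primitive [CompleteSpace X] (hab : a < b) {u u' : ℝ → X}
    (hu : HasWeakDerivOn a b u u') (iu : Integrable u (volume.restrict (Ioo a b)))
    (iu' : Integrable u' (volume.restrict (Ioo a b))) :
    ∃ c, ∀ᵐ t ∂(volume.restrict (Ioo a b)),
      u t + ∫ s in Ioi t, u' s ∂(volume.restrict (Ioo a b)) = c := by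
  have hc : Continuous fun t => ∫ s in Ioi t, u' s ∂(volume.restrict (Ioo a b)) :=
    continuous_integral_Ioi iu'
  have hi : Integrable (fun t => ∫ s in Ioi t, u' s ∂(volume.restrict (Ioo a b)))
      (volume.restrict (Ioo a b)) :=
    (hc.integrableOn_Icc (a := a) (b := b)).mono_set Ioo_subset_Icc_self
  refine HasWeakDerivOn.exists_eq_const hab ?_ (iu.add hi)
  refine (hu.add (HasWeakDerivOn.integral_Ioi iu') iu iu' hi iu'.neg).congr
    (Filter.Eventually.of_forall fun _ => rfl) (Filter.Eventually.of_forall fun t => ?_)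
  simp

theorem eqOn_Icc_of_ae_eq {E : Type*} [NormedAddCommGroup E] {u v : ℝ → E} (hab : a < b)
    (hu : ContinuousOn u (Icc a b))
    (hv : ContinuousOn v (Icc a b)) (h : ∀ᵐ t ∂(volume.restrict (Ioo a b)), u t = v t) :
    EqOn u v (Icc a b) := by
  refine Measure.eqOn_Icc_of_ae_eq volume hab.ne ?_ hu hv
  rw [← restrict_Ioo_eq_restrict_Icc]
  exact h

end WeakDerivative

/-! ### Edges, parametrizations and functions on the network. -/

namespace Network

section Geometry

variable {n : ℕ} {I A : Type*} [Fintype I] [Fintype A] (N : Network n I A)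

theorem length_pos (α : A) : 0 < N.length α :=
  dist_pos.2 fun h => N.src_ne_tgt α (N.pos_injective h)

theorem param_zero (α : A) : N.param α 0 = N.pos (N.src α) := by
  simp [param]

theorem param_length (α : A) : N.param α (N.length α) = N.pos (N.tgt α) := by
  simp [param, div_self (N.length_pos α).ne']

theorem dist_param (α : A) {y : ℝ} (hy : 0 ≤ y) :
    dist (N.param α y) (N.pos (N.src α)) = y := by
  rw [param, dist_lineMap_left, Real.norm_eq_abs, abs_of_nonneg (div_nonneg hy (N.length_pos α).le)]
  exact div_mul_cancel₀ y (N.length_pos α).ne'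

theorem param_mem_edge (α : A) {y : ℝ} (hy : y ∈ Icc 0 (N.length α)) : N.param α y ∈ N.edge α := by
  rw [edge, segment_eq_image_lineMap]
  exact ⟨y / N.length α, ⟨div_nonneg hy.1 (N.length_pos α).le,
    (div_le_one (N.length_pos α)).2 hy.2⟩, rfl⟩

theorem exists_param (α : A) {x : EuclideanSpace ℝ (Fin n)} (hx : x ∈ N.edge α) :
    ∃ y ∈ Icc 0 (N.length α), N.param α y = x := by
  rw [edge, segment_eq_image_lineMap] at hx
  obtain ⟨t, ht, rfl⟩ := hx
  have h := N.length_pos α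
  refine ⟨t * N.length α, ⟨mul_nonneg ht.1 h.le, mul_le_of_le_one_left h.le ht.2⟩, ?_⟩
  rw [param, mul_div_cancel_right₀ _ h.ne']

theorem param_injOn (α : A) : InjOn (N.param α) (Icc 0 (N.length α)) := fun y hy z hz h => by
  rw [← N.dist_param α hy.1, ← N.dist_param α hz.1, h]

theorem mem_adj {i : I} {α : A} : α ∈ N.adj i ↔ N.pos i ∈ N.edge α := by simp [adj]

theorem endParam_src (α : A) : N.endParam (N.src α) α = 0 := by simp [endParam]

theorem endParam_tgt (α : A) : N.endParam (N.tgt α) α = N.length α := by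
  simp [endParam, (N.src_ne_tgt α).symm]

theorem endParam_mem (i : I) (α : A) : N.endParam i α ∈ Icc 0 (N.length α) := by
  have := N.length_pos α
  unfold endParam
  split_ifs
  · exact ⟨le_rfl, this.le⟩
  · exact ⟨this.le, le_rfl⟩

theorem param_endParam {i : I} {α : A} (h : α ∈ N.adj i) :
    N.param α (N.endParam i α) = N.pos i := by
  rcases N.vertex_mem_edge i α (N.mem_adj.1 h) with rfl | rfl
  · rw [endParam_src, param_zero]
  · rw [endParam_tgt, param_length]

theorem endParam_eq_of_param_eq {i : I} {α : A} {y : ℝ} (hy : y ∈ Icc 0 (N.length α))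
    (h : N.param α y = N.pos i) : α ∈ N.adj i ∧ y = N.endParam i α := by
  have hα : α ∈ N.adj i := N.mem_adj.2 (h ▸ N.param_mem_edge α hy)
  exact ⟨hα, N.param_injOn α hy (N.endParam_mem i α) (h.trans (N.param_endParam hα).symm)⟩

/-- Distinct edges share at most a vertex, and a vertex on an edge is one of its ends. Hence the
open edges are disjoint and functions can be prescribed on each one independently; distance to the
source recovers the parameter. -/
theorem eq_of_param_mem_edge {α β : A} {y : ℝ} (hy : y ∈ Ioo 0 (N.length α))
    (h : N.param α y ∈ N.edge β) : α = β := by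
  by_contra hne
  have hy' := Ioo_subset_Icc_self hy
  have hm : N.param α y ∈ N.edge α ∩ N.edge β := ⟨N.param_mem_edge α hy', h⟩
  rcases N.inter_edges α β hne with h0 | ⟨i, hi⟩
  · unfold edge at hm; rw [h0] at hm; exact hm
  · unfold edge at hm; rw [hi, mem_singleton_iff] at hm
    obtain ⟨hα, rfl⟩ := N.endParam_eq_of_param_eq hy' hm
    unfold endParam at hy
    split_ifs at hy
    · exact lt_irrefl _ hy.1
    · exact lt_irrefl _ hy.2

/-- The edge without its end points. -/
def openEdge (α : A) : Set (EuclideanSpace ℝ (Fin n)) :=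
  {x | x ∈ N.edge α ∧ dist x (N.pos (N.src α)) ∈ Ioo 0 (N.length α)}

theorem isClosed_edge (α : A) : IsClosed (N.edge α) := by
  rw [edge, segment_eq_image_lineMap]
  exact (isCompact_Icc.image AffineMap.lineMap_continuous).isClosed

theorem measurableSet_openEdge (α : A) : MeasurableSet (N.openEdge α) :=
  (N.isClosed_edge α).measurableSet.inter
    (measurableSet_Ioo.preimage (continuous_id.dist continuous_const).measurable)

theorem mem_openEdge {α β : A} {y : ℝ} (hy : y ∈ Ioo 0 (N.length α)) :
    N.param α y ∈ N.openEdge β ↔ β = α := by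
  constructor
  · exact fun h => (N.eq_of_param_mem_edge hy h.1).symm
  · rintro rfl
    exact ⟨N.param_mem_edge _ (Ioo_subset_Icc_self hy), by rwa [N.dist_param _ hy.1.le]⟩

theorem exists_param_of_mem_openEdge {α : A} {x : EuclideanSpace ℝ (Fin n)}
    (h : x ∈ N.openEdge α) : ∃ y ∈ Ioo 0 (N.length α), N.param α y = x := by
  obtain ⟨y, hy, rfl⟩ := N.exists_param α h.1
  exact ⟨y, by simpa [N.dist_param α hy.1] using h.2, rfl⟩

/-- The function on `Γ` with given values on the open edges. -/
noncomputable def glue (f : A → ℝ → ℝ) (x : EuclideanSpace ℝ (Fin n)) : ℝ :=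
  ∑ α, (N.openEdge α).indicator (fun x => f α (dist x (N.pos (N.src α)))) x

theorem glue_param (f : A → ℝ → ℝ) {α : A} {y : ℝ} (hy : y ∈ Ioo 0 (N.length α)) :
    N.glue f (N.param α y) = f α y := by
  rw [glue, Finset.sum_eq_single α]
  · rw [indicator_of_mem ((N.mem_openEdge hy).2 rfl), N.dist_param α hy.1.le]
  · intro β _ hβ
    exact indicator_of_notMem (fun h => hβ ((N.mem_openEdge hy).1 h)) _
  · simp

theorem measurable_glue {f : A → ℝ → ℝ} (hf : ∀ α, Continuous (f α)) : Measurable (N.glue f) := by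
  unfold glue
  refine Finset.measurable_sum _ fun α _ => Measurable.indicator ?_ (N.measurableSet_openEdge α)
  exact ((hf α).comp (continuous_id.dist continuous_const)).measurable

theorem exists_bound_glue {f : A → ℝ → ℝ} (hf : ∀ α, Continuous (f α)) :
    ∃ C, ∀ x, ‖N.glue f x‖ ≤ C := by
  choose C hC using fun α => isCompact_Icc.exists_bound_of_continuousOn
    (s := Icc 0 (N.length α)) (hf α).continuousOn
  refine ⟨∑ α, C α, fun x => (norm_sum_le _ _).trans (Finset.sum_le_sum fun α _ => ?_)⟩
  have h0 : 0 ≤ C α := (norm_nonneg _).trans (hC α 0 ⟨le_rfl, (N.length_pos α).le⟩)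
  by_cases h : x ∈ N.openEdge α
  · rw [indicator_of_mem h]
    exact hC α _ (Ioo_subset_Icc_self h.2)
  · rw [indicator_of_notMem h, norm_zero]
    exact h0

instance : IsFiniteMeasure N.measure := by
  unfold measure
  rw [Measure.sum_fintype]
  infer_instance

theorem ae_measure_iff {p : EuclideanSpace ℝ (Fin n) → Prop} (hp : MeasurableSet {x | p x}) :
    (∀ᵐ x ∂N.measure, p x) ↔
      ∀ α, ∀ᵐ y ∂volume.restrict (Ioo 0 (N.length α)), p (N.param α y) := by
  unfold measure
  rw [Measure.ae_sum_iff]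
  exact forall_congr' fun α => ae_map_iff (N.continuous_param α).aemeasurable hp

theorem ae_exists_param : ∀ᵐ x ∂N.measure, ∃ α, ∃ y ∈ Ioo 0 (N.length α), N.param α y = x := by
  have h : ∀ᵐ x ∂N.measure, x ∈ ⋃ α, N.openEdge α := by
    refine (N.ae_measure_iff (p := fun x => x ∈ ⋃ α, N.openEdge α)
      (MeasurableSet.iUnion N.measurableSet_openEdge)).2 fun α => ?_
    filter_upwards [ae_restrict_mem measurableSet_Ioo] with y hy
    exact mem_iUnion.2 ⟨α, (N.mem_openEdge hy).2 rfl⟩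
  filter_upwards [h] with x hx
  obtain ⟨α, hα⟩ := mem_iUnion.1 hx
  exact ⟨α, N.exists_param_of_mem_openEdge hα⟩

theorem ext_param {u v : N.L2}
    (h : ∀ α, ∀ᵐ y ∂volume.restrict (Ioo 0 (N.length α)), u (N.param α y) = v (N.param α y)) :
    u = v := by
  apply Lp.ext
  exact (N.ae_measure_iff (measurableSet_eq_fun (Lp.stronglyMeasurable u).measurable
    (Lp.stronglyMeasurable v).measurable)).2 h

theorem integral_measure {g : EuclideanSpace ℝ (Fin n) → ℝ} (hg : Integrable g N.measure) :
    ∫ x, g x ∂N.measure = ∑ α, ∫ y in Ioo 0 (N.length α), g (N.param α y) := by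
  unfold measure at hg ⊢
  rw [Measure.sum_fintype] at hg ⊢
  have hg' := integrable_finsetSum_measure.1 hg
  rw [integral_finsetSum_measure hg']
  refine Finset.sum_congr rfl fun α hα => ?_
  exact integral_map (N.continuous_param α).aemeasurable (hg' α hα).1

theorem inner_eq_sum (u v : N.L2) :
    inner ℝ u v = ∑ α, ∫ y in Ioo 0 (N.length α), u (N.param α y) * v (N.param α y) := by
  rw [L2.inner_def, N.integral_measure (L2.integrable_inner u v)]
  refine Finset.sum_congr rfl fun α _ => integral_congr_ae (Filter.Eventually.of_forall fun y => ?_)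
  simp [mul_comm]

theorem integrable_param (u : N.L2) (α : A) :
    Integrable (fun y => u (N.param α y)) (volume.restrict (Ioo 0 (N.length α))) :=
  (N.memLp_param u α).integrable (by norm_num)

theorem memLp_glue_mul {f : A → ℝ → ℝ} (hf : ∀ α, Continuous (f α)) (u : N.L2) :
    MemLp (fun x => N.glue f x * u x) 2 N.measure :=
  (Lp.memLp u).of_le_mul (c := (N.exists_bound_glue hf).choose)
    ((N.measurable_glue hf).aestronglyMeasurable.mul (Lp.aestronglyMeasurable u))
    (Filter.Eventually.of_forall fun x => by
      rw [norm_mul]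
      have := (N.exists_bound_glue hf).choose_spec x
      gcongr)

/-- Multiplication by a function that is continuous on every edge. -/
noncomputable def mulL {f : A → ℝ → ℝ} (hf : ∀ α, Continuous (f α)) : N.L2 →L[ℝ] N.L2 :=
  have hm := N.memLp_glue_mul hf
  LinearMap.mkContinuous
    { toFun := fun u => (hm u).toLp _
      map_add' := fun u v => by
        apply Lp.ext
        filter_upwards [(hm (u + v)).coeFn_toLp, (hm u).coeFn_toLp, (hm v).coeFn_toLp,
          Lp.coeFn_add u v, Lp.coeFn_add ((hm u).toLp _) ((hm v).toLp _)] with x h1 h2 h3 h4 h5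
        rw [h1, h5, Pi.add_apply, h2, h3, h4, Pi.add_apply, mul_add]
      map_smul' := fun c u => by
        apply Lp.ext
        filter_upwards [(hm (c • u)).coeFn_toLp, (hm u).coeFn_toLp,
          Lp.coeFn_smul c u, Lp.coeFn_smul c ((hm u).toLp _)] with x h1 h2 h4 h5
        rw [RingHom.id_apply, h1, h5, Pi.smul_apply, h2, h4, Pi.smul_apply]
        simp only [smul_eq_mul]; ring }
    (N.exists_bound_glue hf).choose
    (fun u => by
      refine Lp.norm_le_mul_norm_of_ae_le_mul ?_
      filter_upwards [(hm u).coeFn_toLp] with x h1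
      change ‖(hm u).toLp _ x‖ ≤ _
      rw [h1, norm_mul]
      have := (N.exists_bound_glue hf).choose_spec x
      gcongr)

theorem mulL_param {f : A → ℝ → ℝ} (hf : ∀ α, Continuous (f α)) (u : N.L2) (α : A) :
    ∀ᵐ y ∂volume.restrict (Ioo 0 (N.length α)),
      N.mulL hf u (N.param α y) = f α y * u (N.param α y) := by
  have h : ∀ᵐ x ∂N.measure, N.mulL hf u x = N.glue f x * u x :=
    (N.memLp_glue_mul hf u).coeFn_toLp
  filter_upwards [N.ae_param h α, ae_restrict_mem measurableSet_Ioo] with y h1 h2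
  rw [h1, N.glue_param f h2]

/-- The element of `L²(Γ)` given by functions that are continuous on every edge. -/
noncomputable def lift {f : A → ℝ → ℝ} (hf : ∀ α, Continuous (f α)) : N.L2 :=
  N.mulL hf (Lp.const 2 N.measure 1)

theorem lift_param {f : A → ℝ → ℝ} (hf : ∀ α, Continuous (f α)) (α : A) :
    ∀ᵐ y ∂volume.restrict (Ioo 0 (N.length α)), N.lift hf (N.param α y) = f α y := by
  filter_upwards [N.mulL_param hf (Lp.const 2 N.measure 1) α,
    N.ae_param (Lp.coeFn_const 2 N.measure (1 : ℝ)) α] with y h1 h2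
  rw [lift, h1, h2, Function.const_apply, mul_one]

/-- The restriction of a function to an edge. -/
noncomputable def pull (α : A) : N.L2 →L[ℝ] Lp ℝ 2 (volume.restrict (Ioo 0 (N.length α))) :=
  LinearMap.mkContinuous
    { toFun := fun u => (N.memLp_param u α).toLp _
      map_add' := fun u v => by
        apply Lp.ext
        filter_upwards [(N.memLp_param (u + v) α).coeFn_toLp, (N.memLp_param u α).coeFn_toLp,
          (N.memLp_param v α).coeFn_toLp, N.add_param u v α,
          Lp.coeFn_add ((N.memLp_param u α).toLp _) ((N.memLp_param v α).toLp _)]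
          with x h1 h2 h3 h4 h5
        rw [h1, h5, Pi.add_apply, h2, h3, h4]
      map_smul' := fun c u => by
        apply Lp.ext
        filter_upwards [(N.memLp_param (c • u) α).coeFn_toLp, (N.memLp_param u α).coeFn_toLp,
          N.smul_param c u α, Lp.coeFn_smul c ((N.memLp_param u α).toLp _)]
          with x h1 h2 h4 h5
        rw [RingHom.id_apply, h1, h5, Pi.smul_apply, h2, h4, smul_eq_mul] }
    1
    (fun u => by
      rw [one_mul]
      change ‖(N.memLp_param u α).toLp _‖ ≤ _
      rw [Lp.norm_toLp, Lp.norm_def]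
      refine ENNReal.toReal_mono (Lp.memLp u).2.ne ?_
      have h : eLpNorm u 2 ((volume.restrict (Ioo 0 (N.length α))).map (N.param α)) ≤
          eLpNorm u 2 N.measure := eLpNorm_mono_measure _ (Measure.le_sum _ α)
      rwa [eLpNorm_map_measure (Lp.stronglyMeasurable u).aestronglyMeasurable
        (N.continuous_param α).aemeasurable] at h)

theorem coeFn_pull (α : A) (u : N.L2) :
    ∀ᵐ y ∂volume.restrict (Ioo 0 (N.length α)), N.pull α u y = u (N.param α y) :=
  (N.memLp_param u α).coeFn_toLp

end Geometry

end Network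

/-! ### Traces at the vertices and completeness of `V`. -/

namespace Network

section Trace

variable {n : ℕ} {I A : Type*} [Fintype I] [Fintype A] (N : Network n I A)

/-- The length measure of an edge, on the parameter interval. -/
noncomputable abbrev edgeVol (α : A) : Measure ℝ := volume.restrict (Ioo 0 (N.length α))

/-- The components of a tuple. -/
noncomputable abbrev comp {s : ℕ} (k : Fin (s + 1)) : N.L2Tuple s →L[ℝ] N.L2 :=
  PiLp.proj 2 (fun _ : Fin (s + 1) => N.L2) k

/-- The mean value on an edge. -/
noncomputable def mean (α : A) : Lp ℝ 2 (N.edgeVol α) →L[ℝ] ℝ :=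
  (N.length α)⁻¹ •
    (BoundedContinuousFunction.evalCLM ℝ 0).comp (tailIntegral (N.edgeVol α) ℝ)

/-- The constant of integration of the continuous representative. -/
noncomputable def traceConst (α : A) : N.L2Tuple 1 →L[ℝ] ℝ :=
  (N.mean α).comp ((N.pull α).comp (N.comp 0) +
    (tailOp (N.edgeVol α) ℝ).comp ((N.pull α).comp (N.comp 1)))

/-- The value at `y` of the continuous representative of `p 0` on the edge `α`. -/
noncomputable def trace (α : A) (y : ℝ) : N.L2Tuple 1 →L[ℝ] ℝ :=
  N.traceConst α - (BoundedContinuousFunction.evalCLM ℝ y).comp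
    ((tailIntegral (N.edgeVol α) ℝ).comp ((N.pull α).comp (N.comp 1)))

theorem trace_apply (α : A) (y : ℝ) (p : N.L2Tuple 1) :
    N.trace α y p = N.traceConst α p - tailIntegral (N.edgeVol α) ℝ (N.pull α (p 1)) y := rfl

theorem continuous_trace (α : A) (p : N.L2Tuple 1) : Continuous fun y => N.trace α y p := by
  simp only [trace_apply]
  exact continuous_const.sub (BoundedContinuousFunction.continuous _)

theorem mem_Hb_one {p : N.L2Tuple 1} : p ∈ N.Hb 1 ↔ N.IsEdgeDeriv (p 0) (p 1) := by
  change (∀ k : Fin 1, _) ↔ _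
  rw [Fin.forall_fin_one]
  rfl

theorem tailIntegral_pull (α : A) (u : N.L2) (y : ℝ) :
    tailIntegral (N.edgeVol α) ℝ (N.pull α u) y =
      ∫ s in Ioi y, u (N.param α s) ∂(N.edgeVol α) :=
  integral_congr_ae (ae_restrict_of_ae (N.coeFn_pull α u))

theorem mean_of_ae_const {α : A} {f : Lp ℝ 2 (N.edgeVol α)} {c : ℝ}
    (h : ∀ᵐ y ∂N.edgeVol α, f y = c) : N.mean α f = c := by
  have hl := N.length_pos α
  have h1 : tailIntegral (N.edgeVol α) ℝ f 0 = N.length α * c := by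
    rw [tailIntegral_apply, setIntegral_Ioi_eq (by
      rw [Measure.restrict_apply measurableSet_Iic]
      have : Iic (0 : ℝ) ∩ Ioo 0 (N.length α) = ∅ := by
        ext y; simp only [mem_inter_iff, mem_Iic, mem_Ioo, mem_empty_iff_false, iff_false]
        intro h; linarith [h.1, h.2.1]
      rw [this, measure_empty]), integral_congr_ae h]
    simp [hl.le]
  change (N.length α)⁻¹ * tailIntegral (N.edgeVol α) ℝ f 0 = c
  rw [h1, inv_mul_cancel_left₀ hl.ne']

/-- On an edge, `p 0 + ∫_{s>y} p 1` is constant exactly when `p 1` is the weak derivative of `p 0`,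
and its mean recovers the constant. The representative is thereby a bounded linear functional of the
whole tuple, defined even off `Hb`. -/
theorem mem_Hb_iff_trace {p : N.L2Tuple 1} :
    p ∈ N.Hb 1 ↔ ∀ α, ∀ᵐ y ∂N.edgeVol α, p 0 (N.param α y) = N.trace α y p := by
  rw [mem_Hb_one]
  refine forall_congr' fun α => ⟨fun h => ?_, fun h => ?_⟩
  · obtain ⟨c, hc⟩ := h.exists_primitive (N.length_pos α) (N.integrable_param _ α)
      (N.integrable_param _ α)
    have hc' : N.traceConst α p = c := by
      refine N.mean_of_ae_const (α := α) ?_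
      filter_upwards [hc, N.coeFn_pull α (p 0), coeFn_tailOp (N.pull α (p 1)),
        Lp.coeFn_add (N.pull α (p 0)) (tailOp (N.edgeVol α) ℝ (N.pull α (p 1)))] with y h1 h2 h3 h4
      rw [← h1]
      refine h4.trans ?_
      rw [Pi.add_apply, h2, h3, tailIntegral_pull]
    filter_upwards [hc] with y hy
    rw [trace_apply, hc', tailIntegral_pull, ← hy, add_sub_cancel_right]
  · have i1 : Integrable (N.pull α (p 1)) (N.edgeVol α) := Lp.integrable_of_finite _
    have h1 := HasWeakDerivOn.integral_Ioi i1.neg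
    have h2 := HasWeakDerivOn.const (N.length_pos α).le (N.traceConst α p)
    have i2 : Integrable (fun t => ∫ s in Ioi t, (-(N.pull α (p 1) : ℝ → ℝ)) s ∂(N.edgeVol α))
        (N.edgeVol α) := ((continuous_integral_Ioi i1.neg).integrableOn_Icc
          (a := 0) (b := N.length α)).mono_set Ioo_subset_Icc_self
    refine (h2.add h1 (integrable_const _) (integrable_zero _ _ _) i2 i1.neg.neg).congr ?_ ?_
    · filter_upwards [h] with y hy
      rw [hy, trace_apply, sub_eq_add_neg]
      congr 1
      simp only [Pi.neg_apply, integral_neg]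
      rfl
    · filter_upwards [N.coeFn_pull α (p 1)] with y hy
      simp [hy]

theorem isClosed_Hb_one : IsClosed (N.Hb 1 : Set (N.L2Tuple 1)) := by
  have e : (N.Hb 1 : Set (N.L2Tuple 1)) = ⋂ α, {p | N.pull α (p 0) =
      Lp.constL 2 (N.edgeVol α) ℝ (N.traceConst α p) -
        tailOp (N.edgeVol α) ℝ (N.pull α (p 1))} := by
    ext p
    rw [SetLike.mem_coe, mem_Hb_iff_trace, mem_iInter]
    refine forall_congr' fun α => ?_
    rw [mem_ofPred_eq, Lp.ext_iff]
    have h1 := N.coeFn_pull α (p 0)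
    have h2 : ∀ᵐ y ∂N.edgeVol α, (Lp.constL 2 (N.edgeVol α) ℝ (N.traceConst α p) -
        tailOp (N.edgeVol α) ℝ (N.pull α (p 1)) : Lp ℝ 2 (N.edgeVol α)) y = N.trace α y p := by
      filter_upwards [Lp.coeFn_sub (Lp.constL 2 (N.edgeVol α) ℝ (N.traceConst α p))
        (tailOp (N.edgeVol α) ℝ (N.pull α (p 1))), coeFn_tailOp (N.pull α (p 1)),
        Lp.coeFn_const 2 (N.edgeVol α) (N.traceConst α p)] with y h3 h4 h5
      rw [h3, Pi.sub_apply, h4, Lp.constL_apply, h5, trace_apply]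
      rfl
    constructor
    · intro h
      filter_upwards [h, h1, h2] with y e1 e2 e3
      rw [e2, e3, e1]
    · intro h
      filter_upwards [h, h1, h2] with y e1 e2 e3
      rw [← e2, ← e3, e1]
  rw [e]
  refine isClosed_iInter fun α => isClosed_eq ?_ ?_
  · exact ((N.pull α).comp (N.comp 0)).continuous
  · exact ((Lp.constL 2 (N.edgeVol α) ℝ).comp (N.traceConst α) -
      (tailOp (N.edgeVol α) ℝ).comp ((N.pull α).comp (N.comp 1))).continuous

/-- Continuous representatives are unique up to the end points, so the existential representatives
in the definitions can be replaced by the linear trace. -/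
theorem trace_eq_of_continuousOn {p : N.L2Tuple 1} (hp : p ∈ N.Hb 1) {α : A} {g : ℝ → ℝ}
    (hg : ContinuousOn g (Icc 0 (N.length α)))
    (h : ∀ᵐ y ∂N.edgeVol α, p 0 (N.param α y) = g y) {y : ℝ} (hy : y ∈ Icc 0 (N.length α)) :
    N.trace α y p = g y := by
  refine eqOn_Icc_of_ae_eq (N.length_pos α) (N.continuous_trace α p).continuousOn hg ?_ hy
  filter_upwards [h, N.mem_Hb_iff_trace.1 hp α] with y h1 h2
  rw [← h1, h2]

theorem mem_W_iff {γ : I → A → ℝ} {p : N.L2Tuple 1} : p ∈ N.W γ ↔ p ∈ N.Hb 1 ∧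
    ∀ i, ∀ α ∈ N.adj i, ∀ β ∈ N.adj i,
      N.trace α (N.endParam i α) p / γ i α = N.trace β (N.endParam i β) p / γ i β := by
  refine and_congr_right fun hp => ⟨?_, fun h => ?_⟩
  · rintro ⟨g, hg, hg'⟩ i α hα β hβ
    rw [N.trace_eq_of_continuousOn hp (hg α).1 (hg α).2 (N.endParam_mem i α),
      N.trace_eq_of_continuousOn hp (hg β).1 (hg β).2 (N.endParam_mem i β), hg' i α hα β hβ]
  · exact ⟨fun α y => N.trace α y p, fun α => ⟨(N.continuous_trace α p).continuousOn,
      N.mem_Hb_iff_trace.1 hp α⟩, h⟩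

theorem exists_continuousOn_carrier {t : A → ℝ → ℝ} (ht : ∀ α, Continuous (t α))
    (h : ∀ i, ∀ α ∈ N.adj i, ∀ β ∈ N.adj i, t α (N.endParam i α) = t β (N.endParam i β)) :
    ∃ g : EuclideanSpace ℝ (Fin n) → ℝ, ContinuousOn g N.carrier ∧
      ∀ α, ∀ y ∈ Icc 0 (N.length α), g (N.param α y) = t α y := by
  classical
  -- An arbitrary edge through `x` is chosen. Two edges through the same point meet at a vertex,
  -- where the compatibility condition makes the choice irrelevant.
  set g : EuclideanSpace ℝ (Fin n) → ℝ := fun x =>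
    if hx : ∃ α, x ∈ N.edge α then t hx.choose (dist x (N.pos (N.src hx.choose))) else 0
  have hg : ∀ α, ∀ y ∈ Icc 0 (N.length α), g (N.param α y) = t α y := by
    intro α y hy
    have hx : ∃ β, N.param α y ∈ N.edge β := ⟨α, N.param_mem_edge α hy⟩
    have e : g (N.param α y) =
        t hx.choose (dist (N.param α y) (N.pos (N.src hx.choose))) := dif_pos hx
    have hβ := hx.choose_spec
    rw [e]
    generalize hx.choose = β at hβ
    by_cases hne : α = β
    · subst hne
      rw [N.dist_param α hy.1]
    · have hm : N.param α y ∈ N.edge α ∩ N.edge β := ⟨N.param_mem_edge α hy, hβ⟩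
      rcases N.inter_edges α β hne with h0 | ⟨i, hi⟩
      · unfold edge at hm; rw [h0] at hm; exact absurd hm (notMem_empty _)
      · unfold edge at hm; rw [hi, mem_singleton_iff] at hm
        obtain ⟨hα, rfl⟩ := N.endParam_eq_of_param_eq hy hm
        obtain ⟨z, hz, hz'⟩ := N.exists_param β hβ
        obtain ⟨hβ', rfl⟩ := N.endParam_eq_of_param_eq hz (hz'.trans hm)
        rw [← hz', N.dist_param β hz.1]
        exact h i β hβ' α hα
  refine ⟨g, ?_, hg⟩
  refine (locallyFinite_of_finite _).continuousOn_iUnion N.isClosed_edge fun α => ?_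
  have : ContinuousOn (fun x => t α (dist x (N.pos (N.src α)))) (N.edge α) :=
    ((ht α).comp (continuous_id.dist continuous_const)).continuousOn
  refine this.congr fun x hx => ?_
  obtain ⟨y, hy, rfl⟩ := N.exists_param α hx
  dsimp only
  rw [hg α y hy, N.dist_param α hy.1]

theorem mem_contTuples_iff {s : ℕ} {p : N.L2Tuple s} {t : A → ℝ → ℝ} (ht : ∀ α, Continuous (t α))
    (hp : ∀ α, ∀ᵐ y ∂N.edgeVol α, p 0 (N.param α y) = t α y) : p ∈ N.contTuples s ↔
    ∀ i, ∀ α ∈ N.adj i, ∀ β ∈ N.adj i, t α (N.endParam i α) = t β (N.endParam i β) := by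
  constructor
  · rintro ⟨g, hg, hg'⟩ i α hα β hβ
    have key : ∀ α ∈ N.adj i, t α (N.endParam i α) = g (N.pos i) := by
      intro α hα
      have hc : ContinuousOn (fun y => g (N.param α y)) (Icc 0 (N.length α)) :=
        hg.comp (N.continuous_param α).continuousOn fun y hy =>
          mem_iUnion.2 ⟨α, N.param_mem_edge α hy⟩
      have := eqOn_Icc_of_ae_eq (N.length_pos α) (ht α).continuousOn hc (by
        filter_upwards [hp α, N.ae_param hg' α] with y h1 h2
        rw [← h1, h2]) (N.endParam_mem i α)
      rw [this]
      exact congrArg g (N.param_endParam hα)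
    rw [key α hα, key β hβ]
  · intro h
    obtain ⟨g, hg, hg'⟩ := N.exists_continuousOn_carrier ht h
    refine ⟨g, hg, ?_⟩
    have h1 : ∀ᵐ x ∂N.measure, p 0 x = N.glue t x := by
      refine (N.ae_measure_iff (measurableSet_eq_fun (Lp.stronglyMeasurable (p 0)).measurable
        (N.measurable_glue ht))).2 fun α => ?_
      filter_upwards [hp α, ae_restrict_mem measurableSet_Ioo] with y h1 h2
      rw [h1, N.glue_param t h2]
    filter_upwards [h1, N.ae_exists_param] with x hx hx'
    obtain ⟨α, y, hy, rfl⟩ := hx'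
    rw [hx, N.glue_param t hy, hg' α y (Ioo_subset_Icc_self hy)]

theorem mem_V_iff {p : N.L2Tuple 1} : p ∈ N.V ↔ p ∈ N.Hb 1 ∧
    ∀ i, ∀ α ∈ N.adj i, ∀ β ∈ N.adj i,
      N.trace α (N.endParam i α) p = N.trace β (N.endParam i β) p := by
  change p ∈ N.contTuples 1 ∧ p ∈ N.Hb 1 ↔ _
  rw [and_comm]
  exact and_congr_right fun hp => N.mem_contTuples_iff (fun α => N.continuous_trace α p)
    (N.mem_Hb_iff_trace.1 hp)

/-- The edge derivative relation and the vertex conditions are equalities between continuous linear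
maps. Closedness gives the completeness needed for Lax–Milgram. -/
theorem isClosed_V : IsClosed (N.V : Set (N.L2Tuple 1)) := by
  have e : (N.V : Set (N.L2Tuple 1)) = (N.Hb 1 : Set (N.L2Tuple 1)) ∩
      ⋂ i, ⋂ α ∈ N.adj i, ⋂ β ∈ N.adj i,
        {p | N.trace α (N.endParam i α) p = N.trace β (N.endParam i β) p} := by
    ext p
    rw [SetLike.mem_coe, mem_V_iff]
    simp only [mem_inter_iff, mem_iInter, mem_ofPred_eq, SetLike.mem_coe]
  rw [e]
  refine N.isClosed_Hb_one.inter (isClosed_iInter fun i => isClosed_iInter fun α =>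
    isClosed_iInter fun _ => isClosed_iInter fun β => isClosed_iInter fun _ =>
      isClosed_eq (N.trace _ _).continuous (N.trace _ _).continuous)

instance : CompleteSpace N.V := N.isClosed_V.completeSpace_coe

end Trace

end Network

/-! ### The weight that exchanges `V` and `W`, and test functions on one edge. -/

namespace Network

section Weight

open Classical in
/-- The function `φ` on the edge `α` and `0` elsewhere. -/
noncomputable def single {A : Type*} (α : A) (φ : ℝ → ℝ) (β : A) : ℝ → ℝ := if β = α then φ else 0

theorem single_self {A : Type*} (α : A) (φ : ℝ → ℝ) : single α φ α = φ := by simp [single]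

theorem single_of_ne {A : Type*} {α β : A} (h : β ≠ α) (φ : ℝ → ℝ) : single α φ β = 0 := by simp [single, h]

theorem continuous_single {A : Type*} (α : A) {φ : ℝ → ℝ} (h : Continuous φ) (β : A) :
    Continuous (single α φ β) := by
  unfold single
  split_ifs
  · exact h
  · exact continuous_const

variable {n : ℕ} {I A : Type*} [Fintype I] [Fintype A] (N : Network n I A)

theorem inner_mulL {f g f' g' : A → ℝ → ℝ} (hf : ∀ α, Continuous (f α))
    (hg : ∀ α, Continuous (g α)) (hf' : ∀ α, Continuous (f' α)) (hg' : ∀ α, Continuous (g' α))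
    (h : ∀ α y, f α y * g α y = f' α y * g' α y) (u v : N.L2) :
    inner ℝ (N.mulL hf u) (N.mulL hg v) = inner ℝ (N.mulL hf' u) (N.mulL hg' v) := by
  rw [inner_eq_sum, inner_eq_sum]
  refine Finset.sum_congr rfl fun α _ => integral_congr_ae ?_
  filter_upwards [N.mulL_param hf u α, N.mulL_param hg v α, N.mulL_param hf' u α,
    N.mulL_param hg' v α] with y h1 h2 h3 h4
  rw [h1, h2, h3, h4]
  calc _ = (f α y * g α y) * (u (N.param α y) * v (N.param α y)) := by ring
    _ = _ := by rw [h]; ring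

theorem mulL_mulL {f g k : A → ℝ → ℝ} (hf : ∀ α, Continuous (f α))
    (hg : ∀ α, Continuous (g α)) (hk : ∀ α, Continuous (k α))
    (h : ∀ α y, f α y * g α y = k α y) (u : N.L2) :
    N.mulL hf (N.mulL hg u) = N.mulL hk u := by
  refine N.ext_param fun α => ?_
  filter_upwards [N.mulL_param hf (N.mulL hg u) α, N.mulL_param hg u α, N.mulL_param hk u α]
    with y h1 h2 h3
  rw [h1, h2, h3, ← h, mul_assoc]

theorem mulL_one {f : A → ℝ → ℝ} (hf : ∀ α, Continuous (f α)) (h : ∀ α y, f α y = 1)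
    (u : N.L2) : N.mulL hf u = u := by
  refine N.ext_param fun α => ?_
  filter_upwards [N.mulL_param hf u α] with y h1
  rw [h1, h, one_mul]

theorem mulL_mulL_cancel {f g : A → ℝ → ℝ} (hf : ∀ α, Continuous (f α))
    (hg : ∀ α, Continuous (g α)) (h : ∀ α y, f α y * g α y = 1) (u : N.L2) :
    N.mulL hf (N.mulL hg u) = u := by
  rw [N.mulL_mulL hf hg (k := fun _ _ => 1) (fun _ => continuous_const) h]
  exact N.mulL_one _ (fun _ _ => rfl) u

/-- The logarithmic slope of the weight on an edge. -/
noncomputable def slope (γ : I → A → ℝ) (α : A) : ℝ :=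
  (Real.log (γ (N.tgt α) α) - Real.log (γ (N.src α) α)) / N.length α

/-- The `c`-th power of the weight that interpolates `γ` log-linearly along the edges. -/
noncomputable def weight (γ : I → A → ℝ) (c : ℝ) (α : A) (y : ℝ) : ℝ :=
  Real.exp (c * (Real.log (γ (N.src α) α) + N.slope γ α * y))

theorem continuous_weight (γ : I → A → ℝ) (c : ℝ) (α : A) : Continuous (N.weight γ c α) := by
  unfold weight; fun_prop

theorem contDiff_weight (γ : I → A → ℝ) (c : ℝ) (α : A) : ContDiff ℝ ∞ (N.weight γ c α) := by
  unfold weight; fun_prop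

theorem deriv_weight (γ : I → A → ℝ) (c : ℝ) (α : A) (y : ℝ) :
    deriv (N.weight γ c α) y = c * N.slope γ α * N.weight γ c α y := by
  have h : HasDerivAt (fun y => c * (Real.log (γ (N.src α) α) + N.slope γ α * y))
      (c * (N.slope γ α * 1)) y :=
    (((hasDerivAt_id y).const_mul _).const_add _).const_mul _
  have := h.exp.deriv
  unfold weight
  rw [this]
  ring

theorem weight_mul (γ : I → A → ℝ) (c d : ℝ) (α : A) (y : ℝ) :
    N.weight γ c α y * N.weight γ d α y = N.weight γ (c + d) α y := by
  unfold weight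
  rw [← Real.exp_add, add_mul]

theorem weight_zero (γ : I → A → ℝ) (α : A) (y : ℝ) : N.weight γ 0 α y = 1 := by
  simp [weight]

theorem weight_endParam {γ : I → A → ℝ} (hγ : ∀ i, ∀ α ∈ N.adj i, 0 < γ i α) {i : I} {α : A}
    (h : α ∈ N.adj i) : N.weight γ 1 α (N.endParam i α) = γ i α := by
  have hp := hγ i α h
  rcases N.vertex_mem_edge i α (N.mem_adj.1 h) with rfl | rfl
  · simp [weight, endParam_src, Real.exp_log hp]
  · rw [endParam_tgt, weight, slope, div_mul_cancel₀ _ (N.length_pos α).ne', one_mul,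
      add_sub_cancel, Real.exp_log hp]

/-- Multiplication of a function and its edgewise derivative by a power of the weight. -/
noncomputable def weightTuple (γ : I → A → ℝ) (c : ℝ) (p : N.L2Tuple 1) : N.L2Tuple 1 :=
  WithLp.toLp 2 (Fin.cons (N.mulL (N.continuous_weight γ c) (p 0)) (fun _ =>
    N.mulL (N.continuous_weight γ c) (p 1) +
    N.mulL (f := fun α y => c * N.slope γ α * N.weight γ c α y)
      (fun α => continuous_const.mul (N.continuous_weight γ c α)) (p 0)))

theorem weightTuple_zero (γ : I → A → ℝ) (c : ℝ) (p : N.L2Tuple 1) :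
    N.weightTuple γ c p 0 = N.mulL (N.continuous_weight γ c) (p 0) := rfl

theorem weightTuple_one (γ : I → A → ℝ) (c : ℝ) (p : N.L2Tuple 1) :
    N.weightTuple γ c p 1 = N.mulL (N.continuous_weight γ c) (p 1) +
      N.mulL (f := fun α y => c * N.slope γ α * N.weight γ c α y)
        (fun α => continuous_const.mul (N.continuous_weight γ c α)) (p 0) := rfl

theorem weightTuple_mem_Hb (γ : I → A → ℝ) (c : ℝ) {p : N.L2Tuple 1} (hp : p ∈ N.Hb 1) :
    N.weightTuple γ c p ∈ N.Hb 1 := by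
  rw [mem_Hb_one] at hp ⊢
  intro α
  refine ((hp α).smul_contDiff (N.integrable_param _ α) (N.integrable_param _ α)
    (N.contDiff_weight γ c α)).congr ?_ ?_
  · filter_upwards [N.mulL_param (N.continuous_weight γ c) (p 0) α] with y hy
    rw [weightTuple_zero, hy, smul_eq_mul]
  · filter_upwards [N.mulL_param (N.continuous_weight γ c) (p 1) α,
      N.mulL_param (f := fun α y => c * N.slope γ α * N.weight γ c α y)
        (fun α => continuous_const.mul (N.continuous_weight γ c α)) (p 0) α,
      N.add_param (N.mulL (N.continuous_weight γ c) (p 1))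
        (N.mulL (f := fun α y => c * N.slope γ α * N.weight γ c α y)
        (fun α => continuous_const.mul (N.continuous_weight γ c α)) (p 0)) α] with y h1 h2 h3
    rw [weightTuple_one, h3, h1, h2, deriv_weight, smul_eq_mul, smul_eq_mul]

theorem trace_weightTuple (γ : I → A → ℝ) (c : ℝ) {p : N.L2Tuple 1} (hp : p ∈ N.Hb 1) (α : A)
    {y : ℝ} (hy : y ∈ Icc 0 (N.length α)) :
    N.trace α y (N.weightTuple γ c p) = N.weight γ c α y * N.trace α y p := by
  refine N.trace_eq_of_continuousOn (N.weightTuple_mem_Hb γ c hp)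
    (g := fun y => N.weight γ c α y * N.trace α y p)
    ((N.continuous_weight γ c α).mul (N.continuous_trace α p)).continuousOn ?_ hy
  filter_upwards [N.mulL_param (N.continuous_weight γ c) (p 0) α, N.mem_Hb_iff_trace.1 hp α]
    with y h1 h2
  rw [weightTuple_zero, h1, h2]

/-- The weight equals `γ_{iα}` at the vertex, so dividing the new trace by `γ_{iα}` returns the old
one, which is common to all adjacent edges. -/
theorem weightTuple_mem_W {γ : I → A → ℝ} (hγ : ∀ i, ∀ α ∈ N.adj i, 0 < γ i α)
    {p : N.L2Tuple 1} (hp : p ∈ N.V) : N.weightTuple γ 1 p ∈ N.W γ := by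
  obtain ⟨h1, h2⟩ := N.mem_V_iff.1 hp
  refine N.mem_W_iff.2 ⟨N.weightTuple_mem_Hb γ 1 h1, fun i α hα β hβ => ?_⟩
  rw [N.trace_weightTuple γ 1 h1 α (N.endParam_mem i α),
    N.trace_weightTuple γ 1 h1 β (N.endParam_mem i β), N.weight_endParam hγ hα,
    N.weight_endParam hγ hβ, mul_div_cancel_left₀ _ (hγ i α hα).ne',
    mul_div_cancel_left₀ _ (hγ i β hβ).ne', h2 i α hα β hβ]

theorem weightTuple_mem_V {γ : I → A → ℝ} (hγ : ∀ i, ∀ α ∈ N.adj i, 0 < γ i α)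
    {p : N.L2Tuple 1} (hp : p ∈ N.W γ) : N.weightTuple γ (-1) p ∈ N.V := by
  obtain ⟨h1, h2⟩ := N.mem_W_iff.1 hp
  have key : ∀ i, ∀ α ∈ N.adj i, N.weight γ (-1) α (N.endParam i α) = (γ i α)⁻¹ := by
    intro i α hα
    have := N.weight_mul γ (-1) 1 α (N.endParam i α)
    rw [neg_add_cancel, weight_zero, N.weight_endParam hγ hα] at this
    exact eq_inv_of_mul_eq_one_left this
  refine N.mem_V_iff.2 ⟨N.weightTuple_mem_Hb γ (-1) h1, fun i α hα β hβ => ?_⟩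
  rw [N.trace_weightTuple γ _ h1 α (N.endParam_mem i α),
    N.trace_weightTuple γ _ h1 β (N.endParam_mem i β), key i α hα, key i β hβ, mul_comm,
    ← div_eq_mul_inv, mul_comm _ (N.trace β _ p), ← div_eq_mul_inv, h2 i α hα β hβ]

theorem weightTuple_weightTuple (γ : I → A → ℝ) (p : N.L2Tuple 1) :
    N.weightTuple γ 1 (N.weightTuple γ (-1) p) = p := by
  have hc := N.continuous_weight γ
  have hs : ∀ c : ℝ, ∀ α, Continuous fun y => c * N.slope γ α * N.weight γ c α y := fun c α =>
    continuous_const.mul (hc c α)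
  have e : ∀ α y, N.weight γ 1 α y * N.weight γ (-1) α y = 1 := fun α y => by
    rw [weight_mul, add_neg_cancel, weight_zero]
  ext k : 1
  fin_cases k
  · exact N.mulL_mulL_cancel _ _ e _
  · change N.mulL (hc 1) (N.mulL (hc (-1)) (p 1) + N.mulL (hs (-1)) (p 0)) +
      N.mulL (hs 1) (N.mulL (hc (-1)) (p 0)) = p 1
    refine N.ext_param fun α => ?_
    filter_upwards [N.add_param (N.mulL (hc 1) (N.mulL (hc (-1)) (p 1) + N.mulL (hs (-1)) (p 0)))
        (N.mulL (hs 1) (N.mulL (hc (-1)) (p 0))) α,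
      N.mulL_param (hc 1) (N.mulL (hc (-1)) (p 1) + N.mulL (hs (-1)) (p 0)) α,
      N.add_param (N.mulL (hc (-1)) (p 1)) (N.mulL (hs (-1)) (p 0)) α,
      N.mulL_param (hc (-1)) (p 1) α, N.mulL_param (hs (-1)) (p 0) α,
      N.mulL_param (hs 1) (N.mulL (hc (-1)) (p 0)) α, N.mulL_param (hc (-1)) (p 0) α]
      with y h1 h2 h3 h4 h5 h6 h7
    rw [h1, h2, h3, h4, h5, h6, h7]
    linear_combination p 1 (N.param α y) * e α y

/-- A test function on an edge and its derivative. -/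
noncomputable def testTuple (α : A) {φ : ℝ → ℝ} (h : ContDiff ℝ ∞ φ) : N.L2Tuple 1 :=
  WithLp.toLp 2 (Fin.cons (N.lift (continuous_single α h.continuous)) (fun _ =>
    N.lift (continuous_single α (h.continuous_deriv (by simp)))))

theorem testTuple_zero (α : A) {φ : ℝ → ℝ} (h : ContDiff ℝ ∞ φ) :
    N.testTuple α h 0 = N.lift (continuous_single α h.continuous) := rfl

theorem testTuple_one (α : A) {φ : ℝ → ℝ} (h : ContDiff ℝ ∞ φ) :
    N.testTuple α h 1 = N.lift (continuous_single α (h.continuous_deriv (by simp))) := rfl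

theorem testTuple_mem_Hb (α : A) {φ : ℝ → ℝ} (h : ContDiff ℝ ∞ φ) :
    N.testTuple α h ∈ N.Hb 1 := by
  rw [mem_Hb_one]
  intro β
  by_cases hβ : β = α
  · subst hβ
    -- The smooth function is regarded as its product with the constant `1`, so the product rule
    -- yields its weak derivative.
    refine ((HasWeakDerivOn.const (N.length_pos β).le (1 : ℝ)).smul_contDiff
      (integrable_const _) (integrable_zero _ _ _) h).congr ?_ ?_
    · filter_upwards [N.lift_param (continuous_single β h.continuous) β] with y hy
      rw [testTuple_zero, hy, single_self, smul_eq_mul, mul_one]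
    · filter_upwards [N.lift_param (continuous_single β (h.continuous_deriv (by simp))) β]
        with y hy
      rw [testTuple_one, hy, single_self]
      simp
  · refine (HasWeakDerivOn.const (N.length_pos β).le (0 : ℝ)).congr ?_ ?_
    · filter_upwards [N.lift_param (continuous_single α h.continuous) β] with y hy
      rw [testTuple_zero, hy, single_of_ne hβ, Pi.zero_apply]
    · filter_upwards [N.lift_param (continuous_single α (h.continuous_deriv (by simp))) β]
        with y hy
      rw [testTuple_one, hy, single_of_ne hβ]

theorem trace_testTuple (α : A) {φ : ℝ → ℝ} (h : ContDiff ℝ ∞ φ)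
    (hs : tsupport φ ⊆ Ioo 0 (N.length α)) (i : I) (β : A) :
    N.trace β (N.endParam i β) (N.testTuple α h) = 0 := by
  rw [N.trace_eq_of_continuousOn (N.testTuple_mem_Hb α h)
    (continuous_single α h.continuous β).continuousOn
    (N.lift_param (continuous_single α h.continuous) β) (N.endParam_mem i β)]
  by_cases hβ : β = α
  · subst hβ
    rw [single_self]
    refine image_eq_zero_of_notMem_tsupport fun hm => ?_
    have := hs hm
    unfold endParam at this
    split_ifs at this
    · exact lt_irrefl _ this.1
    · exact lt_irrefl _ this.2
  · rw [single_of_ne hβ, Pi.zero_apply]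

theorem testTuple_mem_V (α : A) {φ : ℝ → ℝ} (h : ContDiff ℝ ∞ φ)
    (hs : tsupport φ ⊆ Ioo 0 (N.length α)) : N.testTuple α h ∈ N.V :=
  N.mem_V_iff.2 ⟨N.testTuple_mem_Hb α h, fun i β _ δ _ => by
    rw [N.trace_testTuple α h hs, N.trace_testTuple α h hs]⟩

theorem testTuple_mem_W (γ : I → A → ℝ) (α : A) {φ : ℝ → ℝ} (h : ContDiff ℝ ∞ φ)
    (hs : tsupport φ ⊆ Ioo 0 (N.length α)) : N.testTuple α h ∈ N.W γ :=
  N.mem_W_iff.2 ⟨N.testTuple_mem_Hb α h, fun i β _ δ _ => by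
    rw [N.trace_testTuple α h hs, N.trace_testTuple α h hs, zero_div, zero_div]⟩

theorem inner_lift_single (u : N.L2) (α : A) {φ : ℝ → ℝ} (h : Continuous φ) :
    inner ℝ u (N.lift (continuous_single α h)) =
      ∫ y in Ioo 0 (N.length α), φ y * u (N.param α y) := by
  rw [inner_eq_sum, Finset.sum_eq_single α]
  · refine integral_congr_ae ?_
    filter_upwards [N.lift_param (continuous_single α h) α] with y hy
    rw [hy, single_self, mul_comm]
  · intro β _ hβ
    refine integral_eq_zero_of_ae ?_
    filter_upwards [N.lift_param (continuous_single α h) β] with y hy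
    rw [hy, single_of_ne hβ, Pi.zero_apply, mul_zero]
  · simp

theorem eq_zero_of_inner_testTuple {u : N.L2} (hu : ∀ (α : A) (φ : ℝ → ℝ) (h : ContDiff ℝ ∞ φ),
    tsupport φ ⊆ Ioo 0 (N.length α) → inner ℝ u (N.testTuple α h 0) = 0) : u = 0 := by
  refine N.ext_param fun α => ?_
  have h0 : HasWeakDerivOn 0 (N.length α) (0 : ℝ → ℝ) (fun y => u (N.param α y)) := by
    intro ψ h1 h2 h3
    have := hu α ψ h1 h3
    rw [testTuple_zero, N.inner_lift_single u α h1.continuous] at this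
    simp only [smul_eq_mul, this]
    simp
  filter_upwards [h0.eq_zero (N.integrable_param u α), N.zero_param α] with y h1 h2
  rw [h1, h2]

/-- Weak derivatives are unique, so the zeroth component determines the tuple. This is the
injectivity of `V` into `L²(Γ)`. -/
theorem eq_zero_of_mem_Hb {p : N.L2Tuple 1} (hp : p ∈ N.Hb 1) (h : p 0 = 0) : p = 0 := by
  have h1 : p 1 = 0 := by
    refine N.ext_param fun α => ?_
    have h0 : HasWeakDerivOn 0 (N.length α) (0 : ℝ → ℝ) (fun y => p 1 (N.param α y)) := by
      refine (N.mem_Hb_one.1 hp α).congr ?_ (Filter.Eventually.of_forall fun _ => rfl)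
      filter_upwards [N.zero_param α] with y hy
      rw [h, hy, Pi.zero_apply]
    filter_upwards [h0.eq_zero (N.integrable_param _ α), N.zero_param α] with y h1 h2
    rw [h1, h2]
  ext k : 1
  fin_cases k
  · exact h
  · exact h1

end Weight

end Network

/-! ### The weighted energy, the drift and the shift. -/

namespace Network

section Energy

variable {n : ℕ} {I A : Type*} [Fintype I] [Fintype A] (N : Network n I A)

/-- Multiplication by the square root of the weight. -/
noncomputable def rootL (γ : I → A → ℝ) : N.L2 →L[ℝ] N.L2 :=
  N.mulL (N.continuous_weight γ (1 / 2))

/-- Multiplication by the inverse of the square root of the weight. -/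
noncomputable def rootInvL (γ : I → A → ℝ) : N.L2 →L[ℝ] N.L2 :=
  N.mulL (N.continuous_weight γ (-(1 / 2)))

theorem rootInvL_rootL (γ : I → A → ℝ) (u : N.L2) : N.rootInvL γ (N.rootL γ u) = u :=
  N.mulL_mulL_cancel _ _ (fun α y => by rw [weight_mul, neg_add_cancel, weight_zero]) u

theorem rootL_rootInvL (γ : I → A → ℝ) (u : N.L2) : N.rootL γ (N.rootInvL γ u) = u :=
  N.mulL_mulL_cancel _ _ (fun α y => by rw [weight_mul, add_neg_cancel, weight_zero]) u

/-- The embedding of `V` into the weighted `L²(Γ)`, realised in `L²(Γ)`. -/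
noncomputable def embV (γ : I → A → ℝ) : N.V →L[ℝ] N.L2 :=
  (N.rootL γ).comp ((N.comp 0).comp N.V.subtypeL)

theorem embV_apply (γ : I → A → ℝ) (v : N.V) :
    N.embV γ v = N.rootL γ ((v : N.L2Tuple 1) 0) := rfl

/-- The weighted derivative. -/
noncomputable def gradV (μ : A → ℝ) (γ : I → A → ℝ) : N.V →L[ℝ] N.L2 :=
  (N.mulL (f := fun α y => √(μ α) * N.weight γ (1 / 2) α y)
    (fun α => continuous_const.mul (N.continuous_weight γ _ α))).comp
    ((N.comp 1).comp N.V.subtypeL)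

theorem gradV_apply (μ : A → ℝ) (γ : I → A → ℝ) (v : N.V) : N.gradV μ γ v =
    N.mulL (f := fun α y => √(μ α) * N.weight γ (1 / 2) α y)
      (fun α => continuous_const.mul (N.continuous_weight γ _ α)) ((v : N.L2Tuple 1) 1) := rfl

/-- The drift term that is due to the derivative of the weight. -/
noncomputable def driftV (μ : A → ℝ) (γ : I → A → ℝ) : N.V →L[ℝ] N.L2 :=
  (N.mulL (f := fun α y => μ α * N.slope γ α * N.weight γ (1 / 2) α y)
    (fun α => continuous_const.mul (N.continuous_weight γ _ α))).comp
    ((N.comp 1).comp N.V.subtypeL)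

theorem driftV_apply (μ : A → ℝ) (γ : I → A → ℝ) (v : N.V) : N.driftV μ γ v =
    N.mulL (f := fun α y => μ α * N.slope γ α * N.weight γ (1 / 2) α y)
      (fun α => continuous_const.mul (N.continuous_weight γ _ α)) ((v : N.L2Tuple 1) 1) := rfl

/-- The symmetric part of the shifted form. -/
noncomputable def energy (μ : A → ℝ) (γ : I → A → ℝ) (l : ℝ) : N.V →L[ℝ] N.V →L[ℝ] ℝ :=
  (innerSL ℝ).bilinearComp (N.gradV μ γ) (N.gradV μ γ) +
    l • (innerSL ℝ).bilinearComp (N.embV γ) (N.embV γ)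

theorem energy_apply (μ : A → ℝ) (γ : I → A → ℝ) (l : ℝ) (v w : N.V) :
    N.energy μ γ l v w = inner ℝ (N.gradV μ γ v) (N.gradV μ γ w) +
      l * inner ℝ (N.embV γ v) (N.embV γ w) := rfl

theorem energy_symm (μ : A → ℝ) (γ : I → A → ℝ) (l : ℝ) (v w : N.V) :
    N.energy μ γ l v w = N.energy μ γ l w v := by
  rw [energy_apply, energy_apply, real_inner_comm, real_inner_comm (N.embV γ w)]

/-- Multiplication by the inverse factors is bounded on the compact edges, so both components of `v`
are controlled by `gradV` and `embV`. -/
theorem isCoercive_energy {μ : A → ℝ} (hμ : ∀ α, 0 < μ α) (γ : I → A → ℝ) {l : ℝ} (hl : 0 < l) :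
    IsCoercive (N.energy μ γ l) := by
  set G : N.L2 →L[ℝ] N.L2 := N.mulL (f := fun α y => (√(μ α))⁻¹ * N.weight γ (-(1 / 2)) α y)
    (fun α => continuous_const.mul (N.continuous_weight γ _ α))
  have h1 : ∀ v : N.V, ‖(v : N.L2Tuple 1) 1‖ ≤ ‖G‖ * ‖N.gradV μ γ v‖ := fun v => by
    have e : G (N.gradV μ γ v) = (v : N.L2Tuple 1) 1 := by
      rw [gradV_apply]
      refine N.mulL_mulL_cancel _ _ (fun α y => ?_) _
      have hne : √(μ α) ≠ 0 := (Real.sqrt_pos.2 (hμ α)).ne'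
      have := N.weight_mul γ (-(1 / 2)) (1 / 2) α y
      rw [neg_add_cancel, weight_zero] at this
      calc _ = ((√(μ α))⁻¹ * √(μ α)) *
          (N.weight γ (-(1 / 2)) α y * N.weight γ (1 / 2) α y) := by ring
        _ = 1 := by rw [this, inv_mul_cancel₀ hne, one_mul]
    rw [← e]
    exact G.le_opNorm _
  have h0 : ∀ v : N.V, ‖(v : N.L2Tuple 1) 0‖ ≤ ‖N.rootInvL γ‖ * ‖N.embV γ v‖ := fun v => by
    have e : N.rootInvL γ (N.embV γ v) = (v : N.L2Tuple 1) 0 := N.rootInvL_rootL γ _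
    rw [← e]
    exact (N.rootInvL γ).le_opNorm _
  set K := 1 + ‖G‖ ^ 2 + ‖N.rootInvL γ‖ ^ 2 / l
  have hK : 0 < K := by positivity
  refine ⟨K⁻¹, inv_pos.2 hK, fun v => ?_⟩
  rw [energy_apply, real_inner_self_eq_norm_sq, real_inner_self_eq_norm_sq]
  have hn : ‖v‖ * ‖v‖ = ‖(v : N.L2Tuple 1) 0‖ ^ 2 + ‖(v : N.L2Tuple 1) 1‖ ^ 2 := by
    rw [← sq]
    change ‖(v : N.L2Tuple 1)‖ ^ 2 = _
    rw [PiLp.norm_sq_eq_of_L2, Fin.sum_univ_two]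
  rw [mul_assoc, hn, inv_mul_le_iff₀ hK]
  have e0 : ‖(v : N.L2Tuple 1) 0‖ ^ 2 ≤ ‖N.rootInvL γ‖ ^ 2 * ‖N.embV γ v‖ ^ 2 := by
    rw [← mul_pow]; gcongr; exact h0 v
  have e1 : ‖(v : N.L2Tuple 1) 1‖ ^ 2 ≤ ‖G‖ ^ 2 * ‖N.gradV μ γ v‖ ^ 2 := by
    rw [← mul_pow]; gcongr; exact h1 v
  have e2 : K * (‖N.gradV μ γ v‖ ^ 2 + l * ‖N.embV γ v‖ ^ 2) =
      ‖G‖ ^ 2 * ‖N.gradV μ γ v‖ ^ 2 + ‖N.rootInvL γ‖ ^ 2 * ‖N.embV γ v‖ ^ 2 +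
      ((1 + ‖N.rootInvL γ‖ ^ 2 / l) * ‖N.gradV μ γ v‖ ^ 2 +
        (1 + ‖G‖ ^ 2) * (l * ‖N.embV γ v‖ ^ 2)) := by
    simp only [K]; field_simp; ring
  rw [e2]
  have : 0 ≤ (1 + ‖N.rootInvL γ‖ ^ 2 / l) * ‖N.gradV μ γ v‖ ^ 2 +
        (1 + ‖G‖ ^ 2) * (l * ‖N.embV γ v‖ ^ 2) := by positivity
  linarith

/-- The drift coefficient is `√μ_α` times the logarithmic slope, times the coefficient of `gradV`;
the first two factors are constant on each edge. -/
theorem exists_norm_driftV_le {μ : A → ℝ} (hμ : ∀ α, 0 < μ α) (γ : I → A → ℝ) :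
    ∃ C, 0 ≤ C ∧ ∀ v, ‖N.driftV μ γ v‖ ≤ C * ‖N.gradV μ γ v‖ := by
  set G : N.L2 →L[ℝ] N.L2 := N.mulL (f := fun α _ => √(μ α) * N.slope γ α)
    (fun α => continuous_const)
  refine ⟨‖G‖, norm_nonneg _, fun v => ?_⟩
  have e : G (N.gradV μ γ v) = N.driftV μ γ v := by
    rw [gradV_apply, driftV_apply]
    refine N.mulL_mulL _ _ _ (fun α y => ?_) _
    linear_combination N.slope γ α * N.weight γ (1 / 2) α y * Real.mul_self_sqrt (hμ α).le
  rw [← e]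
  exact G.le_opNorm _

/-- For a large shift the drift is small with respect to the symmetric part. -/
theorem exists_shift {μ : A → ℝ} (hμ : ∀ α, 0 < μ α) (γ : I → A → ℝ) :
    ∃ l, 0 < l ∧ ∀ (v : N.V) (x : N.L2), (∀ w, N.energy μ γ l v w = inner ℝ x (N.embV γ w)) →
      ‖N.driftV μ γ v‖ ≤ 1 / 4 * ‖x‖ := by
  obtain ⟨C, hC, hD⟩ := N.exists_norm_driftV_le hμ γ
  -- Testing with `v` gives `l ‖gradV v‖² ≤ ‖x‖²`, so `16 C² ≤ l` yields the factor `1/4`; the added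
  -- `1` keeps `l` positive.
  refine ⟨16 * C ^ 2 + 1, by positivity, fun v x h => ?_⟩
  set l := 16 * C ^ 2 + 1
  have hl : 0 < l := by positivity
  have h1 := h v
  rw [energy_apply, real_inner_self_eq_norm_sq, real_inner_self_eq_norm_sq] at h1
  have h2 := real_inner_le_norm x (N.embV γ v)
  set g := ‖N.gradV μ γ v‖
  set e := ‖N.embV γ v‖
  set m := ‖x‖
  have hg : l * g ^ 2 ≤ m ^ 2 := by
    have e1 : g ^ 2 + l * e ^ 2 ≤ m * e := h1.trans_le h2
    have e2 : l * (g ^ 2 + l * e ^ 2) ≤ l * (m * e) := by gcongr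
    nlinarith [sq_nonneg (l * e - m), sq_nonneg (l * e)]
  refine (hD v).trans (abs_le_of_sq_le_sq' ?_ (by positivity)).2
  have hl' : l * g ^ 2 = 16 * (C ^ 2 * g ^ 2) + g ^ 2 := by simp only [l]; ring
  rw [mul_pow, mul_pow]
  linarith [sq_nonneg g]

theorem form_eq_inner (μ : A → ℝ) (γ : I → A → ℝ) (v : N.V) (w : N.W γ) : N.form μ γ v w =
    inner ℝ (N.mulL (f := fun α _ => μ α) (fun _ => continuous_const) ((v : N.L2Tuple 1) 1))
      ((w : N.L2Tuple 1) 1) := by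
  rw [inner_eq_sum]
  refine Finset.sum_congr rfl fun α _ => integral_congr_ae ?_
  filter_upwards [N.mulL_param (f := fun α _ => μ α) (fun _ => continuous_const)
    ((v : N.L2Tuple 1) 1) α] with y hy
  rw [hy]

theorem toWDual_eq_inner (γ : I → A → ℝ) (u : N.L2) (w : N.W γ) :
    N.toWDual γ u w = inner ℝ u ((w : N.L2Tuple 1) 0) := rfl

/-- The product rule `∂(ρ w) = ρ ∂w + slope · ρ w`, with one factor `√ρ` placed on each side of the
inner product, separates the symmetric part from the drift. -/
theorem form_weightTuple {μ : A → ℝ} (hμ : ∀ α, 0 < μ α) {γ : I → A → ℝ}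
    (hγ : ∀ i, ∀ α ∈ N.adj i, 0 < γ i α) (v w : N.V) :
    N.form μ γ v ⟨N.weightTuple γ 1 w, N.weightTuple_mem_W hγ w.2⟩ =
      inner ℝ (N.gradV μ γ v) (N.gradV μ γ w) + inner ℝ (N.driftV μ γ v) (N.embV γ w) := by
  have hh : ∀ α y, N.weight γ (1 / 2) α y * N.weight γ (1 / 2) α y = N.weight γ 1 α y :=
    fun α y => by rw [weight_mul]; norm_num
  rw [form_eq_inner, weightTuple_one, inner_add_right]
  congr 1
  · rw [gradV_apply, gradV_apply]
    refine N.inner_mulL _ _ _ _ (fun α y => ?_) _ _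
    linear_combination -μ α * hh α y -
      N.weight γ (1 / 2) α y * N.weight γ (1 / 2) α y * Real.mul_self_sqrt (hμ α).le
  · rw [driftV_apply, embV_apply]
    refine N.inner_mulL _ _ _ _ (fun α y => ?_) _ _
    linear_combination -μ α * N.slope γ α * hh α y

theorem toWDual_weightTuple {γ : I → A → ℝ}
    (hγ : ∀ i, ∀ α ∈ N.adj i, 0 < γ i α) (u : N.L2) (w : N.V) :
    N.toWDual γ u ⟨N.weightTuple γ 1 w, N.weightTuple_mem_W hγ w.2⟩ =
      inner ℝ (N.rootL γ u) (N.embV γ w) := by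
  rw [toWDual_eq_inner, weightTuple_zero, embV_apply]
  conv_lhs => rw [← N.mulL_one (f := fun _ _ => 1) (fun _ => continuous_const) (fun _ _ => rfl) u]
  refine N.inner_mulL _ _ _ _ (fun α y => ?_) _ _
  rw [weight_mul]; norm_num

theorem exists_weightTuple_eq {γ : I → A → ℝ} (hγ : ∀ i, ∀ α ∈ N.adj i, 0 < γ i α)
    (w : N.W γ) : ∃ y : N.V, (⟨N.weightTuple γ 1 y, N.weightTuple_mem_W hγ y.2⟩ : N.W γ) = w :=
  ⟨⟨_, N.weightTuple_mem_V hγ w.2⟩, Subtype.ext (N.weightTuple_weightTuple γ _)⟩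

theorem injective_embV (γ : I → A → ℝ) : Function.Injective (N.embV γ) := by
  rw [injective_iff_map_eq_zero]
  intro v hv
  have h0 : (v : N.L2Tuple 1) 0 = 0 := by
    rw [← N.rootInvL_rootL γ ((v : N.L2Tuple 1) 0), ← embV_apply, hv, map_zero]
  exact Subtype.ext (N.eq_zero_of_mem_Hb (N.mem_V_iff.1 v.2).1 h0)

/-- Test functions inside single edges belong to `V`, so an orthogonal element vanishes after
multiplication by the invertible `√ρ`. -/
theorem denseRange_embV (γ : I → A → ℝ) : DenseRange (N.embV γ) := by
  have key : (LinearMap.range (N.embV γ).toLinearMap).topologicalClosure = ⊤ := by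
    rw [Submodule.topologicalClosure_eq_top_iff, Submodule.eq_bot_iff]
    intro u hu
    have h1 : N.rootL γ u = 0 := by
      refine N.eq_zero_of_inner_testTuple fun α φ h hs => ?_
      have h2 : inner ℝ (N.embV γ ⟨_, N.testTuple_mem_V α h hs⟩) u = 0 :=
        (Submodule.mem_orthogonal _ _).1 hu _ ⟨_, rfl⟩
      rw [embV_apply, real_inner_comm] at h2
      rw [← h2]
      conv_lhs => rw [← N.mulL_one (f := fun _ _ => 1) (fun _ => continuous_const) (fun _ _ => rfl)
        (N.testTuple α h 0)]
      conv_rhs => rw [← N.mulL_one (f := fun _ _ => 1) (fun _ => continuous_const)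
        (fun _ _ => rfl) u]
      exact N.inner_mulL _ _ _ _ (fun α y => mul_comm _ _) _ _
    rw [← N.rootInvL_rootL γ u, h1, map_zero]
  intro y
  have : y ∈ (LinearMap.range (N.embV γ).toLinearMap).topologicalClosure := by rw [key]; trivial
  exact this

end Energy

end Network

/-! ### From the abstract equation to the shifted problem on the network. -/

namespace Network

section Parabolic

variable {n : ℕ} {I A : Type*} [Fintype I] [Fintype A] (N : Network n I A)

/-- `toWDual` as a continuous linear map. -/
noncomputable def toWDualL (γ : I → A → ℝ) : N.L2 →L[ℝ] N.WDual γ where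
  toFun := N.toWDual γ
  map_add' u v := by
    ext w
    rw [add_apply, toWDual_eq_inner, toWDual_eq_inner, toWDual_eq_inner, inner_add_left]
  map_smul' c u := by
    ext w
    rw [smul_apply, toWDual_eq_inner, toWDual_eq_inner, real_inner_smul_left]
    rfl
  cont := by
    unfold toWDual
    fun_prop

theorem toWDualL_apply (γ : I → A → ℝ) (u : N.L2) : N.toWDualL γ u = N.toWDual γ u := rfl

/-- The shifted form, as a functional of the first argument. -/
noncomputable def shiftedForm (μ : A → ℝ) (γ : I → A → ℝ) (l : ℝ) (w : N.W γ) : N.V →L[ℝ] ℝ :=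
  (innerSL ℝ ((w : N.L2Tuple 1) 1)).comp
    ((N.mulL (f := fun α _ => μ α) (fun _ => continuous_const)).comp
      ((N.comp 1).comp N.V.subtypeL)) +
  l • (innerSL ℝ ((w : N.L2Tuple 1) 0)).comp ((N.comp 0).comp N.V.subtypeL)

theorem shiftedForm_apply (μ : A → ℝ) (γ : I → A → ℝ) (l : ℝ) (w : N.W γ) (v : N.V) :
    N.shiftedForm μ γ l w v = N.form μ γ v w + l * N.toWDual γ ((v : N.L2Tuple 1) 0) w := by
  rw [form_eq_inner, toWDual_eq_inner, real_inner_comm, real_inner_comm ((w : N.L2Tuple 1) 0)]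
  rfl

theorem shiftedForm_weightTuple {μ : A → ℝ} (hμ : ∀ α, 0 < μ α) {γ : I → A → ℝ}
    (hγ : ∀ i, ∀ α ∈ N.adj i, 0 < γ i α) (l : ℝ) (v y : N.V) :
    N.shiftedForm μ γ l ⟨N.weightTuple γ 1 y, N.weightTuple_mem_W hγ y.2⟩ v =
      N.energy μ γ l v y + inner ℝ (N.driftV μ γ v) (N.embV γ y) := by
  rw [shiftedForm_apply, N.form_weightTuple hμ hγ, N.toWDual_weightTuple hγ, energy_apply,
    ← embV_apply]
  ring

theorem form_smul (μ : A → ℝ) (γ : I → A → ℝ) (c : ℝ) (v : N.V) (w : N.W γ) :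
    N.form μ γ (c • v) w = c * N.form μ γ v w := by
  have h := N.shiftedForm_apply μ γ 0 w (c • v)
  rw [map_smul, N.shiftedForm_apply μ γ 0 w v, zero_mul, zero_mul, add_zero, add_zero,
    smul_eq_mul] at h
  exact h.symm

/-- The tuple of a function in `V` and its second derivative in case the functional
`form v` is `g ∈ L²(Γ)`. -/
noncomputable def secondTuple {μ : A → ℝ} (q : N.V × N.L2) : N.L2Tuple 2 :=
  WithLp.toLp 2 (Fin.cons ((q.1 : N.L2Tuple 1) 0) (Fin.cons ((q.1 : N.L2Tuple 1) 1)
    (fun _ => -N.mulL (f := fun α _ => (μ α)⁻¹) (fun _ => continuous_const) q.2)))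

theorem continuous_secondTuple (μ : A → ℝ) : Continuous (N.secondTuple (μ := μ)) := by
  refine (PiLp.continuous_toLp 2 _).comp (continuous_pi fun k => ?_)
  fin_cases k
  · exact ((N.comp 0).comp N.V.subtypeL).continuous.comp continuous_fst
  · exact ((N.comp 1).comp N.V.subtypeL).continuous.comp continuous_fst
  · exact ((N.mulL (f := fun α _ => (μ α)⁻¹) (fun _ => continuous_const)).continuous.comp
      continuous_snd).neg

theorem exists_norm_secondTuple_le (μ : A → ℝ) : ∃ m, 0 ≤ m ∧ ∀ (v : N.V) (g : N.L2),
    ‖N.secondTuple (μ := μ) (v, g)‖ ≤ ‖v‖ + m * ‖g‖ := by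
  set M : N.L2 →L[ℝ] N.L2 := N.mulL (f := fun α _ => (μ α)⁻¹) (fun _ => continuous_const)
  refine ⟨‖M‖, norm_nonneg _, fun v g => ?_⟩
  have h1 : ‖N.secondTuple (μ := μ) (v, g)‖ ^ 2 = ‖v‖ ^ 2 + ‖M g‖ ^ 2 := by
    have e : ‖v‖ ^ 2 = ‖(v : N.L2Tuple 1) 0‖ ^ 2 + ‖(v : N.L2Tuple 1) 1‖ ^ 2 := by
      change ‖(v : N.L2Tuple 1)‖ ^ 2 = _
      rw [PiLp.norm_sq_eq_of_L2, Fin.sum_univ_two]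
    rw [PiLp.norm_sq_eq_of_L2, Fin.sum_univ_three, e, ← norm_neg (M g)]
    rfl
  have h2 := M.le_opNorm g
  refine le_trans (b := ‖v‖ + ‖M g‖) ?_ (by gcongr)
  refine (abs_le_of_sq_le_sq' ?_ (by positivity)).2
  rw [h1]
  nlinarith [mul_nonneg (norm_nonneg v) (norm_nonneg (M g))]

/-- A test function supported inside one edge lies in `W` without any vertex condition. On it the
identity says that `μ_α ∂v` has weak derivative `-g`. -/
theorem secondTuple_mem_H {μ : A → ℝ} (hμ : ∀ α, 0 < μ α) {γ : I → A → ℝ} {v : N.V} {g : N.L2}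
    (h : ∀ w, N.form μ γ v w = N.toWDual γ g w) : N.secondTuple (μ := μ) (v, g) ∈ N.H 2 := by
  have hv := v.2
  refine ⟨hv.1, ?_⟩
  change ∀ k : Fin 2, _
  rw [Fin.forall_fin_two]
  refine ⟨N.mem_Hb_one.1 hv.2, ?_⟩
  change N.IsEdgeDeriv ((v : N.L2Tuple 1) 1)
    (-N.mulL (f := fun α _ => (μ α)⁻¹) (fun _ => continuous_const) g)
  intro α ψ h1 h2 h3
  have e := h ⟨_, N.testTuple_mem_W γ α h1 h3⟩
  rw [form_eq_inner, toWDual_eq_inner, testTuple_zero, testTuple_one,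
    N.inner_lift_single _ α (h1.continuous_deriv (by simp)),
    N.inner_lift_single _ α h1.continuous] at e
  have e1 : ∫ y in Ioo 0 (N.length α), deriv ψ y *
      N.mulL (f := fun α _ => μ α) (fun _ => continuous_const) ((v : N.L2Tuple 1) 1)
        (N.param α y) = μ α * ∫ y in Ioo 0 (N.length α), deriv ψ y •
          (v : N.L2Tuple 1) 1 (N.param α y) := by
    rw [← integral_const_mul]
    refine integral_congr_ae ?_
    filter_upwards [N.mulL_param (f := fun α _ => μ α) (fun _ => continuous_const)
      ((v : N.L2Tuple 1) 1) α] with y hy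
    rw [hy, smul_eq_mul]
    ring
  have e2 : ∫ y in Ioo 0 (N.length α), ψ y •
      (-N.mulL (f := fun α _ => (μ α)⁻¹) (fun _ => continuous_const) g : N.L2) (N.param α y) =
      -((μ α)⁻¹ * ∫ y in Ioo 0 (N.length α), ψ y * g (N.param α y)) := by
    rw [← integral_const_mul, ← integral_neg]
    refine integral_congr_ae ?_
    filter_upwards [N.mulL_param (f := fun α _ => (μ α)⁻¹) (fun _ => continuous_const) g α,
      N.ae_param (Lp.coeFn_neg (N.mulL (f := fun α _ => (μ α)⁻¹)
        (fun _ => continuous_const) g)) α] with y hy hy'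
    rw [hy', Pi.neg_apply, hy, smul_eq_mul]
    ring
  have hne := (hμ α).ne'
  rw [e2, ← e, neg_neg]
  refine Eq.trans ?_ (congrArg (fun x => (μ α)⁻¹ * x) e1.symm)
  rw [inv_mul_cancel_left₀ hne]

theorem eLpNorm_two_le_of_ae_bound {Ω X Y : Type*} [MeasurableSpace Ω] [NormedAddCommGroup X]
    [NormedAddCommGroup Y] {ν : Measure Ω} [IsFiniteMeasure ν] {u : Ω → X} {g : Ω → Y}
    {B m G : ℝ} (hB : 0 ≤ B) (hm : 0 ≤ m) (hG : 0 ≤ G) (hg : AEStronglyMeasurable g ν)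
    (h : ∀ᵐ t ∂ν, ‖u t‖ ≤ B + m * ‖g t‖) (hgG : eLpNorm g 2 ν ≤ ENNReal.ofReal G) :
    eLpNorm u 2 ν ≤ ENNReal.ofReal (B * √(ν.real univ) + m * G) := by
  have h1 : eLpNorm u 2 ν ≤ eLpNorm ((fun _ => B) + fun t => m • ‖g t‖) 2 ν := by
    refine eLpNorm_mono_ae_real ?_
    filter_upwards [h] with t ht
    simpa using ht
  have h2 : eLpNorm (fun _ : Ω => B) 2 ν ≤ ENNReal.ofReal (B * √(ν.real univ)) := by
    refine (eLpNorm_le_of_ae_bound (Filter.Eventually.of_forall fun _ =>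
      (Real.norm_of_nonneg hB).le)).trans (le_of_eq ?_)
    rw [ENNReal.ofReal_mul hB, mul_comm]
    congr 1
    rw [Real.sqrt_eq_rpow, ← ENNReal.ofReal_rpow_of_nonneg measureReal_nonneg (by norm_num),
      ofReal_measureReal]
    norm_num
  have h3 : eLpNorm (fun t => m • ‖g t‖) 2 ν ≤ ENNReal.ofReal (m * G) := by
    have := eLpNorm_const_smul_le (c := m) (f := fun t => ‖g t‖) (p := 2) (μ := ν)
    refine this.trans ?_
    rw [eLpNorm_norm, ENNReal.ofReal_mul hm, ← Real.enorm_of_nonneg hm]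
    gcongr
  refine h1.trans ((eLpNorm_add_le aestronglyMeasurable_const
    (hg.norm.const_smul m) (by norm_num)).trans ?_)
  rw [ENNReal.ofReal_add (by positivity) (by positivity)]
  exact add_le_add h2 h3

/-- Every `w ∈ W` is `ρ y` with `y ∈ V`, so testing against `W` is the abstract perturbed equation
for `√ρ f` and `√ρ h`. Dividing by `√ρ` returns to the unweighted functions. -/
theorem exists_solution_of_shift {μ : A → ℝ} (hμ : ∀ α, 0 < μ α) {γ : I → A → ℝ}
    (hγ : ∀ i, ∀ α ∈ N.adj i, 0 < γ i α) {l : ℝ} (hl : 0 < l)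
    (hlD : ∀ (v : N.V) (x : N.L2), (∀ w, N.energy μ γ l v w = inner ℝ x (N.embV γ w)) →
      ‖N.driftV μ γ v‖ ≤ 1 / 4 * ‖x‖) (T : ℝ) :
    ∃ C, 0 ≤ C ∧ ∀ (h : Lp N.L2 2 (volume.restrict (Ioo 0 T))) (x : N.V),
      ∃ (f : Lp N.L2 2 (volume.restrict (Ioo 0 T))) (z : BoundedContinuousFunction ℝ N.V),
      (∀ t, (z t : N.L2Tuple 1) 0 = (x : N.L2Tuple 1) 0 +
        tailIntegral (volume.restrict (Ioo 0 T)) N.L2 f t) ∧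
      (∀ᵐ t ∂volume.restrict (Ioo 0 T), ∀ w : N.W γ, N.toWDual γ (f t) w +
        N.shiftedForm μ γ l w (z t) = N.toWDual γ (h t) w) ∧
      ‖f‖ ≤ C * (‖h‖ + ‖x‖) ∧ ‖z‖ ≤ C * (‖h‖ + ‖x‖) := by
  have ha := N.isCoercive_energy hμ γ hl
  obtain ⟨R, hR⟩ := ha.exists_solution (N.embV γ)
  have h₀ : (volume.restrict (Ioo 0 T)) (Iic (0 : ℝ)) = 0 := by
    rw [Measure.restrict_apply measurableSet_Iic]
    have : Iic (0 : ℝ) ∩ Ioo 0 T = ∅ := by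
      ext y; simp only [mem_inter_iff, mem_Iic, mem_Ioo, mem_empty_iff_false, iff_false]
      intro h; linarith [h.1, h.2.1]
    rw [this, measure_empty]
  obtain ⟨C, hC, hsol⟩ := exists_perturbed_solution (ν := volume.restrict (Ioo 0 T))
    (N.energy_symm μ γ l) ha hR (N.denseRange_embV γ) (N.injective_embV γ) h₀
    (D := N.driftV μ γ) (fun x => hlD _ x (hR x))
  refine ⟨(1 + ‖N.rootInvL γ‖) * (C * (1 + ‖N.rootL γ‖)), by positivity, fun h x => ?_⟩
  obtain ⟨f, z, h1, h2, h3, h4⟩ := hsol ((N.rootL γ).compLpL 2 _ h) x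
  have hb : C * (‖(N.rootL γ).compLpL 2 (volume.restrict (Ioo 0 T)) h‖ + ‖x‖) ≤
      C * (1 + ‖N.rootL γ‖) * (‖h‖ + ‖x‖) := by
    rw [mul_assoc]
    have : ‖(N.rootL γ).compLpL 2 (volume.restrict (Ioo 0 T)) h‖ ≤ ‖N.rootL γ‖ * ‖h‖ :=
      ContinuousLinearMap.norm_compLp_le _ _
    gcongr
    nlinarith [norm_nonneg h, norm_nonneg x, norm_nonneg (N.rootL γ)]
  refine ⟨(N.rootInvL γ).compLpL 2 _ f, z, fun t => ?_, ?_, ?_, ?_⟩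
  · have := congrArg (N.rootInvL γ) (h1 t)
    rw [map_add, embV_apply, embV_apply, rootInvL_rootL, rootInvL_rootL] at this
    rw [this, tailIntegral_compLpL]
  · filter_upwards [h2, ContinuousLinearMap.coeFn_compLpL (p := 2)
      (μ := volume.restrict (Ioo 0 T)) (N.rootL γ) h, ContinuousLinearMap.coeFn_compLpL (p := 2)
      (μ := volume.restrict (Ioo 0 T)) (N.rootInvL γ) f] with t e1 e2 e3 w
    obtain ⟨y, rfl⟩ := N.exists_weightTuple_eq hγ w
    rw [N.shiftedForm_weightTuple hμ hγ, N.toWDual_weightTuple hγ, N.toWDual_weightTuple hγ, e3,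
      rootL_rootInvL, ← e2, ← e1 y]
    ring
  · refine (ContinuousLinearMap.norm_compLp_le _ _).trans ?_
    rw [mul_assoc]
    gcongr
    · exact le_add_of_nonneg_left zero_le_one
    · exact h3.trans hb
  · refine h4.trans (hb.trans ?_)
    rw [mul_assoc (1 + _)]
    exact le_mul_of_one_le_left (by positivity) (le_add_of_nonneg_right (norm_nonneg _))

end Parabolic

end Network

/-! ### Weak derivatives with values in a dual space. -/

section WeakDerivativeDual

variable {X E : Type*} [NormedAddCommGroup X] [NormedSpace ℝ X]
  [NormedAddCommGroup E] [NormedSpace ℝ E] {a b : ℝ}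

theorem HasWeakDerivOn.neg {u u' : ℝ → X} (hu : HasWeakDerivOn a b u u') :
    HasWeakDerivOn a b (fun t => -u t) (fun t => -u' t) := by
  intro ψ h1 h2 h3
  simp only [smul_neg, integral_neg, hu ψ h1 h2 h3]

theorem HasWeakDerivOn.sub {u u' v v' : ℝ → X} (hu : HasWeakDerivOn a b u u')
    (hv : HasWeakDerivOn a b v v') (iu : Integrable u (volume.restrict (Ioo a b)))
    (iu' : Integrable u' (volume.restrict (Ioo a b)))
    (iv : Integrable v (volume.restrict (Ioo a b)))
    (iv' : Integrable v' (volume.restrict (Ioo a b))) :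
    HasWeakDerivOn a b (fun t => u t - v t) (fun t => u' t - v' t) := by
  simp only [sub_eq_add_neg]
  exact hu.add hv.neg iu iu' iv.neg iv'.neg

theorem integrable_of_continuousOn_Icc {X : Type*} [NormedAddCommGroup X] {u : ℝ → X} (h : ContinuousOn u (Icc a b)) : Integrable u (volume.restrict (Ioo a b)) :=
  (h.integrableOn_Icc).mono_set Ioo_subset_Icc_self

/-- Evaluation at `w` is continuous on the dual, which reduces the equation in `W'` to scalar
functions of time. -/
theorem HasWeakDerivOn.apply_comp_clm [CompleteSpace X] (L : X →L[ℝ] StrongDual ℝ E) {v : ℝ → X}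
    {d : ℝ → StrongDual ℝ E} (hv : ContinuousOn v (Icc a b))
    (h : HasWeakDerivOn a b (fun t => L (v t)) d) (hd : MemLp d 2 (volume.restrict (Ioo a b)))
    (w : E) : HasWeakDerivOn a b (fun t => L (v t) w) (fun t => d t w) ∧
      Integrable (fun t => L (v t) w) (volume.restrict (Ioo a b)) ∧
      Integrable (fun t => d t w) (volume.restrict (Ioo a b)) := by
  have i1 : Integrable (fun t => L (v t)) (volume.restrict (Ioo a b)) :=
    L.integrable_comp (integrable_of_continuousOn_Icc hv)
  have i2 : Integrable d (volume.restrict (Ioo a b)) := hd.integrable (by norm_num)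
  exact ⟨h.comp_clm i1 i2 (ContinuousLinearMap.apply ℝ ℝ w),
    (ContinuousLinearMap.apply ℝ ℝ w).integrable_comp i1,
    (ContinuousLinearMap.apply ℝ ℝ w).integrable_comp i2⟩

theorem HasWeakDerivOn.clm_dual [CompleteSpace X] (L : X →L[ℝ] StrongDual ℝ E) {v v' : ℝ → X}
    (h : HasWeakDerivOn a b v v') (hv : ContinuousOn v (Icc a b))
    (hd : MemLp v' 2 (volume.restrict (Ioo a b))) :
    HasWeakDerivOn a b (fun t => L (v t)) (fun t => L (v' t)) ∧
      MemLp (fun t => L (v' t)) 2 (volume.restrict (Ioo a b)) :=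
  ⟨h.comp_clm (integrable_of_continuousOn_Icc hv) (hd.integrable (by norm_num)) L,
    L.comp_memLp' hd⟩

end WeakDerivativeDual

/-! ### Uniqueness of weak solutions. -/

namespace Network

section Main

variable {n : ℕ} {I A : Type*} [Fintype I] [Fintype A] (N : Network n I A)

theorem contDiff_exp_mul (c : ℝ) : ContDiff ℝ ∞ fun t : ℝ => Real.exp (c * t) := by fun_prop

theorem deriv_exp_mul (c t : ℝ) :
    deriv (fun t : ℝ => Real.exp (c * t)) t = c * Real.exp (c * t) := by
  have := ((hasDerivAt_id t).const_mul c).exp.deriv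
  simp only [id, mul_one] at this
  rw [this, mul_comm]

theorem tailIntegral_eq_zero {X : Type*} [NormedAddCommGroup X] [NormedSpace ℝ X]
    [CompleteSpace X] (T : ℝ) (f : Lp X 2 (volume.restrict (Ioo 0 T))) :
    tailIntegral (volume.restrict (Ioo 0 T)) X f T = 0 := by
  rw [tailIntegral_apply, Measure.restrict_restrict measurableSet_Ioi]
  have : Ioi T ∩ Ioo 0 T = ∅ := by
    ext y; simp only [mem_inter_iff, mem_Ioi, mem_Ioo, mem_empty_iff_false, iff_false]
    intro h; linarith [h.1, h.2.2]
  rw [this, Measure.restrict_empty, integral_zero_measure]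

/-- The difference of two weak solutions, multiplied by `exp (l t)` and tested with `w`. -/
theorem IsWeakSolution.sub_eq {μ : A → ℝ} {γ : I → A → ℝ} {T : ℝ} (hT : 0 < T)
    {F : ℝ → N.WDual γ} {vT : N.L2} {v₁ v₂ : ℝ → N.L2} (h₁ : N.IsWeakSolution μ γ T F vT v₁)
    (h₂ : N.IsWeakSolution μ γ T F vT v₂) (l : ℝ) :
    ∃ u : Lp N.V 2 (volume.restrict (Ioo 0 T)),
      (∀ᵐ t ∂volume.restrict (Ioo 0 T), (u t : N.L2Tuple 1) 0 =
        Real.exp (l * t) • (v₁ t - v₂ t)) ∧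
      ∀ t ∈ Icc 0 T, ∀ w : N.W γ, N.toWDual γ (Real.exp (l * t) • (v₁ t - v₂ t)) w +
        N.shiftedForm μ γ l w (tailIntegral (volume.restrict (Ioo 0 T)) N.V u t) = 0 := by
  obtain ⟨c₁, ⟨V₁, d₁, hV₁, e₁, hd₁, w₁, eq₁⟩, t₁⟩ := h₁
  obtain ⟨c₂, ⟨V₂, d₂, hV₂, e₂, hd₂, w₂, eq₂⟩, t₂⟩ := h₂
  have hm : MemLp (fun t => Real.exp (l * t) • (V₁ t - V₂ t)) 2 (volume.restrict (Ioo 0 T)) := by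
    obtain ⟨C, hC⟩ := isCompact_Icc.exists_bound_of_continuousOn (s := Icc 0 T)
      (contDiff_exp_mul l).continuous.continuousOn
    refine (hV₁.sub hV₂).of_le_mul (c := C) ?_ ?_
    · exact (contDiff_exp_mul l).continuous.aestronglyMeasurable.smul (hV₁.1.sub hV₂.1)
    · filter_upwards [ae_restrict_mem measurableSet_Ioo] with t ht
      rw [norm_smul]
      have := hC t (Ioo_subset_Icc_self ht)
      exact mul_le_mul_of_nonneg_right this (norm_nonneg _)
  have hu := hm.coeFn_toLp
  set u := hm.toLp _
  have e0 : ∀ᵐ t ∂volume.restrict (Ioo 0 T), (u t : N.L2Tuple 1) 0 =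
      Real.exp (l * t) • (v₁ t - v₂ t) := by
    filter_upwards [hu, e₁, e₂] with t a1 a2 a3
    rw [a1, ← a2, ← a3]
    rfl
  refine ⟨u, e0, ?_⟩
  have key : ∀ w : N.W γ, EqOn (fun t => N.toWDual γ (Real.exp (l * t) • (v₁ t - v₂ t)) w +
      N.shiftedForm μ γ l w (tailIntegral (volume.restrict (Ioo 0 T)) N.V u t))
      (fun _ => 0) (Icc 0 T) := by
    intro w
    obtain ⟨W1, I1, J1⟩ := HasWeakDerivOn.apply_comp_clm (N.toWDualL γ) c₁ w₁ hd₁ w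
    obtain ⟨W2, I2, J2⟩ := HasWeakDerivOn.apply_comp_clm (N.toWDualL γ) c₂ w₂ hd₂ w
    have W3 := ((W1.sub W2 I1 J1 I2 J2).smul_contDiff (I1.sub I2) (J1.sub J2)
      (contDiff_exp_mul l))
    -- On subtracting the two equations `F` cancels; differentiating `exp (l t)` contributes exactly
    -- the shift.
    have W4 : HasWeakDerivOn 0 T (fun t => N.toWDual γ (Real.exp (l * t) • (v₁ t - v₂ t)) w)
        (fun t => N.shiftedForm μ γ l w (u t)) := by
      refine W3.congr (Filter.Eventually.of_forall fun t => ?_) ?_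
      · change Real.exp (l * t) • (N.toWDualL γ (v₁ t) w - N.toWDualL γ (v₂ t) w) =
          N.toWDualL γ (Real.exp (l * t) • (v₁ t - v₂ t)) w
        rw [map_smul, map_sub]
        rfl
      · filter_upwards [hu, e₁, e₂, eq₁, eq₂] with t a1 a2 a3 a4 a5
        change Real.exp (l * t) • (d₁ t w - d₂ t w) + deriv (fun t => Real.exp (l * t)) t •
          (N.toWDualL γ (v₁ t) w - N.toWDualL γ (v₂ t) w) = _
        rw [a1, map_smul, map_sub, shiftedForm_apply, shiftedForm_apply, deriv_exp_mul, a2, a3,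
          toWDualL_apply, toWDualL_apply]
        have b1 := a4 w
        have b2 := a5 w
        simp only [smul_eq_mul]
        linear_combination -Real.exp (l * t) * b1 + Real.exp (l * t) * b2
    have cont : ContinuousOn (fun t => N.toWDual γ (Real.exp (l * t) • (v₁ t - v₂ t)) w)
        (Icc 0 T) := by
      have : ContinuousOn (fun t => Real.exp (l * t) • (v₁ t - v₂ t)) (Icc 0 T) :=
        (contDiff_exp_mul l).continuous.continuousOn.smul (c₁.sub c₂)
      simp only [toWDual_eq_inner]
      exact this.inner continuousOn_const
    have ci : Integrable (fun t => N.shiftedForm μ γ l w (u t)) (volume.restrict (Ioo 0 T)) :=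
      (N.shiftedForm μ γ l w).integrable_comp (Lp.integrable_of_finite u)
    have ce : ∀ t, ∫ s in Ioi t, N.shiftedForm μ γ l w (u s) ∂(volume.restrict (Ioo 0 T)) =
        N.shiftedForm μ γ l w (tailIntegral (volume.restrict (Ioo 0 T)) N.V u t) := fun t =>
      (N.shiftedForm μ γ l w).integral_comp_comm (Lp.integrable_of_finite u).restrict
    obtain ⟨c, hc⟩ := W4.exists_primitive hT (integrable_of_continuousOn_Icc cont) ci
    have hce := eqOn_Icc_of_ae_eq hT (cont.add
      ((N.shiftedForm μ γ l w).continuous.comp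
        (tailIntegral (volume.restrict (Ioo 0 T)) N.V u).continuous).continuousOn)
      (continuousOn_const (c := c)) (by
        filter_upwards [hc] with t ht
        rw [← ht, ce]; rfl)
    -- The constant of integration is read off at `T`, where the terminal values agree and the
    -- backward primitive vanishes.
    have c0 : c = 0 := by
      have h := hce ⟨hT.le, le_rfl⟩
      change N.toWDual γ (Real.exp (l * T) • (v₁ T - v₂ T)) w +
        N.shiftedForm μ γ l w (tailIntegral (volume.restrict (Ioo 0 T)) N.V u T) = c at h
      rw [tailIntegral_eq_zero, map_zero, t₁, t₂, sub_self, smul_zero, toWDual_eq_inner, inner_zero_left,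
        add_zero] at h
      exact h.symm
    rw [c0] at hce
    exact hce
  exact fun t ht w => key w ht

/-- Testing the time-integrated equation with `ρ y` gives the abstract homogeneous equation for the
weighted difference. Equality almost everywhere extends to the closed interval by continuity. -/
theorem IsWeakSolution.eqOn {μ : A → ℝ} (hμ : ∀ α, 0 < μ α) {γ : I → A → ℝ}
    (hγ : ∀ i, ∀ α ∈ N.adj i, 0 < γ i α) {T : ℝ} (hT : 0 < T) {F : ℝ → N.WDual γ} {vT : N.L2}
    {v₁ v₂ : ℝ → N.L2} (h₁ : N.IsWeakSolution μ γ T F vT v₁)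
    (h₂ : N.IsWeakSolution μ γ T F vT v₂) : EqOn v₁ v₂ (Icc 0 T) := by
  obtain ⟨l, hl, hlD⟩ := N.exists_shift hμ γ
  obtain ⟨u, hu, heq⟩ := IsWeakSolution.sub_eq N hT h₁ h₂ l
  have ha := N.isCoercive_energy hμ γ hl
  obtain ⟨R, hR⟩ := ha.exists_solution (N.embV γ)
  have h₀ : (volume.restrict (Ioo 0 T)) (Iic (0 : ℝ)) = 0 := by
    rw [Measure.restrict_apply measurableSet_Iic]
    have : Iic (0 : ℝ) ∩ Ioo 0 T = ∅ := by
      ext y; simp only [mem_inter_iff, mem_Iic, mem_Ioo, mem_empty_iff_false, iff_false]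
      intro h; linarith [h.1, h.2.1]
    rw [this, measure_empty]
  have hu0 : u = 0 := by
    refine eq_zero_of_perturbed_equation (ν := volume.restrict (Ioo 0 T))
      (N.energy_symm μ γ l) ha hR (N.denseRange_embV γ) (N.injective_embV γ) h₀
      (D := N.driftV μ γ) (fun x => hlD _ x (hR x)) u ?_
    filter_upwards [hu, ae_restrict_mem measurableSet_Ioo] with t ht ht' y
    have := heq t (Ioo_subset_Icc_self ht') ⟨_, N.weightTuple_mem_W hγ y.2⟩
    rw [N.shiftedForm_weightTuple hμ hγ, N.toWDual_weightTuple hγ, ← ht, ← embV_apply] at this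
    rw [add_assoc]
    exact this
  refine eqOn_Icc_of_ae_eq hT h₁.1 h₂.1 ?_
  rw [hu0] at hu
  filter_upwards [hu, Lp.coeFn_zero N.V 2 (volume.restrict (Ioo 0 T))] with t h1 h2
  rw [h2] at h1
  have h3 : Real.exp (l * t) • (v₁ t - v₂ t) = 0 := h1.symm
  exact sub_eq_zero.1 ((smul_eq_zero_iff_right (Real.exp_pos _).ne').1 h3)

end Main

end Network

/-! ### Existence, regularity and the estimate. -/

namespace Network

section Main

variable {n : ℕ} {I A : Type*} [Fintype I] [Fintype A] (N : Network n I A)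

theorem aestronglyMeasurable_of_continuous_real {X : Type*} [NormedAddCommGroup X] {u : ℝ → X}
    (hu : Continuous u) (ν : Measure ℝ) : AEStronglyMeasurable u ν :=
  hu.aestronglyMeasurable

theorem memLp_exp_smul {X : Type*} [NormedAddCommGroup X] [NormedSpace ℝ X] {T l : ℝ} (hl : 0 ≤ l)
    {h : ℝ → X} (hh : MemLp h 2 (volume.restrict (Ioo 0 T))) :
    ∃ g : Lp X 2 (volume.restrict (Ioo 0 T)),
      (∀ᵐ t ∂volume.restrict (Ioo 0 T), g t = Real.exp (l * t) • h t) ∧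
      ‖g‖ ≤ Real.exp (l * T) * (eLpNorm h 2 (volume.restrict (Ioo 0 T))).toReal := by
  have hb : ∀ᵐ t ∂volume.restrict (Ioo 0 T),
      ‖Real.exp (l * t) • h t‖ ≤ Real.exp (l * T) * ‖h t‖ := by
    filter_upwards [ae_restrict_mem measurableSet_Ioo] with t ht
    rw [norm_smul, Real.norm_of_nonneg (Real.exp_pos _).le]
    refine mul_le_mul_of_nonneg_right (Real.exp_le_exp.2 ?_) (norm_nonneg _)
    exact mul_le_mul_of_nonneg_left ht.2.le hl
  have hm : MemLp (fun t => Real.exp (l * t) • h t) 2 (volume.restrict (Ioo 0 T)) :=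
    hh.of_le_mul ((contDiff_exp_mul l).continuous.aestronglyMeasurable.smul hh.1) hb
  refine ⟨hm.toLp _, hm.coeFn_toLp, ?_⟩
  rw [Lp.norm_toLp]
  have h1 := eLpNorm_le_mul_eLpNorm_of_ae_le_mul hb 2
  refine (ENNReal.toReal_mono (ENNReal.mul_ne_top ENNReal.ofReal_ne_top hh.2.ne) h1).trans ?_
  rw [ENNReal.toReal_mul, ENNReal.toReal_ofReal (Real.exp_pos _).le]

theorem exists_strong_solution {μ : A → ℝ} (hμ : ∀ α, 0 < μ α) {γ : I → A → ℝ}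
    (hγ : ∀ i, ∀ α ∈ N.adj i, 0 < γ i α) {T : ℝ} (hT : 0 < T) :
    ∃ K, 0 ≤ K ∧ ∀ (vT : N.V) (h : ℝ → N.L2), MemLp h 2 (volume.restrict (Ioo 0 T)) →
      ∃ (vV : ℝ → N.V) (v' : ℝ → N.L2), Continuous vV ∧
        (vV T : N.L2Tuple 1) 0 = (vT : N.L2Tuple 1) 0 ∧
        MemLp v' 2 (volume.restrict (Ioo 0 T)) ∧
        HasWeakDerivOn 0 T (fun t => (vV t : N.L2Tuple 1) 0) v' ∧
        (∀ᵐ t ∂volume.restrict (Ioo 0 T), ∀ w : N.W γ,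
          -(N.toWDual γ (v' t) w) + N.form μ γ (vV t) w = N.toWDual γ (h t) w) ∧
        (∀ t ∈ Ioo 0 T, ‖vV t‖ ≤
          K * ((eLpNorm h 2 (volume.restrict (Ioo 0 T))).toReal + ‖vT‖)) ∧
        eLpNorm v' 2 (volume.restrict (Ioo 0 T)) ≤ ENNReal.ofReal
          (K * ((eLpNorm h 2 (volume.restrict (Ioo 0 T))).toReal + ‖vT‖)) := by
  obtain ⟨l, hl, hlD⟩ := N.exists_shift hμ γ
  obtain ⟨C, hC, hsol⟩ := N.exists_solution_of_shift hμ hγ hl hlD T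
  set q := √((volume.restrict (Ioo 0 T)).real univ)
  have hq : 0 ≤ q := Real.sqrt_nonneg _
  -- The exponential bounds the shifted data. The term `l * q` is the `L²` cost of the zeroth-order
  -- part `l v` of the time derivative, bounded uniformly in time.
  refine ⟨C * Real.exp (l * T) * (1 + l * q), by positivity, fun vT h hh => ?_⟩
  obtain ⟨g, hg, hgn⟩ := memLp_exp_smul hl.le hh
  -- The factor on the terminal datum cancels against `exp (-l T)` when the shift is undone.
  obtain ⟨f, z, h0, heq, hf, hz⟩ := hsol g (Real.exp (l * T) • vT)
  set R := (eLpNorm h 2 (volume.restrict (Ioo 0 T))).toReal + ‖vT‖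
  have hR : 0 ≤ R := by positivity
  have hb : C * (‖g‖ + ‖Real.exp (l * T) • vT‖) ≤ C * Real.exp (l * T) * R := by
    rw [norm_smul, Real.norm_of_nonneg (Real.exp_pos _).le, mul_assoc]
    refine mul_le_mul_of_nonneg_left ?_ hC
    rw [mul_add]
    exact add_le_add_left hgn _
  have hf' := hf.trans hb
  have hz' := hz.trans hb
  set S := C * Real.exp (l * T) * R
  have hS : 0 ≤ S := by positivity
  have hKS : C * Real.exp (l * T) * (1 + l * q) * R = S + l * S * q := by
    simp only [S]; ring
  have he : ∀ t ∈ Ioo 0 T, Real.exp (-l * t) ≤ 1 := fun t ht =>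
    Real.exp_le_one_iff.2 (by nlinarith [ht.1])
  have hV : ∀ t ∈ Ioo 0 T, ‖Real.exp (-l * t) • z t‖ ≤ S := fun t ht => by
    rw [norm_smul, Real.norm_of_nonneg (Real.exp_pos _).le]
    exact (mul_le_of_le_one_left (norm_nonneg _) (he t ht)).trans
      ((z.norm_coe_le_norm t).trans hz')
  have hVc : Continuous fun t => Real.exp (-l * t) • z t :=
    (contDiff_exp_mul (-l)).continuous.smul z.continuous
  have h0c : Continuous fun t => ((Real.exp (-l * t) • z t : N.V) : N.L2Tuple 1) 0 :=
    ((N.comp 0).comp N.V.subtypeL).continuous.comp hVc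
  have hVn : ∀ v : N.V, ‖(v : N.L2Tuple 1) 0‖ ≤ ‖v‖ := fun v => PiLp.norm_apply_le _ 0
  have hfi : Integrable f (volume.restrict (Ioo 0 T)) := Lp.integrable_of_finite f
  -- Differentiating `v = exp (-l t) z` with `∂ₜz = -f` gives both terms.
  set v' : ℝ → N.L2 := fun t => -(Real.exp (-l * t) • f t) -
    l • ((Real.exp (-l * t) • z t : N.V) : N.L2Tuple 1) 0
  have hv's : AEStronglyMeasurable v' (volume.restrict (Ioo 0 T)) :=
    (((contDiff_exp_mul (-l)).continuous.aestronglyMeasurable.smul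
      (Lp.aestronglyMeasurable f)).neg).sub (h0c.const_smul l).aestronglyMeasurable
  have hv'n : eLpNorm v' 2 (volume.restrict (Ioo 0 T)) ≤
      ENNReal.ofReal (l * S * q + 1 * S) := by
    refine eLpNorm_two_le_of_ae_bound (g := f) (by positivity) zero_le_one hS
      (Lp.aestronglyMeasurable f) ?_ ?_
    · filter_upwards [ae_restrict_mem measurableSet_Ioo] with t ht
      refine (norm_sub_le _ _).trans ?_
      rw [norm_neg, norm_smul, norm_smul l, Real.norm_of_nonneg (Real.exp_pos _).le,
        Real.norm_of_nonneg hl.le, add_comm]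
      refine add_le_add (mul_le_mul_of_nonneg_left ((hVn _).trans (hV t ht)) hl.le)
        (mul_le_mul_of_nonneg_right (he t ht) (norm_nonneg _))
    · rw [← ENNReal.ofReal_toReal (Lp.eLpNorm_ne_top f), ← Lp.norm_def]
      exact ENNReal.ofReal_le_ofReal hf'
  refine ⟨fun t => Real.exp (-l * t) • z t, v', hVc, ?_, ⟨hv's, hv'n.trans_lt
    ENNReal.ofReal_lt_top⟩, ?_, ?_, fun t ht => (hV t ht).trans ?_, hv'n.trans
    (le_of_eq (by rw [hKS, one_mul, add_comm]))⟩
  · change Real.exp (-l * T) • (z T : N.L2Tuple 1) 0 = _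
    rw [h0, tailIntegral_eq_zero, add_zero]
    change Real.exp (-l * T) • Real.exp (l * T) • (vT : N.L2Tuple 1) 0 = _
    rw [smul_smul, ← Real.exp_add]
    simp
  · have c1 : Continuous fun t => ∫ s in Ioi t, f s ∂(volume.restrict (Ioo 0 T)) :=
      continuous_integral_Ioi hfi
    have d1 := (HasWeakDerivOn.const hT.le (((Real.exp (l * T) • vT : N.V) : N.L2Tuple 1) 0)).add
      (HasWeakDerivOn.integral_Ioi hfi) (integrable_const _) (integrable_zero _ _ _)
      (integrable_of_continuousOn_Icc c1.continuousOn) hfi.neg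
    have d2 := d1.smul_contDiff
      (integrable_of_continuousOn_Icc (continuous_const.add c1).continuousOn)
      ((integrable_zero _ _ _).add hfi.neg) (contDiff_exp_mul (-l))
    refine d2.congr (Filter.Eventually.of_forall fun t => ?_)
      (Filter.Eventually.of_forall fun t => ?_)
    · change _ = Real.exp (-l * t) • (z t : N.L2Tuple 1) 0
      rw [h0, tailIntegral_apply]
    · change _ = -(Real.exp (-l * t) • f t) - l • Real.exp (-l * t) • (z t : N.L2Tuple 1) 0
      rw [h0, tailIntegral_apply, deriv_exp_mul, Pi.zero_apply, zero_add, smul_neg, mul_smul,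
        neg_smul, sub_eq_add_neg]
  · filter_upwards [hg, heq] with t h1 h2 w
    have h3 := h2 w
    rw [h1, shiftedForm_apply, toWDual_eq_inner, toWDual_eq_inner, toWDual_eq_inner,
      real_inner_smul_left] at h3
    rw [form_smul, toWDual_eq_inner, toWDual_eq_inner]
    change -inner ℝ (-(Real.exp (-l * t) • f t) -
      l • Real.exp (-l * t) • (z t : N.L2Tuple 1) 0) _ + _ = _
    rw [inner_sub_left, inner_neg_left, real_inner_smul_left, real_inner_smul_left,
      real_inner_smul_left]
    have h4 : Real.exp (-l * t) * Real.exp (l * t) = 1 := by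
      rw [← Real.exp_add]; simp
    linear_combination Real.exp (-l * t) * h3 +
      inner ℝ (h t) ((w : N.L2Tuple 1) 0) * h4
  · rw [hKS]
    exact le_add_of_nonneg_right (by positivity)

theorem isWeakSolution_of_strong {μ : A → ℝ} {γ : I → A → ℝ} {T : ℝ} {vT : N.V}
    {h v' : ℝ → N.L2} {vV : ℝ → N.V} (hc : Continuous vV)
    (h0 : (vV T : N.L2Tuple 1) 0 = (vT : N.L2Tuple 1) 0)
    (hm : MemLp v' 2 (volume.restrict (Ioo 0 T)))
    (hd : HasWeakDerivOn 0 T (fun t => (vV t : N.L2Tuple 1) 0) v')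
    (he : ∀ᵐ t ∂volume.restrict (Ioo 0 T), ∀ w : N.W γ,
      -(N.toWDual γ (v' t) w) + N.form μ γ (vV t) w = N.toWDual γ (h t) w) :
    N.IsWeakSolution μ γ T (fun t => N.toWDual γ (h t)) ((vT : N.L2Tuple 1) 0)
      (fun t => (vV t : N.L2Tuple 1) 0) := by
  have h0c : Continuous fun t => (vV t : N.L2Tuple 1) 0 :=
    ((N.comp 0).comp N.V.subtypeL).continuous.comp hc
  obtain ⟨d1, d2⟩ := hd.clm_dual (N.toWDualL γ) h0c.continuousOn hm
  refine ⟨h0c.continuousOn, ⟨vV, fun t => N.toWDual γ (v' t), ?_,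
    Filter.Eventually.of_forall fun _ => rfl, d2, d1, he⟩, h0⟩
  obtain ⟨C, hC⟩ := isCompact_Icc.exists_bound_of_continuousOn (s := Icc 0 T) hc.continuousOn
  refine MemLp.of_bound (aestronglyMeasurable_of_continuous_real hc _) C ?_
  filter_upwards [ae_restrict_mem measurableSet_Ioo] with t ht
  exact hC t (Ioo_subset_Icc_self ht)

theorem exists_H_two {μ : A → ℝ} (hμ : ∀ α, 0 < μ α) (γ : I → A → ℝ) :
    ∃ m, 0 ≤ m ∧ ∀ (T : ℝ) (vV : ℝ → N.V) (g : ℝ → N.L2), Continuous vV →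
      AEStronglyMeasurable g (volume.restrict (Ioo 0 T)) →
      (∀ᵐ t ∂volume.restrict (Ioo 0 T), ∀ w : N.W γ,
        N.form μ γ (vV t) w = N.toWDual γ (g t) w) →
      ∃ vH : ℝ → N.H 2, AEStronglyMeasurable vH (volume.restrict (Ioo 0 T)) ∧
        (∀ᵐ t ∂volume.restrict (Ioo 0 T),
          (vH t : N.L2Tuple 2) 0 = (vV t : N.L2Tuple 1) 0) ∧
        ∀ᵐ t ∂volume.restrict (Ioo 0 T), ‖vH t‖ ≤ ‖vV t‖ + m * ‖g t‖ := by
  classical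
  obtain ⟨m, hm, hmb⟩ := N.exists_norm_secondTuple_le μ
  refine ⟨m, hm, fun T vV g hc hg he => ?_⟩
  -- The value `0` is used only on a null set of times. Measurability comes from the embedding into
  -- tuples, where `vH` agrees almost everywhere with a continuous function of `(vV, g)`.
  set vH : ℝ → N.H 2 := fun t =>
    if hx : N.secondTuple (μ := μ) (vV t, g t) ∈ N.H 2 then ⟨_, hx⟩ else 0
  have hH : ∀ᵐ t ∂volume.restrict (Ioo 0 T),
      (vH t : N.L2Tuple 2) = N.secondTuple (μ := μ) (vV t, g t) := by
    filter_upwards [he] with t ht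
    simp only [vH, dif_pos (N.secondTuple_mem_H hμ ht)]
  refine ⟨vH, ?_, ?_, ?_⟩
  · rw [← Topology.IsEmbedding.subtypeVal.aestronglyMeasurable_comp_iff]
    exact ((N.continuous_secondTuple μ).comp_aestronglyMeasurable
      ((aestronglyMeasurable_of_continuous_real hc _).prodMk hg)).congr (by
        filter_upwards [hH] with t ht
        exact ht.symm)
  · filter_upwards [hH] with t ht
    rw [ht]
    rfl
  · filter_upwards [hH] with t ht
    change ‖(vH t : N.L2Tuple 2)‖ ≤ _
    rw [ht]
    exact hmb _ _

theorem exists_regular_solution {μ : A → ℝ} (hμ : ∀ α, 0 < μ α) {γ : I → A → ℝ}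
    (hγ : ∀ i, ∀ α ∈ N.adj i, 0 < γ i α) {T : ℝ} (hT : 0 < T) :
    ∃ C : ℝ≥0, 0 < C ∧ ∀ (vT : N.V) (h : ℝ → N.L2), MemLp h 2 (volume.restrict (Ioo 0 T)) →
      ∃ (vV : ℝ → N.V) (vH : ℝ → N.H 2) (v' : ℝ → N.L2),
        N.IsWeakSolution μ γ T (fun t => N.toWDual γ (h t)) ((vT : N.L2Tuple 1) 0)
          (fun t => (vV t : N.L2Tuple 1) 0) ∧
        Continuous vV ∧
        MemLp vH 2 (volume.restrict (Ioo 0 T)) ∧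
        (∀ᵐ t ∂volume.restrict (Ioo 0 T),
          (vH t : N.L2Tuple 2) 0 = (vV t : N.L2Tuple 1) 0) ∧
        MemLp v' 2 (volume.restrict (Ioo 0 T)) ∧
        HasWeakDerivOn 0 T (fun t => (vV t : N.L2Tuple 1) 0) v' ∧
        eLpNorm vV ∞ (volume.restrict (Ioo 0 T)) + eLpNorm vH 2 (volume.restrict (Ioo 0 T)) +
            eLpNorm v' 2 (volume.restrict (Ioo 0 T)) ≤
          C * (eLpNorm h 2 (volume.restrict (Ioo 0 T)) + ‖vT‖ₑ) := by
  obtain ⟨K, hK, hsol⟩ := N.exists_strong_solution hμ hγ hT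
  obtain ⟨m, hm, hH2⟩ := N.exists_H_two hμ γ
  set q := √((volume.restrict (Ioo 0 T)).real univ)
  have hq : 0 ≤ q := Real.sqrt_nonneg _
  -- The summands bound, in order, the `L^∞(V)` norm, the `L²(H²)` norm and the `L²` norm of the
  -- time derivative; the last `1` ensures positivity.
  set M : ℝ := K + (K * q + m * (1 + K)) + K + 1
  have hM : 0 < M := by positivity
  refine ⟨M.toNNReal, Real.toNNReal_pos.2 hM, fun vT h hh => ?_⟩
  obtain ⟨vV, v', hc, h0, hm', hd, he, hV, hv'⟩ := hsol vT h hh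
  set R := (eLpNorm h 2 (volume.restrict (Ioo 0 T))).toReal + ‖vT‖
  have hR : 0 ≤ R := by positivity
  have hRe : eLpNorm h 2 (volume.restrict (Ioo 0 T)) + ‖vT‖ₑ = ENNReal.ofReal R := by
    rw [ENNReal.ofReal_add ENNReal.toReal_nonneg (norm_nonneg _), ENNReal.ofReal_toReal hh.2.ne,
      ofReal_norm]
  have hhR : eLpNorm h 2 (volume.restrict (Ioo 0 T)) ≤ ENNReal.ofReal R :=
    hRe ▸ le_self_add
  -- With the time derivative in `L²`, the equation is elliptic at almost every time, with
  -- right-hand side `h + ∂ₜv`.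
  have hg : MemLp (h + v') 2 (volume.restrict (Ioo 0 T)) := hh.add hm'
  have hgn : eLpNorm (h + v') 2 (volume.restrict (Ioo 0 T)) ≤ ENNReal.ofReal ((1 + K) * R) := by
    rw [add_mul, one_mul, ENNReal.ofReal_add hR (by positivity)]
    exact (eLpNorm_add_le hh.1 hm'.1 (by norm_num)).trans (add_le_add hhR hv')
  obtain ⟨vH, hs, hH0, hHb⟩ := hH2 T vV (h + v') hc hg.1 (by
    filter_upwards [he] with t ht w
    have := ht w
    rw [toWDual_eq_inner, toWDual_eq_inner] at this
    rw [toWDual_eq_inner, Pi.add_apply, inner_add_left]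
    linear_combination this)
  have nV : eLpNorm vV ∞ (volume.restrict (Ioo 0 T)) ≤ ENNReal.ofReal (K * R) := by
    rw [eLpNorm_exponent_top]
    refine eLpNormEssSup_le_of_ae_bound ?_
    filter_upwards [ae_restrict_mem measurableSet_Ioo] with t ht
    exact hV t ht
  have nH : eLpNorm vH 2 (volume.restrict (Ioo 0 T)) ≤
      ENNReal.ofReal (K * R * q + m * ((1 + K) * R)) := by
    refine eLpNorm_two_le_of_ae_bound (g := h + v') (by positivity) hm (by positivity) hg.1 ?_ hgn
    filter_upwards [hHb, ae_restrict_mem measurableSet_Ioo] with t h1 h2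
    exact h1.trans (add_le_add_left (hV t h2) _)
  refine ⟨vV, vH, v', N.isWeakSolution_of_strong hc h0 hm' hd he, hc,
    ⟨hs, nH.trans_lt ENNReal.ofReal_lt_top⟩, hH0, hm', hd, ?_⟩
  refine (add_le_add (add_le_add nV nH) hv').trans ?_
  rw [hRe, ← ENNReal.ofReal_add (by positivity) (by positivity),
    ← ENNReal.ofReal_add (by positivity) (by positivity)]
  change _ ≤ ENNReal.ofReal M * ENNReal.ofReal R
  rw [← ENNReal.ofReal_mul hM.le]
  refine ENNReal.ofReal_le_ofReal ?_
  have : M * R = K * R + (K * R * q + m * ((1 + K) * R)) + K * R + R := by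
    simp only [M]; ring
  rw [this]
  exact le_add_of_nonneg_right hR

end Main

end Network

theorem mainTheorem6 {n : ℕ} {I A : Type*} [Fintype I] [Fintype A] (N : Network n I A)
    (μ : A → ℝ) (γ : I → A → ℝ) (T : ℝ)
    (hμ : ∀ α, 0 < μ α)
    (hγ : ∀ i, ∀ α ∈ N.adj i, 0 < γ i α)
    (hγμ : ∀ i, ∑ α ∈ N.adj i, γ i α * μ α = 1)
    (hT : 0 < T) :
    ∃ C : ℝ≥0, 0 < C ∧
      ∀ (vT : N.V) (h : ℝ → N.L2), MemLp h 2 (volume.restrict (Ioo 0 T)) →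
        -- there is exactly one weak solution
        (∃ v : ℝ → N.L2, N.IsWeakSolution μ γ T (fun t => N.toWDual γ (h t))
          ((vT : N.L2Tuple 1) 0) v) ∧
        (∀ v₁ v₂ : ℝ → N.L2,
          N.IsWeakSolution μ γ T (fun t => N.toWDual γ (h t)) ((vT : N.L2Tuple 1) 0) v₁ →
          N.IsWeakSolution μ γ T (fun t => N.toWDual γ (h t)) ((vT : N.L2Tuple 1) 0) v₂ →
          EqOn v₁ v₂ (Icc 0 T)) ∧
        -- and it is in `C([0,T]; V)` and `L²(0,T; H²)`, with `∂ₜv` in `L²(0,T; L²)`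
        ∀ v : ℝ → N.L2,
          N.IsWeakSolution μ γ T (fun t => N.toWDual γ (h t)) ((vT : N.L2Tuple 1) 0) v →
          ∃ (vV : ℝ → N.V) (vH : ℝ → N.H 2) (v' : ℝ → N.L2),
            ContinuousOn vV (Icc 0 T) ∧
            (∀ t ∈ Icc 0 T, (vV t : N.L2Tuple 1) 0 = v t) ∧
            MemLp vH 2 (volume.restrict (Ioo 0 T)) ∧
            (∀ᵐ t ∂volume.restrict (Ioo 0 T), (vH t : N.L2Tuple 2) 0 = v t) ∧
            MemLp v' 2 (volume.restrict (Ioo 0 T)) ∧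
            HasWeakDerivOn 0 T v v' ∧
            eLpNorm vV ∞ (volume.restrict (Ioo 0 T)) + eLpNorm vH 2 (volume.restrict (Ioo 0 T)) +
                eLpNorm v' 2 (volume.restrict (Ioo 0 T)) ≤
              C * (eLpNorm h 2 (volume.restrict (Ioo 0 T)) + ‖vT‖ₑ) := by
  obtain ⟨C, hC, hreg⟩ := N.exists_regular_solution hμ hγ hT
  refine ⟨C, hC, fun vT h hh => ?_⟩
  obtain ⟨vV, vH, v', hw, hc, hH, hH0, hm', hd, hb⟩ := hreg vT h hh
  refine ⟨⟨_, hw⟩, fun v₁ v₂ h₁ h₂ => Network.IsWeakSolution.eqOn N hμ hγ hT h₁ h₂, fun v hv => ?_⟩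
  -- By uniqueness an arbitrary weak solution is the regular one, so the regularity and the bound
  -- transfer to it.
  have heq : EqOn (fun t => (vV t : N.L2Tuple 1) 0) v (Icc 0 T) :=
    Network.IsWeakSolution.eqOn N hμ hγ hT hw hv
  have hae : ∀ᵐ t ∂volume.restrict (Ioo 0 T), (vV t : N.L2Tuple 1) 0 = v t := by
    filter_upwards [ae_restrict_mem measurableSet_Ioo] with t ht
    exact heq (Ioo_subset_Icc_self ht)
  refine ⟨vV, vH, v', hc.continuousOn, heq, hH, ?_, hm', ?_, hb⟩
  · filter_upwards [hH0, hae] with t h1 h2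
    rw [h1, h2]
  · exact hd.congr hae (Filter.Eventually.of_forall fun _ => rfl)
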